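/- **Conventions.** A substitution on a finite nonempty alphabet $\mathcal A$ is a map $\phi$ from $\mathcal A$ to the nonempty finite words over $\mathcal A$; maps from letters to words (morphisms) are extended to words by concatenation. The abelianization of a morphism $\rho$ is the matrix whose $(i,j)$ entry is the number of occurrences of the letter $i$ in $\rho(j)$. Let $A$ be the abelianization of $\phi$ and $\lambda$ its Perron–Frobenius eigenvalue (the one with a positive eigenvector). All substitutions are primitive (some power of $A$ is positive) and aperiodic (no element of the tiling space $\mathcal T_\phi$ defined below is periodic under translation). $\phi$ is Pisot if $\lambda$ is a Pisot number, i.e. $\lambda>1$ is an algebraic integer whose other conjugates have modulus $<1$. *Rewriting.* Let $\mathcal L_\phi$ be the set of nonempty factors of the words $\phi^n(i)$, and $X_\phi$ the set of bi-infinite words all of whose nonempty finite factors are in $\mathcal L_\phi$. Suppose $w_1,\dots,w_k\in\mathcal L_\phi$ are distinct words such that each $x\in X_\phi$ factors uniquely (that is, with a unique set of cutting points) into words $w_i$, and each $\phi(w_i)$ factors uniquely as $w_{i_1}\cdots w_{i_\ell}$. Then the substitution $\phi'(i)=i_1\cdots i_\ell$ is a rewriting of $\phi$, with rewriting morphism $\rho(i)=w_i$.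 *Strands and tiling space.* Let $\mu$ be the minimal polynomial of $\lambda$ over $\mathbb Q$, let $V=\ker \mu(A)$ be the Pisot subspace of $\mathbb R^{\mathcal A}$, $W$ its $A$-invariant complement (the range of $\mu(A)$), $\mathrm{pr}_V$ the projection onto $V$ along $W$, $v_i=\mathrm{pr}_V e_i$, $\Gamma=\mathrm{pr}_V\mathbb Z^{\mathcal A}$, $\omega\in V$ a positive eigenvector of $A$ for $\lambda$, and $\mathbb E^u=\mathbb R\omega$. An edge of type $i$ with initial vertex $\min I=x\in V$ is the labelled segment $I=\sigma_i+x$, where $\sigma_i=[0,v_i]$. A bi-infinite strand in $V$ is a bi-infinite sequence of edges meeting tip to tail, regarded as a set of labelled edges. Two strands are close if a translate of one by a small vector of $V$ agrees with the other, with labels, in a large ball around the origin. A morphism $\rho:\mathcal A'\to\mathcal A^*$ with abelianization $P$ induces the map $\overline\rho$ that replaces each edge $\sigma'_i+x$ by the edges $\sigma_{i_k}+Px+v_{i_1}+\cdots+v_{i_{k-1}}$, $1\le k\le \ell$, where $\rho(i)=i_1\cdots i_\ell$; for $\rho=\phi$ this is inflation and substitution $\Phi$. Let $\mathcal F^R$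 be the set of bi-infinite strands within distance $R$ of $\mathbb E^u$ and $\mathcal F_\phi=\bigcap_{n\ge0}\Phi^n(\mathcal F^R)$ for any large $R$. The tiling space $\mathcal T_\phi$ is the $\omega$-limit set $\bigcap_{T>0}\mathrm{cl}\{\gamma-t\omega:t\ge T\}$ of any $\gamma\in\mathcal F_\phi$. The map $\Phi:\mathcal T_\phi\to\mathcal T_\phi$ is a homeomorphism. *Return lattice.* $\Theta(i)$ is the set of $v\in\Gamma$ such that some $\gamma\in\mathcal T_\phi$ has edges $I$ and $I+v$, both of type $i$. The group $\Sigma_\infty$ generated by $\bigcup_{k\in\mathbb Z}(A|_V)^k\Theta(i)$ does not depend on $i$. The return lattice is $\Sigma=\Sigma_\infty\cap\Gamma$. *Solenoids and shift equivalence.* A map $T:(V,\Sigma)\to(V',\Sigma')$ is a linear map $V\to V'$ with $T\Sigma\subset\Sigma'$; it induces $F_T:V/\Sigma\to V'/\Sigma'$. Let $\varprojlim F_{A|_V}=\{(z_k)_{k\ge0}: z_k\in V/\Sigma,\ F_{A|_V}z_{k+1}=z_k\}$. Maps $T:(V,\Sigma)\to(V',\Sigma')$ and $S:(V',\Sigma')\to(V,\Sigma)$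 express a shift equivalence of $A|_V$ and $A'|_{V'}$ if $A'T=TA$, $AS=SA'$, $ST=(A|_V)^p$ and $TS=(A'|_{V'})^q$ for some positive integers $p,q$. Then $\hat F_T$ and $\hat F_S$ denote the maps between $\varprojlim F_{A|_V}$ and $\varprojlim F_{A'|_{V'}}$ that act by $F_T$ and $F_S$ in each coordinate; $\hat F_{A|_V}$ is the (invertible) shift. *Geometric realization.* Choose $u_i\in V/\Sigma$ $(i\in\mathcal A)$ such that $\min J-\min I\equiv u_j-u_i \pmod\Sigma$ whenever $I,J$ are edges of types $i,j$ of some $\gamma\in\mathcal T_\phi$, and $Au_i=u_{i'}$, where $i'$ is the first letter of $\phi(i)$. The corresponding geometric realization $g_\phi:\mathcal T_\phi\to\varprojlim F_{A|_V}$ is $g_\phi(\gamma)=(\min I_k-u_{i_k})_{k\ge0}$, where $I_k$ is any edge of $\Phi^{-k}(\gamma)$ and $i_k$ is its type. **Lemma 3.** Let $\phi$ and $\phi'$ be (primitive, aperiodic) Pisot substitutions; let $A,V,\Sigma$ and $A',V',\Sigma'$ be their abelianizations, Pisot subspaces and return lattices. (a) If $\phi'$ is a rewriting of $\phi$ with rewriting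 morphism $\rho$, then $\overline\rho:\mathcal T_{\phi'}\to\mathcal T_\phi$ is a homeomorphism. Moreover there are maps $T:(V,\Sigma)\to(V',\Sigma')$ and $S:(V',\Sigma')\to(V,\Sigma)$ that express a shift equivalence of $A|_V$ and $A'|_{V'}$, and an $m\in\mathbb N$, such that for all geometric realizations $g_\phi$ and $g_{\phi'}$ there are translations $\tau$ of $\varprojlim F_{A|_V}$ and $\tau'$ of $\varprojlim F_{A'|_{V'}}$ with $$g_\phi\circ\overline\rho=\tau\circ\hat F_S\circ g_{\phi'},\qquad g_{\phi'}\circ\overline\rho^{\,-1}=\tau'\circ\hat F_T\circ\hat F_{A|_V}^{-m}\circ g_\phi .$$ (b) If there are morphisms $\alpha,\beta$ with $\phi=\alpha\circ\beta$ and $\phi'=\beta\circ\alpha$, then $\overline\alpha:\mathcal T_{\phi'}\to\mathcal T_\phi$ and $\overline\beta:\mathcal T_\phi\to\mathcal T_{\phi'}$ are homeomorphisms. Moreover there are maps $T:(V,\Sigma)\to(V',\Sigma')$ and $S:(V',\Sigma')\to(V,\Sigma)$ that express a shift equivalence of $A|_V$ and $A'|_{V'}$, such that for all geometric realizations $g_\phi$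 and $g_{\phi'}$ there are translations $\tau$ of $\varprojlim F_{A|_V}$ and $\tau'$ of $\varprojlim F_{A'|_{V'}}$ with $$g_\phi\circ\overline\alpha=\tau\circ\hat F_S\circ g_{\phi'},\qquad g_{\phi'}\circ\overline\beta=\tau'\circ\hat F_T\circ g_\phi .$$ -/

import Mathlib

/-! ### Words, morphisms and substitutions -/

section Words

variable {𝒜 ℬ : Type*}

/-- A morphism `ρ : 𝒜 → ℬ*`, extended to words by concatenation. -/
def extendWord (ρ : 𝒜 → List ℬ) (w : List 𝒜) : List ℬ := w.flatMap ρ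

/-- The language of `φ`: the nonempty words occurring as factors of some `φⁿ(i)`. -/
def language (φ : 𝒜 → List 𝒜) : Set (List 𝒜) :=
  {w | w ≠ [] ∧ ∃ (i : 𝒜) (n : ℕ), w <:+: (extendWord φ)^[n] [i]}

/-- The finite word `x_a x_{a+1} ⋯ x_{b-1}` of a bi-infinite word `x`. -/
def block (x : ℤ → 𝒜) (a b : ℤ) : List 𝒜 :=
  (List.range (b - a).toNat).map fun m => x (a + m)

/-- The allowed bi-infinite words `X_φ`: all nonempty finite blocks are in the language. -/
def allowedWords (φ : 𝒜 → List 𝒜) : Set (ℤ → 𝒜) :=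
  {x | ∀ a b : ℤ, a < b → block x a b ∈ language φ}

/-- `C` is the set of cutting points of a factorization of the bi-infinite word `x` into
words from `W`. -/
def IsCutting (W : Set (List 𝒜)) (x : ℤ → 𝒜) (C : Set ℤ) : Prop :=
  ∃ c : ℤ → ℤ, StrictMono c ∧ Set.range c = C ∧ ∀ k, block x (c k) (c (k + 1)) ∈ W

/-- `φ'` is a rewriting of `φ` with rewriting morphism `ρ`. The set of words is
`W = {ρ i}`, the words `ρ i` being pairwise distinct. -/
structure IsRewriting (φ : 𝒜 → List 𝒜) (φ' : ℬ → List ℬ) (ρ : ℬ → List 𝒜) : Prop where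
  injective : Function.Injective ρ
  mem_language : ∀ i, ρ i ∈ language φ
  unique_cutting : ∀ x ∈ allowedWords φ, ∃! C : Set ℤ, IsCutting (Set.range ρ) x C
  factor : ∀ i, extendWord ρ (φ' i) = extendWord φ (ρ i)
  unique_factor : ∀ i u, extendWord ρ u = extendWord φ (ρ i) → u = φ' i

end Words

/-- A Pisot number: a real algebraic integer `> 1` all of whose other algebraic conjugates lie
strictly inside the unit circle. -/
def IsPisotNumber (lam : ℝ) : Prop :=
  1 < lam ∧ IsIntegral ℤ lam ∧
    ∀ z : ℂ, Polynomial.aeval z (minpoly ℚ lam) = 0 → z ≠ (lam : ℂ) → ‖z‖ < 1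

/-! ### Linear maps of pairs (vector space, lattice), solenoids, shift equivalence -/

section Lattices

variable {V V' : Type*} [AddCommGroup V] [Module ℝ V] [AddCommGroup V'] [Module ℝ V']

/-- A map `(V, Λ) → (V', Λ')`: a linear map `V → V'` that sends `Λ` into `Λ'`. -/
structure PairHom (Λ : AddSubgroup V) (Λ' : AddSubgroup V') where
  lin : V →ₗ[ℝ] V'
  map_mem : ∀ x ∈ Λ, lin x ∈ Λ'

variable {Λ : AddSubgroup V} {Λ' : AddSubgroup V'}

/-- The induced map `F_T : V/Λ → V'/Λ'`. -/
def quotientTorusMap (T : PairHom Λ Λ') : V ⧸ Λ →+ V' ⧸ Λ' :=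
  QuotientAddGroup.map Λ Λ' T.lin.toAddMonoidHom T.map_mem

/-- The inverse limit of `F_A : V/Λ → V/Λ`, as a subgroup of the product. -/
def solenoid (A : PairHom Λ Λ) : AddSubgroup (ℕ → V ⧸ Λ) where
  carrier := {z | ∀ k, quotientTorusMap A (z (k + 1)) = z k}
  zero_mem' := by intro k; simp
  add_mem' := by
    intro a b ha hb k
    have h1 := ha k
    have h2 := hb k
    simp [h1, h2]
  neg_mem' := by
    intro a ha k
    have h1 := ha k
    simp [h1]

/-- The map `F̂_T` between inverse limits, acting by `F_T` in each coordinate, induced by a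
map `T` that intertwines `A` and `A'`. -/
def solenoidMap {A : PairHom Λ Λ} {A' : PairHom Λ' Λ'} (T : PairHom Λ Λ')
    (h : ∀ x, A'.lin (T.lin x) = T.lin (A.lin x)) : solenoid A →+ solenoid A' where
  toFun z := ⟨fun k => quotientTorusMap T (z.1 k), by
    intro k
    have hz : quotientTorusMap A (z.1 (k + 1)) = z.1 k := z.2 k
    change quotientTorusMap A' (quotientTorusMap T (z.1 (k + 1))) = quotientTorusMap T (z.1 k)
    rw [← hz]
    generalize z.1 (k + 1) = q
    induction q using QuotientAddGroup.induction_on with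
    | H x => exact congrArg (QuotientAddGroup.mk (s := Λ')) (h x)⟩
  map_zero' := by ext k; simp
  map_add' := by intro a b; ext k; simp

/-- The shift `F̂_A` on the inverse limit; it is invertible, its inverse forgets the first
coordinate. -/
def solenoidShift (A : PairHom Λ Λ) : solenoid A ≃+ solenoid A :=
  { solenoidMap A (fun _ => rfl) with
    invFun := fun z => ⟨fun k => z.1 (k + 1), fun k => z.2 (k + 1)⟩
    left_inv := fun z => Subtype.ext (funext fun k => z.2 k)
    right_inv := fun z => Subtype.ext (funext fun k => z.2 k) }

/-- `A` and `A'` are shift equivalent, and `T` and `S` express the shift equivalence. -/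
structure ExpressShiftEquiv (A : PairHom Λ Λ) (A' : PairHom Λ' Λ')
    (T : PairHom Λ Λ') (S : PairHom Λ' Λ) : Prop where
  comm_T : ∀ x, A'.lin (T.lin x) = T.lin (A.lin x)
  comm_S : ∀ x, A.lin (S.lin x) = S.lin (A'.lin x)
  pow_ST : ∃ m : ℕ, 0 < m ∧ ∀ x, S.lin (T.lin x) = (A.lin ^ m) x
  pow_TS : ∃ n : ℕ, 0 < n ∧ ∀ x, T.lin (S.lin x) = (A'.lin ^ n) x

end Lattices

/-! ### Abelianization and the Pisot subspace -/

noncomputable section Pisot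

variable {𝒜 ℬ : Type*} [Fintype 𝒜] [DecidableEq 𝒜] [Fintype ℬ] [DecidableEq ℬ]

/-- The abelianization of a morphism: entry `(i, j)` is the number of occurrences of `i` in
`ρ j`. -/
def abelianization (ρ : ℬ → List 𝒜) : Matrix 𝒜 ℬ ℝ :=
  Matrix.of fun i j => ((ρ j).count i : ℝ)

/-- `lam` is an eigenvalue of `A` with the positive right eigenvector `ω`. -/
def IsPerronPair (A : Matrix 𝒜 𝒜 ℝ) (lam : ℝ) (ω : 𝒜 → ℝ) : Prop :=
  (∀ i, 0 < ω i) ∧ A.mulVec ω = lam • ω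

open Classical in
/-- The Perron-Frobenius eigenvalue: the eigenvalue that has a positive right eigenvector. -/
def pfEigenvalue (φ : 𝒜 → List 𝒜) : ℝ :=
  if h : ∃ lam ω, IsPerronPair (abelianization φ) lam ω then h.choose else 0

/-- The abelianization of `φ` as an endomorphism of `ℝ^𝒜`. -/
def abelianEnd (φ : 𝒜 → List 𝒜) : Module.End ℝ (𝒜 → ℝ) :=
  Matrix.toLin' (abelianization φ)

/-- `m(A)`, where `m` is the minimal polynomial over `ℚ` of the Perron-Frobenius eigenvalue. -/
def minpolyEnd (φ : 𝒜 → List 𝒜) : Module.End ℝ (𝒜 → ℝ) :=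
  Polynomial.aeval (abelianEnd φ)
    ((minpoly ℚ (pfEigenvalue φ)).map (algebraMap ℚ ℝ))

/-- The Pisot subspace `V = ker m(A)`. -/
def pisotSpace (φ : 𝒜 → List 𝒜) : Submodule ℝ (𝒜 → ℝ) := LinearMap.ker (minpolyEnd φ)

/-- The `A`-invariant complement `W` of `V`. An invariant complement of `ker m(A)` is mapped onto
itself by `m(A)`, so it can only be the range of `m(A)`. -/
def pisotCompl (φ : 𝒜 → List 𝒜) : Submodule ℝ (𝒜 → ℝ) := LinearMap.range (minpolyEnd φ)

open Classical in
/-- The projection `pr_V : ℝ^𝒜 → V` along `W`. (When the Perron-Frobenius eigenvalue is a simple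
eigenvalue, `V` and `W` are complementary and the value `0` is not used.) -/
def prV (φ : 𝒜 → List 𝒜) : (𝒜 → ℝ) →ₗ[ℝ] pisotSpace φ :=
  if h : IsCompl (pisotSpace φ) (pisotCompl φ) then
    (pisotSpace φ).projectionOnto (pisotCompl φ) h else 0

lemma abelianEnd_comm (φ : 𝒜 → List 𝒜) (x : 𝒜 → ℝ) :
    minpolyEnd φ (abelianEnd φ x) = abelianEnd φ (minpolyEnd φ x) := by
  have h : Commute (minpolyEnd φ) (abelianEnd φ) := by
    unfold minpolyEnd
    exact (Polynomial.commute_X _).map (Polynomial.aeval (abelianEnd φ)) |>.symm |> fun h => by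
      simpa using h
  exact congrArg (fun f => f x) h.eq

lemma abelianEnd_mem (φ : 𝒜 → List 𝒜) :
    ∀ x ∈ pisotSpace φ, abelianEnd φ x ∈ pisotSpace φ := by
  intro x hx
  have hx' : minpolyEnd φ x = 0 := hx
  change minpolyEnd φ (abelianEnd φ x) = 0
  rw [abelianEnd_comm, hx', map_zero]

/-- The restriction `A|_V`. -/
def abelianV (φ : 𝒜 → List 𝒜) : pisotSpace φ →ₗ[ℝ] pisotSpace φ :=
  (abelianEnd φ).restrict (abelianEnd_mem φ)

open Classical in
/-- A positive right Perron-Frobenius eigenvector `ω ∈ V`. -/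
def pfVector (φ : 𝒜 → List 𝒜) : pisotSpace φ :=
  if h : ∃ ω : pisotSpace φ, IsPerronPair (abelianization φ) (pfEigenvalue φ) ω
  then h.choose else 0

/-- The expanding line `𝔼ᵘ`, spanned by `ω`. -/
def expandingLine (φ : 𝒜 → List 𝒜) : Submodule ℝ (pisotSpace φ) := Submodule.span ℝ {pfVector φ}

/-- `v_i = pr_V e_i`. -/
def segVec (φ : 𝒜 → List 𝒜) (i : 𝒜) : pisotSpace φ := prV φ (Pi.single i 1)

/-- The lattice `Γ = pr_V ℤ^𝒜`, generated by the `v_i`. -/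
def gammaLattice (φ : 𝒜 → List 𝒜) : AddSubgroup (pisotSpace φ) :=
  AddSubgroup.closure (Set.range (segVec φ))

/-! ### Strands -/

/-- A labelled edge `σ_i + x` in `V`: its type `i` and its initial vertex `x`. -/
abbrev Edge (φ : 𝒜 → List 𝒜) : Type _ := 𝒜 × pisotSpace φ

/-- Bi-infinite strands in `V`, as sets of labelled edges that meet tip to tail. -/
def Strand (φ : 𝒜 → List 𝒜) : Type _ :=
  {γ : Set (Edge φ) // ∃ (w : ℤ → 𝒜) (x : ℤ → pisotSpace φ),
    (∀ k, x (k + 1) = x k + segVec φ (w k)) ∧ γ = Set.range fun k => (w k, x k)}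

/-- The set of edges of a strand. -/
def Strand.edges {φ : 𝒜 → List 𝒜} (γ : Strand φ) : Set (Edge φ) := γ.1

/-- The translate `γ + v`. -/
def Strand.translate {φ : 𝒜 → List 𝒜} (γ : Strand φ) (v : pisotSpace φ) : Strand φ :=
  ⟨(fun e : Edge φ => (e.1, e.2 + v)) '' γ.edges, by
    obtain ⟨γ, w, x, hx, rfl⟩ := γ
    refine ⟨w, fun k => x k + v, fun k => ?_, ?_⟩
    · simp only [hx]; abel
    · exact (Set.range_comp _ _).symm⟩

/-- The translation flow `γ ↦ γ - t`, which translates `γ` by `-t ω`. -/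
def Strand.flow {φ : 𝒜 → List 𝒜} (γ : Strand φ) (t : ℝ) : Strand φ :=
  γ.translate (-(t • pfVector φ))

/-- `γ` and `γ'` are `ε`-close: some translate of `γ` by a vector shorter than `ε` has exactly the
same labelled edges as `γ'` issuing from the points of the ball of radius `1/ε`. -/
def Strand.Close {φ : 𝒜 → List 𝒜} (ε : ℝ) (γ γ' : Strand φ) : Prop :=
  ∃ v : pisotSpace φ, ‖v‖ < ε ∧
    ∀ e : Edge φ, ‖e.2‖ < ε⁻¹ → (e ∈ (γ.translate v).edges ↔ e ∈ γ'.edges)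

lemma Strand.Close.mono {φ : 𝒜 → List 𝒜} {ε δ : ℝ} {γ γ' : Strand φ} (h : Strand.Close ε γ γ')
    (hε : 0 < ε) (hle : ε ≤ δ) : Strand.Close δ γ γ' := by
  obtain ⟨v, hv, he⟩ := h
  exact ⟨v, hv.trans_le hle, fun e h1 => he e (h1.trans_le (inv_anti₀ hε hle))⟩

/-- The topology on strands for which the sets of strands `ε`-close to `γ`, `ε > 0`, form a
neighbourhood basis at `γ`. -/
instance {φ : 𝒜 → List 𝒜} : TopologicalSpace (Strand φ) where
  IsOpen U := ∀ γ ∈ U, ∃ ε : ℝ, 0 < ε ∧ ∀ γ', Strand.Close ε γ γ' → γ' ∈ U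
  isOpen_univ := fun _ _ => ⟨1, one_pos, fun _ _ => Set.mem_univ _⟩
  isOpen_inter := by
    rintro U U' hU hU' γ ⟨h1, h2⟩
    obtain ⟨ε, hε, h⟩ := hU γ h1
    obtain ⟨δ, hδ, h'⟩ := hU' γ h2
    exact ⟨min ε δ, lt_min hε hδ, fun γ' hc =>
      ⟨h γ' (hc.mono (lt_min hε hδ) (min_le_left _ _)),
        h' γ' (hc.mono (lt_min hε hδ) (min_le_right _ _))⟩⟩
  isOpen_sUnion := by
    rintro s hs γ ⟨U, hU, hγ⟩
    obtain ⟨ε, hε, h⟩ := hs U hU γ hγ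
    exact ⟨ε, hε, fun γ' hc => ⟨U, hU, h γ' hc⟩⟩

/-- The map induced by a morphism `ρ : ℬ → 𝒜*` with abelianization `P` on sets of labelled edges:
the edge `σ'_i + x` is replaced by the edges `σ_{i_k} + P x + v_{i_1} + ⋯ + v_{i_{k-1}}`, where
`ρ i = i_1 ⋯ i_l`. -/
def edgeMap (φ' : ℬ → List ℬ) (φ : 𝒜 → List 𝒜) (ρ : ℬ → List 𝒜) (γ : Set (Edge φ')) :
    Set (Edge φ) :=
  {e | ∃ f ∈ γ, ∃ p s : List 𝒜, ρ f.1 = p ++ e.1 :: s ∧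
    (e.2 : 𝒜 → ℝ) = (abelianization ρ).mulVec (f.2 : ℬ → ℝ) +
      (((p.map (segVec φ)).sum : pisotSpace φ) : 𝒜 → ℝ)}

/-- Inflation and substitution `Φ`, on sets of labelled edges. -/
def inflate (φ : 𝒜 → List 𝒜) : Set (Edge φ) → Set (Edge φ) := edgeMap φ φ φ

/-- The strands in `𝓕^R`: all edges are within distance `R` of `𝔼ᵘ`. (As every vertex of a
bi-infinite strand is the initial vertex of an edge, it suffices to look at these.) -/
def strandsNear (φ : 𝒜 → List 𝒜) (R : ℝ) : Set (Strand φ) :=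
  {γ | ∀ e ∈ γ.edges, Metric.infDist e.2 (expandingLine φ : Set (pisotSpace φ)) ≤ R}

/-- `𝓕_φ = ⋂ₙ Φⁿ(𝓕^R)` for all large `R`; the intersection grows with `R` and is eventually
constant, so this is the union over `R`. -/
def strandSpace (φ : 𝒜 → List 𝒜) : Set (Strand φ) :=
  {γ | ∃ R : ℝ, ∀ n : ℕ, ∃ δ ∈ strandsNear φ R, (inflate φ)^[n] δ.edges = γ.edges}

/-- The `ω`-limit set of `γ` under the translation flow. -/
def omegaLimitSet (φ : 𝒜 → List 𝒜) (γ : Strand φ) : Set (Strand φ) :=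
  {δ | ∀ T : ℝ, 0 < T → δ ∈ closure {η | ∃ t : ℝ, T ≤ t ∧ η = γ.flow t}}

/-- The tiling space `𝓣_φ`: the `ω`-limit set of any `γ ∈ 𝓕_φ`. -/
def tilingSpace (φ : 𝒜 → List 𝒜) : Set (Strand φ) :=
  {δ | ∃ γ ∈ strandSpace φ, δ ∈ omegaLimitSet φ γ}

/-- A primitive, aperiodic Pisot substitution: `φ` takes letters to nonempty words, its
abelianization is primitive, no element of the tiling space is periodic under the translation
flow, and the Perron-Frobenius eigenvalue is a Pisot number. -/
structure IsPisotSubstitution (φ : 𝒜 → List 𝒜) : Prop where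
  ne_nil : ∀ i, φ i ≠ []
  primitive : (abelianization φ).IsPrimitive
  aperiodic : ∀ γ ∈ tilingSpace φ, ∀ t : ℝ, t ≠ 0 → γ.flow t ≠ γ
  pisot : IsPisotNumber (pfEigenvalue φ)

/-! ### Return lattice and geometric realization -/

/-- The return vectors `Θ(i)`. -/
def returnVectors (φ : 𝒜 → List 𝒜) (i : 𝒜) : Set (pisotSpace φ) :=
  {v | v ∈ gammaLattice φ ∧ ∃ γ ∈ tilingSpace φ, ∃ x, (i, x) ∈ γ.edges ∧ (i, x + v) ∈ γ.edges}

/-- `Σ_∞`, the group generated by the vectors `(A|_V)^k θ` with `k ∈ ℤ` and `θ` a return vector.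
As `A|_V` is invertible, `v` is of this form iff `A^k v = A^l θ` with `k, l ∈ ℕ`. The group
generated by the `(A|_V)^k Θ(i)` is the same for every letter `i`, so all letters are used. -/
def returnGroup (φ : 𝒜 → List 𝒜) : AddSubgroup (pisotSpace φ) :=
  AddSubgroup.closure {v | ∃ (i : 𝒜) (θ : pisotSpace φ) (k l : ℕ), θ ∈ returnVectors φ i ∧
    (abelianV φ ^ k) v = (abelianV φ ^ l) θ}

/-- The return lattice `Σ = Σ_∞ ∩ Γ`. -/
def returnLattice (φ : 𝒜 → List 𝒜) : AddSubgroup (pisotSpace φ) :=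
  returnGroup φ ⊓ gammaLattice φ

lemma prV_comm (φ : 𝒜 → List 𝒜) (x : 𝒜 → ℝ) :
    prV φ (abelianEnd φ x) = abelianV φ (prV φ x) := by
  by_cases h : IsCompl (pisotSpace φ) (pisotCompl φ)
  · have hx : x ∈ pisotSpace φ ⊔ pisotCompl φ := by rw [h.sup_eq_top]; trivial
    obtain ⟨y, hy, z, hz, rfl⟩ := Submodule.mem_sup.mp hx
    have hz' : abelianEnd φ z ∈ pisotCompl φ := by
      obtain ⟨u, rfl⟩ := hz
      exact ⟨abelianEnd φ u, abelianEnd_comm φ u⟩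
    have key : ∀ y (hy : y ∈ pisotSpace φ), ∀ z ∈ pisotCompl φ, prV φ (y + z) = ⟨y, hy⟩ := by
      intro y hy z hz
      rw [prV, dif_pos h, map_add, (Submodule.projectionOnto_apply_eq_zero_iff h).mpr hz, add_zero]
      exact Submodule.projectionOnto_apply_left h ⟨y, hy⟩
    rw [map_add, key _ (abelianEnd_mem φ y hy) _ hz', key y hy z hz]
    rfl
  · simp [prV, h]

lemma abelianV_mem_gamma (φ : 𝒜 → List 𝒜) :
    ∀ x ∈ gammaLattice φ, abelianV φ x ∈ gammaLattice φ := by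
  intro x hx
  induction hx using AddSubgroup.closure_induction with
  | mem x hx =>
    obtain ⟨i, rfl⟩ := hx
    have h1 : abelianEnd φ (Pi.single i 1)
        = ∑ j, ((φ i).count j) • (Pi.single j (1 : ℝ) : 𝒜 → ℝ) := by
      ext k
      simp [abelianEnd, abelianization, Finset.sum_apply, Pi.single_apply]
    rw [segVec, ← prV_comm, h1, map_sum]
    refine AddSubgroup.sum_mem _ fun j _ => ?_
    rw [map_nsmul]
    exact AddSubgroup.nsmul_mem _ (AddSubgroup.subset_closure (Set.mem_range_self j)) _
  | zero => rw [map_zero]; exact zero_mem _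
  | add x y _ _ hx hy => rw [map_add]; exact add_mem hx hy
  | neg x _ hx => rw [map_neg]; exact neg_mem hx

lemma abelianV_mem_returnGroup (φ : 𝒜 → List 𝒜) :
    ∀ x ∈ returnGroup φ, abelianV φ x ∈ returnGroup φ := by
  intro x hx
  induction hx using AddSubgroup.closure_induction with
  | mem x hx =>
    obtain ⟨i, θ, k, l, hθ, h⟩ := hx
    have key : (abelianV φ ^ k) (abelianV φ x) = (abelianV φ ^ (l + 1)) θ := by
      rw [← Module.End.mul_apply, ← pow_succ, pow_succ', Module.End.mul_apply, h,
        ← Module.End.mul_apply, ← pow_succ']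
    exact AddSubgroup.subset_closure ⟨i, θ, k, l + 1, hθ, key⟩
  | zero => rw [map_zero]; exact zero_mem _
  | add x y _ _ hx hy => rw [map_add]; exact add_mem hx hy
  | neg x _ hx => rw [map_neg]; exact neg_mem hx

/-- `A|_V : (V, Σ) → (V, Σ)`. -/
def latticeEnd (φ : 𝒜 → List 𝒜) : PairHom (returnLattice φ) (returnLattice φ) where
  lin := abelianV φ
  map_mem := fun x hx =>
    ⟨abelianV_mem_returnGroup φ x hx.1, abelianV_mem_gamma φ x hx.2⟩

/-- The class of a vector modulo `Σ`. -/
def modReturn (φ : 𝒜 → List 𝒜) (x : pisotSpace φ) : pisotSpace φ ⧸ returnLattice φ :=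
  QuotientAddGroup.mk x

/-- `(u_i)` is a choice of translations for geometric realization: `u_j - u_i` is the transition
vector from edges of type `i` to edges of type `j`, and `A u_i = u_{i'}` when `φ i` begins
with `i'`. -/
structure IsTranslationChoice (φ : 𝒜 → List 𝒜) (u : 𝒜 → pisotSpace φ ⧸ returnLattice φ) :
    Prop where
  transition : ∀ γ ∈ tilingSpace φ, ∀ i j x y, (i, x) ∈ γ.edges → (j, y) ∈ γ.edges →
    modReturn φ (y - x) = u j - u i
  normalized : ∀ i i' s, φ i = i' :: s → quotientTorusMap (latticeEnd φ) (u i) = u i'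

/-- `g : 𝓣_φ → lim F_{A|_V}` is geometric realization for some choice of the `u_i`: the `k`-th
coordinate of `g γ` is `min I - u_i mod Σ` for any edge `I` of `Φ^{-k} γ`, where `i` is the type
of `I`. -/
def IsGeometricRealization (φ : 𝒜 → List 𝒜) (g : tilingSpace φ → solenoid (latticeEnd φ)) : Prop :=
  ∃ u, IsTranslationChoice φ u ∧
    ∀ (γ δ : tilingSpace φ) (k : ℕ), (inflate φ)^[k] δ.1.edges = γ.1.edges →
      ∀ i x, (i, x) ∈ δ.1.edges → (g γ).1 k = modReturn φ x - u i

end Pisot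

/-! ### Blocks of bi-infinite words -/

section Symbolic

variable {𝒜 ℬ 𝒞 : Type*}

/-! Both parts rest on one situation: a morphism `ρ` with `ρ ∘ φ' = φ ∘ ρ` that sends letters to
words of the language of `φ` (`Intertwines`) and is recognizable on the allowed words of `φ'`
(`Recognizable`). In (a) recognizability is the unique factorization of allowed words. In (b) it is
Mossé's theorem for `φ' = β ∘ α` (`IsMixing.recognizable`), since a right factor of a recognizable
morphism is recognizable.

Mossé's theorem is reached through a minimal alphabet. If some power of `φ` factors as `β ∘ α`
through the fewest possible letters, no power of `ψ = α ∘ β` factors through fewer. By the defect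
argument `Forks.factorsThrough`, two points with the same image under a power of `ψ` then agree as
soon as they share a cutting point. If some point had two representations under a power of `ψ`,
minimality and composition would make the number of representations under higher powers unbounded,
whereas aperiodicity bounds it uniformly in the power (`card_le_of_representations`).

The abelianization `P` of `ρ` restricts to an isomorphism `V' → V`
(`IsPisotMorphism.abelMap_bijective`): a left Perron eigenvector kills no nonzero rational vector of
`ker μ(A')`, so the rational subspace `ker P ∩ V'` is trivial, and the same argument for transposes
gives equality of dimensions.

On `V` the Pisot condition supplies a seminorm that vanishes on the expanding line and is contracted
by `A` (`StableNorm`). With it the tiling space is the set of strands having preimages of all orders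
under `Φ` among the strands that have allowed words and lie in a fixed tube around the line
(`mem_tilingSpace_iff`). This description is transported by `ρ`; with recognizability and
compactness it makes the induced map a homeomorphism (`exists_homeomorph`).

Finally `P Σ' ⊆ Σ`, and conversely `A^m Σ ⊆ P Σ'` for some `m`: two copies of a long `φ^m(i)` are
cut by `ρ` in the same way in their middle, so a power of `A` turns each return vector into the
image of a return vector (`exists_returnVectors`), and `Σ` is finitely generated. Hence `S = P` and
`T = P⁻¹ A^m` express a shift equivalence. Comparing edges that begin at corresponding vertices
shows that `g ∘ ρ̄` and `F̂_S ∘ g'` differ by a constant (`exists_translation`). In (a) the formula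
for the inverse follows by applying `T`; in (b) `S` and `T` are the abelianizations of `α` and `β`.
-/

lemma block_eq_map (x : ℤ → 𝒜) (a b : ℤ) :
    block x a b = (List.range (b - a).toNat).map fun m : ℕ => x (a + m) := by
  -- In `block` the range is coerced to a list of integers through the monad structure of lists;
  -- this coercion is a plain `map`.
  have : (do let a ← List.range (b - a).toNat; pure (a : ℤ) : List ℤ) =
      (List.range (b - a).toNat).map fun m : ℕ => (m : ℤ) := by
    induction List.range (b - a).toNat with
    | nil => rfl
    | cons a l ih => exact congrArg (List.cons (a : ℤ)) ih
  rw [block, this, List.map_map]; rfl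

lemma length_block (x : ℤ → 𝒜) (a b : ℤ) : (block x a b).length = (b - a).toNat := by
  simp [block_eq_map]

lemma block_getElem (x : ℤ → 𝒜) (a b : ℤ) (m : ℕ) (h : m < (block x a b).length) :
    (block x a b)[m] = x (a + m) := by
  simp [block_eq_map]

lemma block_eq_iff {x : ℤ → 𝒜} {a b : ℤ} {u : List 𝒜} (hab : a ≤ b) :
    block x a b = u ↔ b = a + u.length ∧ ∀ (m : ℕ) (h : m < u.length), x (a + m) = u[m] := by
  constructor
  · rintro rfl
    refine ⟨?_, fun m h => (block_getElem x a b m h).symm⟩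
    rw [length_block]; omega
  · rintro ⟨h1, h2⟩
    apply List.ext_getElem
    · rw [length_block]; omega
    · intro m h h'
      rw [block_getElem, h2 m h']

lemma block_append (x : ℤ → 𝒜) {a b c : ℤ} (hab : a ≤ b) (hbc : b ≤ c) :
    block x a b ++ block x b c = block x a c := by
  apply List.ext_getElem
  · simp only [List.length_append, length_block]; omega
  · intro m h h'
    rw [List.getElem_append]
    split_ifs with h1
    · simp [block_getElem]
    · rw [length_block] at h1
      simp only [block_getElem, length_block]
      congr 1
      omega

lemma block_self (x : ℤ → 𝒜) (a : ℤ) : block x a a = [] := by simp [block_eq_map]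

lemma block_succ (x : ℤ → 𝒜) (a : ℤ) : block x a (a + 1) = [x a] := by simp [block_eq_map]

lemma block_infix (x : ℤ → 𝒜) {a a' b' b : ℤ} (h1 : a ≤ a') (h2 : a' ≤ b') (h3 : b' ≤ b) :
    block x a' b' <:+: block x a b :=
  ⟨block x a a', block x b' b, by rw [block_append x h1 h2, block_append x (h1.trans h2) h3]⟩

lemma block_congr {x y : ℤ → 𝒜} {a b a' : ℤ}
    (h : ∀ n : ℤ, 0 ≤ n → n < b - a → x (a + n) = y (a' + n)) :
    block x a b = block y a' (a' + (b - a)) := by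
  apply List.ext_getElem
  · simp only [length_block]; congr 1; omega
  · intro m h1 h2
    rw [length_block] at h1
    rw [block_getElem, block_getElem]
    exact h m (by omega) (by omega)

lemma block_shift (x : ℤ → 𝒜) (p a b : ℤ) :
    block (fun n => x (n + p)) a b = block x (a + p) (b + p) := by
  have := block_congr (x := fun n => x (n + p)) (y := x) (a := a) (b := b) (a' := a + p)
    (fun n _ _ => by ring_nf)
  rw [this]; congr 1; ring

/-- If `u` occurs in the block `[a, b)` of `x`, it is itself a block. -/
lemma exists_block_of_infix {x : ℤ → 𝒜} {a b : ℤ} {u : List 𝒜} (hab : a ≤ b)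
    (h : u <:+: block x a b) :
    ∃ p, a ≤ p ∧ p + u.length ≤ b ∧ block x p (p + u.length) = u := by
  obtain ⟨s, t, h⟩ := h
  have h' := (block_eq_iff hab).1 h.symm
  have hlen : (s ++ u ++ t).length = s.length + u.length + t.length := by
    simp [add_assoc]
  refine ⟨a + s.length, by omega, by omega, ?_⟩
  rw [block_eq_iff (by omega)]
  refine ⟨by omega, fun m hm => ?_⟩
  have := h'.2 (s.length + m) (by omega)
  simp only [List.append_assoc] at this
  rw [List.getElem_append_right (by omega), List.getElem_append_left (by omega)] at this
  simp only [Nat.add_sub_cancel_left] at this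
  rw [← this]; push_cast; ring_nf

/-! ### Summation over `ℤ` and strictly increasing sequences -/

/-- Vertices of paths and cutting points of images are both built from their increments this way.
For each `k` only one of the two finite sums in the witness is nonempty. -/
lemma exists_int_sum {G : Type*} [AddCommGroup G] (f : ℤ → G) (a : G) :
    ∃ F : ℤ → G, F 0 = a ∧ ∀ k, F (k + 1) = F k + f k := by
  refine ⟨fun k => a + (∑ i ∈ Finset.range k.toNat, f i)
    - ∑ i ∈ Finset.range (-k).toNat, f (-(i : ℤ) - 1), by simp, fun k => ?_⟩
  beta_reduce
  rcases le_or_gt 0 k with h | h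
  · have h1 : (k + 1).toNat = k.toNat + 1 := by omega
    have h2 : (-(k + 1)).toNat = 0 := by omega
    have h3 : (-k).toNat = 0 := by omega
    rw [h1, h2, h3, Finset.sum_range_succ, Int.toNat_of_nonneg h]
    simp [add_assoc]
  · have h1 : (k + 1).toNat = 0 := by omega
    have h2 : (-k).toNat = (-(k + 1)).toNat + 1 := by omega
    have h3 : k.toNat = 0 := by omega
    have h4 : -((-(k + 1)).toNat : ℤ) - 1 = k := by omega
    rw [h1, h3, h2, Finset.sum_range_succ, h4]
    abel

lemma eq_add_of_step_eq {G : Type*} [AddCommGroup G] {F F' : ℤ → G}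
    (h : ∀ k, F' (k + 1) - F' k = F (k + 1) - F k) (k : ℤ) : F' k = F k + (F' 0 - F 0) := by
  induction k using Int.induction_on with
  | zero => simp
  | succ n ih =>
    have := h n
    rw [sub_eq_iff_eq_add.1 this, ih]; abel
  | pred n ih =>
    have := h (-(n : ℤ) - 1)
    rw [sub_add_cancel] at this
    have h2 : F' (-(n : ℤ) - 1) = F' (-(n : ℤ)) - (F (-(n : ℤ)) - F (-(n : ℤ) - 1)) := by
      rw [← this]; abel
    rw [h2, ih]; abel

lemma strictMono_of_step {α : Type*} [Preorder α] {c : ℤ → α} (h : ∀ k, c k < c (k + 1)) :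
    StrictMono c := strictMono_int_of_lt_succ h

lemma strictMono_int_sub_le {c : ℤ → ℤ} (hc : StrictMono c) {k l : ℤ} (h : k ≤ l) :
    l - k ≤ c l - c k := by
  obtain ⟨n, rfl⟩ := Int.le.dest h
  induction n with
  | zero => simp
  | succ n ih =>
    have := hc (show k + (n : ℤ) < k + (n + 1 : ℕ) by push_cast; omega)
    have := ih (by omega)
    push_cast at *; omega

lemma StrictMono.exists_int_floor {c : ℤ → ℤ} (hc : StrictMono c) (n : ℤ) :
    ∃ k, c k ≤ n ∧ n < c (k + 1) := by
  obtain ⟨k, hk, hk'⟩ := Int.exists_greatest_of_bdd (P := fun k => c k ≤ n)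
    ⟨max 0 (n - c 0), fun z hz => by
      rcases le_or_gt z 0 with h | h
      · exact h.trans (le_max_left _ _)
      · have := strictMono_int_sub_le hc h.le
        exact le_trans (by omega) (le_max_right _ _)⟩
    ⟨min 0 (n - c 0), by
      have := strictMono_int_sub_le hc (min_le_left 0 (n - c 0))
      have := min_le_right 0 (n - c 0)
      omega⟩
  refine ⟨k, hk, ?_⟩
  by_contra! h
  have := hk' (k + 1) h
  omega

lemma StrictMono.int_floor_unique {α : Type*} [LinearOrder α] {c : ℤ → α} (hc : StrictMono c)
    {n : α} {k l : ℤ} (h1 : c k ≤ n) (h2 : n < c (k + 1)) (h3 : c l ≤ n) (h4 : n < c (l + 1)) :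
    k = l := by
  have h5 := hc.lt_iff_lt.1 (h1.trans_lt h4)
  have h6 := hc.lt_iff_lt.1 (h3.trans_lt h2)
  omega

/-! ### Morphisms -/

@[simp] lemma extendWord_nil (ρ : 𝒜 → List ℬ) : extendWord ρ [] = [] := rfl

@[simp] lemma extendWord_cons (ρ : 𝒜 → List ℬ) (a : 𝒜) (u : List 𝒜) :
    extendWord ρ (a :: u) = ρ a ++ extendWord ρ u := by simp [extendWord]

@[simp] lemma extendWord_append (ρ : 𝒜 → List ℬ) (u v : List 𝒜) :
    extendWord ρ (u ++ v) = extendWord ρ u ++ extendWord ρ v := by simp [extendWord]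

lemma extendWord_singleton (ρ : 𝒜 → List ℬ) (a : 𝒜) : extendWord ρ [a] = ρ a := by simp

lemma extendWord_infix (ρ : 𝒜 → List ℬ) {u v : List 𝒜} (h : u <:+: v) :
    extendWord ρ u <:+: extendWord ρ v := by
  obtain ⟨s, t, rfl⟩ := h
  exact ⟨extendWord ρ s, extendWord ρ t, by simp⟩

lemma infix_extendWord_of_mem (ρ : 𝒜 → List ℬ) {u : List 𝒜} {a : 𝒜} (h : a ∈ u) :
    ρ a <:+: extendWord ρ u := by
  obtain ⟨s, t, rfl⟩ := List.append_of_mem h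
  exact ⟨extendWord ρ s, extendWord ρ t, by simp⟩

/-- Composition of morphisms. -/
def morComp (σ : ℬ → List 𝒞) (τ : 𝒜 → List ℬ) : 𝒜 → List 𝒞 := fun a => extendWord σ (τ a)

lemma extendWord_morComp (σ : ℬ → List 𝒞) (τ : 𝒜 → List ℬ) (u : List 𝒜) :
    extendWord (morComp σ τ) u = extendWord σ (extendWord τ u) := by
  induction u with
  | nil => rfl
  | cons a u ih => simp [ih, morComp]

lemma extendWord_eq_nil_iff {ρ : 𝒜 → List ℬ} (hρ : ∀ a, ρ a ≠ []) {u : List 𝒜} :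
    extendWord ρ u = [] ↔ u = [] := by
  cases u with
  | nil => simp
  | cons a u => simp [hρ a]

lemma morComp_ne_nil {σ : ℬ → List 𝒞} {τ : 𝒜 → List ℬ} (hσ : ∀ a, σ a ≠ [])
    (hτ : ∀ a, τ a ≠ []) (a : 𝒜) : morComp σ τ a ≠ [] := by
  rw [morComp, Ne, extendWord_eq_nil_iff hσ]; exact hτ a

/-- The powers of a substitution. -/
def morPow (φ : 𝒜 → List 𝒜) (n : ℕ) : 𝒜 → List 𝒜 := fun i => (extendWord φ)^[n] [i]

lemma extendWord_morPow (φ : 𝒜 → List 𝒜) (n : ℕ) (u : List 𝒜) :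
    extendWord (morPow φ n) u = (extendWord φ)^[n] u := by
  induction u with
  | nil =>
    induction n with
    | zero => rfl
    | succ n ih => rw [Function.iterate_succ_apply]; simpa using ih
  | cons a u ih =>
    rw [extendWord_cons, ih]
    have : ∀ (n : ℕ) (u v : List 𝒜), (extendWord φ)^[n] (u ++ v) =
        (extendWord φ)^[n] u ++ (extendWord φ)^[n] v := by
      intro n
      induction n with
      | zero => intros; rfl
      | succ n ih => intro u v; simp only [Function.iterate_succ_apply, extendWord_append, ih]
    exact (this n [a] u).symm

lemma morPow_zero (φ : 𝒜 → List 𝒜) (i : 𝒜) : morPow φ 0 i = [i] := rfl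

lemma morPow_one (φ : 𝒜 → List 𝒜) : morPow φ 1 = φ := by
  funext i; simp [morPow]

lemma morPow_add (φ : 𝒜 → List 𝒜) (m n : ℕ) :
    morPow φ (m + n) = morComp (morPow φ m) (morPow φ n) := by
  funext i
  rw [morComp, extendWord_morPow, morPow, Function.iterate_add_apply]; rfl

lemma morPow_ne_nil {φ : 𝒜 → List 𝒜} (h : ∀ i, φ i ≠ []) (n : ℕ) (i : 𝒜) :
    morPow φ n i ≠ [] := by
  induction n generalizing i with
  | zero => simp [morPow]
  | succ n ih => rw [morPow_add, morPow_one]; exact morComp_ne_nil ih h i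

/-! ### The language and the subshift of a substitution -/

lemma mem_language_iff {φ : 𝒜 → List 𝒜} {w : List 𝒜} :
    w ∈ language φ ↔ w ≠ [] ∧ ∃ i n, w <:+: morPow φ n i := Iff.rfl

lemma language_of_infix {φ : 𝒜 → List 𝒜} {u v : List 𝒜} (hv : v ∈ language φ) (hu : u ≠ [])
    (h : u <:+: v) : u ∈ language φ := by
  obtain ⟨_, i, n, hi⟩ := hv
  exact ⟨hu, i, n, h.trans hi⟩

lemma extendWord_morPow_mem_language {φ : 𝒜 → List 𝒜} (hφ : ∀ i, φ i ≠ []) {u : List 𝒜}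
    (hu : u ∈ language φ) (n : ℕ) : extendWord (morPow φ n) u ∈ language φ := by
  obtain ⟨h0, i, m, hi⟩ := mem_language_iff.1 hu
  refine mem_language_iff.2 ⟨?_, i, n + m, ?_⟩
  · rwa [Ne, extendWord_eq_nil_iff (morPow_ne_nil hφ n)]
  · rw [morPow_add]; exact extendWord_infix _ hi

lemma singleton_mem_language (φ : 𝒜 → List 𝒜) (i : 𝒜) : [i] ∈ language φ :=
  mem_language_iff.2 ⟨by simp, i, 0, List.infix_rfl⟩

lemma morPow_mem_language {φ : 𝒜 → List 𝒜} (hφ : ∀ i, φ i ≠ []) (n : ℕ) (i : 𝒜) :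
    morPow φ n i ∈ language φ :=
  mem_language_iff.2 ⟨morPow_ne_nil hφ n i, i, n, List.infix_rfl⟩

lemma allowedWords_shift {φ : 𝒜 → List 𝒜} {x : ℤ → 𝒜} (hx : x ∈ allowedWords φ) (p : ℤ) :
    (fun n => x (n + p)) ∈ allowedWords φ := by
  intro a b hab
  rw [block_shift]
  exact hx _ _ (by omega)

lemma allowedWords_of_cofinal {φ : 𝒜 → List 𝒜} {x : ℤ → 𝒜}
    (h : ∀ L : ℤ, ∃ a b, a ≤ -L ∧ L ≤ b ∧ block x a b ∈ language φ) : x ∈ allowedWords φ := by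
  intro a b hab
  obtain ⟨a', b', h1, h2, h3⟩ := h (max (-a) b)
  have := le_max_left (-a) b
  have := le_max_right (-a) b
  refine language_of_infix h3 ?_ (block_infix x (a := a') (b := b') (by omega) hab.le (by omega))
  intro h0
  have := congrArg List.length h0
  rw [length_block] at this
  simp at this; omega

/-! ### Desubstitution -/

/-- The bi-infinite word `y` is the image under `σ` of `z`, the image of `z k` being the block
of `y` between the cutting points `c k` and `c (k + 1)`. -/
structure IsImage (σ : 𝒜 → List ℬ) (z : ℤ → 𝒜) (c : ℤ → ℤ) (y : ℤ → ℬ) : Prop where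
  step : ∀ k, c (k + 1) = c k + (σ (z k)).length
  block_eq : ∀ k, block y (c k) (c (k + 1)) = σ (z k)

namespace IsImage

variable {σ : 𝒜 → List ℬ} {z : ℤ → 𝒜} {c : ℤ → ℤ} {y : ℤ → ℬ}

lemma getElem (h : IsImage σ z c y) (k : ℤ) (m : ℕ) (hm : m < (σ (z k)).length) :
    y (c k + m) = (σ (z k))[m] :=
  ((block_eq_iff (by rw [h.step]; omega)).1 (h.block_eq k)).2 m hm

lemma strictMono (h : IsImage σ z c y) (hσ : ∀ i, σ i ≠ []) : StrictMono c :=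
  strictMono_of_step fun k => by
    have := List.length_pos_iff.2 (hσ (z k))
    rw [h.step]; omega

lemma monotone (h : IsImage σ z c y) : Monotone c :=
  monotone_int_of_le_succ fun k => by rw [h.step]; omega

lemma shift (h : IsImage σ z c y) (j : ℤ) :
    IsImage σ (fun k => z (k + j)) (fun k => c (k + j)) y where
  step k := by
    have := h.step (k + j)
    rw [← this]; congr 1; ring
  block_eq k := by
    rw [← h.block_eq (k + j)]; congr 2; ring

lemma translate (h : IsImage σ z c y) (p : ℤ) :
    IsImage σ z (fun k => c k - p) (fun n => y (n + p)) where
  step k := by rw [h.step]; ring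
  block_eq k := by
    rw [← h.block_eq k, block_shift]; congr 1 <;> ring

lemma block_extend (h : IsImage σ z c y) {k l : ℤ} (hkl : k ≤ l) :
    block y (c k) (c l) = extendWord σ (block z k l) := by
  obtain ⟨n, rfl⟩ := Int.le.dest hkl
  clear hkl
  induction n with
  | zero => simp [block_self]
  | succ n ih =>
    have h1 := h.monotone (show k ≤ k + n by omega)
    have h2 := h.monotone (show k + (n : ℤ) ≤ k + n + 1 by omega)
    push_cast
    rw [← add_assoc, ← block_append y h1 h2, ih, h.block_eq,
      ← block_append z (show k ≤ k + n by omega) (show k + (n : ℤ) ≤ k + n + 1 by omega),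
      extendWord_append, block_succ, extendWord_singleton]

/-- A word and the position of a cutting point determine the image. -/
lemma unique (hσ : ∀ i, σ i ≠ []) {c' : ℤ → ℤ} {y' : ℤ → ℬ} (h : IsImage σ z c y)
    (h' : IsImage σ z c' y') :
    (∀ k, c' k = c k + (c' 0 - c 0)) ∧ ∀ n, y' (n + (c' 0 - c 0)) = y n := by
  have hc : ∀ k, c' k = c k + (c' 0 - c 0) := eq_add_of_step_eq fun k => by
    rw [h.step, h'.step]; ring
  refine ⟨hc, fun n => ?_⟩
  obtain ⟨k, h1, h2⟩ := (h.strictMono hσ).exists_int_floor n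
  rw [h.step] at h2
  have e1 := h.getElem k (n - c k).toNat (by omega)
  have e2 := h'.getElem k (n - c k).toNat (by omega)
  rw [← e1, hc k] at e2
  convert e2 using 2 <;> omega

lemma exists_image (hσ : ∀ i, σ i ≠ []) (z : ℤ → 𝒜) (c0 : ℤ) :
    ∃ c y, c 0 = c0 ∧ IsImage σ z c y := by
  obtain ⟨c, hc0, hc⟩ := exists_int_sum (fun k => ((σ (z k)).length : ℤ)) c0
  have hmono : StrictMono c := strictMono_of_step fun k => by
    have := List.length_pos_iff.2 (hσ (z k))
    rw [hc]; omega
  choose κ h1 h2 using hmono.exists_int_floor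
  have hlt : ∀ n, (n - c (κ n)).toNat < (σ (z (κ n))).length := fun n => by
    have := h1 n
    have := h2 n
    rw [hc] at this
    omega
  refine ⟨c, fun n => (σ (z (κ n)))[(n - c (κ n)).toNat]'(hlt n), hc0, hc, fun k => ?_⟩
  rw [block_eq_iff (by rw [hc]; omega)]
  refine ⟨hc k, fun m hm => ?_⟩
  have hk : κ (c k + m) = k := hmono.int_floor_unique (h1 _) (h2 _) (by omega)
    (by rw [hc]; omega)
  simp only [hk, add_sub_cancel_left, Int.toNat_natCast]

lemma comp {τ : ℬ → List 𝒞} {d : ℤ → ℤ} {x : ℤ → 𝒞} (h : IsImage σ z c y)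
    (h' : IsImage τ y d x) : IsImage (morComp τ σ) z (fun k => d (c k)) x := by
  have key : ∀ k, block x (d (c k)) (d (c (k + 1))) = morComp τ σ (z k) := fun k => by
    rw [h'.block_extend (h.monotone (by omega)), h.block_eq]; rfl
  refine ⟨fun k => ?_, key⟩
  rw [← key, length_block]
  have := h'.monotone (h.monotone (show k ≤ k + 1 by omega))
  omega

/-- The forms `0 + j` and `1 + j` match `IsImage.shift` evaluated at `0` and `1`: after the shift by
`j`, block number `0` covers position `n`. -/
lemma exists_normalized (h : IsImage σ z c y) (hσ : ∀ i, σ i ≠ []) (n : ℤ) :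
    ∃ j, c (0 + j) ≤ n ∧ n < c (1 + j) := by
  obtain ⟨j, h1, h2⟩ := (h.strictMono hσ).exists_int_floor n
  exact ⟨j, by simpa using h1, by simpa [add_comm] using h2⟩

end IsImage

/-- `σ` is recognizable on `X`: a point is the image of points of `X` in at most one way. -/
def Recognizable (σ : 𝒜 → List ℬ) (X : Set (ℤ → 𝒜)) : Prop :=
  ∀ z ∈ X, ∀ z' ∈ X, ∀ c c' y, IsImage σ z c y → IsImage σ z' c' y →
    ∃ j, ∀ k, z' k = z (k + j) ∧ c' k = c (k + j)

/-- Two `σ`-representations of `y` induce representations of a `τ`-image of `y`, and the injective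
cut function of `τ` pulls the equality of cutting points back to `y`. -/
lemma Recognizable.of_morComp {σ : 𝒜 → List ℬ} {τ : ℬ → List 𝒞} {X : Set (ℤ → 𝒜)}
    (hτ : ∀ i, τ i ≠ []) (h : Recognizable (morComp τ σ) X) : Recognizable σ X := by
  intro z hz z' hz' c c' y hc hc'
  obtain ⟨d, x, _, hd⟩ := IsImage.exists_image hτ y 0
  obtain ⟨j, hj⟩ := h z hz z' hz' _ _ x (hc.comp hd) (hc'.comp hd)
  exact ⟨j, fun k => ⟨(hj k).1, (hd.strictMono hτ).injective (hj k).2⟩⟩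

lemma Recognizable.of_surjective {σ : 𝒜 → List ℬ} {τ : ℬ → List 𝒞} {X : Set (ℤ → 𝒜)}
    {Y : Set (ℤ → ℬ)} (hσ : ∀ i, σ i ≠ []) (h : Recognizable (morComp τ σ) X)
    (hsurj : ∀ y ∈ Y, ∃ z ∈ X, ∃ c, IsImage σ z c y) : Recognizable τ Y := by
  intro y hy y' hy' d d' x hd hd'
  obtain ⟨z, hz, c, hc⟩ := hsurj y hy
  obtain ⟨z', hz', c', hc'⟩ := hsurj y' hy'
  obtain ⟨j, hj⟩ := h z hz z' hz' _ _ x (hc.comp hd) (hc'.comp hd')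
  have hzz : z' = fun k => z (k + j) := funext fun k => (hj k).1
  subst hzz
  obtain ⟨-, h2⟩ := IsImage.unique hσ (hc.shift j) hc'
  -- The shift relating `y` and `y'` is measured in letters of `y`: it is the distance between
  -- corresponding `σ`-cuts.
  have hyy : ∀ n, y' n = y (n + (c (0 + j) - c' 0)) := fun n => by
    rw [← h2]; congr 1; ring
  refine ⟨c (0 + j) - c' 0, fun k => ⟨hyy k, ?_⟩⟩
  have hstep := eq_add_of_step_eq (F := fun k => d (k + (c (0 + j) - c' 0))) (F' := d')
    (fun k => by
      have h3 := hd.step (k + (c (0 + j) - c' 0))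
      rw [hd'.step k, hyy k]
      rw [show k + 1 + (c (0 + j) - c' 0) = k + (c (0 + j) - c' 0) + 1 by ring, h3]; ring)
  have h0 := hstep (c' 0)
  rw [hstep k]
  have h4 := (hj 0).2
  have h5 : c' 0 + (c (0 + j) - c' 0) = c (0 + j) := by ring
  simp only [h5] at h0
  linarith

/-! ### Limits along ultrafilters -/

/-- Ultrafilters take the place of diagonal extraction of subsequences: every sequence of letters
has a limit letter along one fixed ultrafilter. -/
lemma Ultrafilter.exists_eventually_eq {ι α : Type*} [Finite α] (U : Ultrafilter ι) (f : ι → α) :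
    ∃ a, ∀ᶠ i in U, f i = a := by
  by_contra h
  simp only [not_exists, ← Ultrafilter.eventually_not] at h
  have h' : ∀ a, ∀ᶠ i in U, ¬ f i = a := h
  obtain ⟨i, hi⟩ := (Filter.eventually_all.2 h').exists
  exact hi _ rfl

lemma Ultrafilter.exists_eventually_eq_of_mem {ι α : Type*} {s : Set α} (hs : s.Finite)
    (U : Ultrafilter ι) (f : ι → α) (hf : ∀ᶠ i in U, f i ∈ s) : ∃ a ∈ s, ∀ᶠ i in U, f i = a := by
  by_contra h
  simp only [not_exists, not_and, ← Ultrafilter.eventually_not] at h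
  have h' : ∀ a ∈ s, ∀ᶠ i in U, ¬ f i = a := h
  obtain ⟨i, hi, hi'⟩ := (((Filter.eventually_all_finite hs).2 h').and hf).exists
  exact hi _ hi' rfl

lemma eventually_block_eq {ι : Type*} {F : Filter ι} {z : ι → ℤ → 𝒜} {z0 : ℤ → 𝒜}
    (h : ∀ k, ∀ᶠ i in F, z i k = z0 k) (a b : ℤ) :
    ∀ᶠ i in F, block (z i) a b = block z0 a b := by
  have : ∀ᶠ i in F, ∀ k ∈ Set.Ico a b, z i k = z0 k :=
    (Filter.eventually_all_finite (Set.finite_Ico a b)).2 fun k _ => h k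
  filter_upwards [this] with i hi
  apply List.ext_getElem
  · simp [length_block]
  · intro m h1 h2
    rw [length_block] at h1
    rw [block_getElem, block_getElem]
    exact hi _ ⟨by omega, by omega⟩

lemma allowedWords_of_eventually {ι : Type*} {F : Filter ι} [F.NeBot] {φ : 𝒜 → List 𝒜}
    {z : ι → ℤ → 𝒜} {z0 : ℤ → 𝒜} (hz : ∀ i, z i ∈ allowedWords φ)
    (h : ∀ k, ∀ᶠ i in F, z i k = z0 k) : z0 ∈ allowedWords φ := by
  intro a b hab
  obtain ⟨i, hi⟩ := (eventually_block_eq h a b).exists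
  rw [← hi]; exact hz i a b hab

/-- Compactness of preimages. Because block `0` covers the origin and blocks have bounded length, `c
i 0` takes finitely many values, so it stabilizes along `U`; the other cuts then stabilize because
the letters do. -/
lemma IsImage.limit {ι : Type*} [Finite 𝒜] (U : Ultrafilter ι) {σ : 𝒜 → List ℬ}
    {z : ι → ℤ → 𝒜} {c : ι → ℤ → ℤ} {y : ι → ℤ → ℬ} {y0 : ℤ → ℬ}
    (h : ∀ i, IsImage σ (z i) (c i) (y i)) (h0 : ∀ i, c i 0 ≤ 0) (h1 : ∀ i, 0 < c i 1)
    (hy : ∀ n, ∀ᶠ i in U, y i n = y0 n) :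
    ∃ z0 c0, IsImage σ z0 c0 y0 ∧ (c0 0 ≤ 0 ∧ 0 < c0 1) ∧
      (∀ k, ∀ᶠ i in U, z i k = z0 k) ∧ ∀ k, ∀ᶠ i in U, c i k = c0 k := by
  choose z0 hz0 using fun k => U.exists_eventually_eq fun i => z i k
  obtain ⟨M, hM⟩ : ∃ M : ℕ, ∀ a, (σ a).length ≤ M := by
    obtain ⟨M, hM⟩ := (Set.finite_range fun a => (σ a).length).bddAbove
    exact ⟨M, fun a => hM ⟨a, rfl⟩⟩
  obtain ⟨e, -, he⟩ := U.exists_eventually_eq_of_mem (Set.finite_Icc (-(M : ℤ)) 0)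
    (fun i => c i 0) (Filter.Eventually.of_forall fun i => by
      have := (h i).step 0
      have := h1 i
      have := hM (z i 0)
      have := h0 i
      simp only [zero_add] at *
      constructor <;> omega)
  obtain ⟨c0, hc0, hc⟩ := exists_int_sum (fun k => ((σ (z0 k)).length : ℤ)) e
  have hck : ∀ k, ∀ᶠ i in U, c i k = c0 k := by
    intro k
    induction k using Int.induction_on with
    | zero => rw [hc0]; exact he
    | succ n ih =>
      filter_upwards [ih, hz0 n] with i e1 e2
      rw [hc, (h i).step, e1, e2]
    | pred n ih =>
      filter_upwards [ih, hz0 (-n - 1)] with i e1 e2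
      have e3 := hc (-n - 1)
      have e4 := (h i).step (-n - 1)
      rw [e2] at e4
      rw [sub_add_cancel] at e3 e4
      omega
  refine ⟨z0, c0, ⟨hc, fun k => ?_⟩, ?_, hz0, hck⟩
  · obtain ⟨i, e1, e2, e3, e4⟩ := (((hck k).and ((hck (k + 1)).and ((hz0 k).and
      (eventually_block_eq hy (c0 k) (c0 (k + 1))))))).exists
    rw [← e4, ← e1, ← e2, ← e3, (h i).block_eq]
  · obtain ⟨i, e1, e2⟩ := ((hck 0).and (hck 1)).exists
    rw [← e1, ← e2]; exact ⟨h0 i, h1 i⟩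

lemma hyperfilter_eventually_ge (n : ℕ) : ∀ᶠ m in (Filter.hyperfilter ℕ : Filter ℕ), n ≤ m := by
  have : ∀ᶠ m in (Filter.cofinite : Filter ℕ), n ≤ m := by
    rw [Nat.cofinite_eq_atTop]; exact Filter.eventually_ge_atTop n
  exact this.filter_mono Filter.hyperfilter_le_cofinite

end Symbolic

/-! ### Mixing substitutions -/

section Mixing

variable {𝒜 ℬ 𝒞 : Type*}

/-- Combinatorial form of primitivity, for substitutions that are not permutations of letters. -/
structure IsMixing (φ : 𝒜 → List 𝒜) : Prop where
  ne_nil : ∀ i, φ i ≠ []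
  mem_morPow : ∃ N, ∀ n ≥ N, ∀ i j, j ∈ morPow φ n i
  two_le : ∃ i, 2 ≤ (φ i).length

lemma length_extendWord_ge {σ : 𝒜 → List ℬ} {M : ℕ} (h : ∀ i, M ≤ (σ i).length) (u : List 𝒜) :
    M * u.length ≤ (extendWord σ u).length := by
  induction u with
  | nil => simp
  | cons a u ih =>
    have := h a
    simp only [List.length_cons, extendWord_cons, List.length_append]
    nlinarith

lemma length_extendWord_le {σ : 𝒜 → List ℬ} {M : ℕ} (h : ∀ i, (σ i).length ≤ M) (u : List 𝒜) :
    (extendWord σ u).length ≤ M * u.length := by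
  induction u with
  | nil => simp
  | cons a u ih =>
    have := h a
    simp only [List.length_cons, extendWord_cons, List.length_append]
    nlinarith

lemma length_le_length_extendWord {σ : 𝒜 → List ℬ} (h : ∀ i, σ i ≠ []) (u : List 𝒜) :
    u.length ≤ (extendWord σ u).length := by
  simpa using length_extendWord_ge (M := 1) (fun i => List.length_pos_iff.2 (h i)) u

lemma exists_length_le [Finite 𝒜] (σ : 𝒜 → List ℬ) : ∃ M : ℕ, ∀ a, (σ a).length ≤ M := by
  obtain ⟨M, hM⟩ := (Set.finite_range fun a => (σ a).length).bddAbove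
  exact ⟨M, fun a => hM ⟨a, rfl⟩⟩

lemma morPow_length_mono {φ : 𝒜 → List 𝒜} (h : ∀ i, φ i ≠ []) {m n : ℕ} (hmn : m ≤ n) (i : 𝒜) :
    (morPow φ m i).length ≤ (morPow φ n i).length := by
  obtain ⟨k, rfl⟩ := Nat.exists_eq_add_of_le' hmn
  rw [morPow_add]
  exact length_le_length_extendWord (morPow_ne_nil h k) _

namespace IsMixing

variable {φ : 𝒜 → List 𝒜}

/-- For large `N` every `φ^N(i)` contains a letter whose image has length at least two, so `φ^(1+N)`
at least doubles the length of every word; a linear lower bound is enough here. -/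
lemma growing (h : IsMixing φ) (L : ℕ) : ∃ n₀, ∀ n ≥ n₀, ∀ i, L ≤ (morPow φ n i).length := by
  obtain ⟨N, hN⟩ := h.mem_morPow
  obtain ⟨i₀, h₀⟩ := h.two_le
  have h2 : ∀ i, 2 ≤ (morPow φ (1 + N) i).length := fun i => by
    rw [morPow_add, morPow_one]
    exact h₀.trans (infix_extendWord_of_mem φ (hN N le_rfl i i₀)).length_le
  have hk : ∀ k i, k + 1 ≤ (morPow φ ((1 + N) * k) i).length := fun k => by
    induction k with
    | zero => intro i; simp [morPow]
    | succ k ih =>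
      intro i
      rw [mul_add, mul_one, add_comm ((1 + N) * k), morPow_add]
      have := length_extendWord_ge h2 (morPow φ ((1 + N) * k) i)
      have := ih i
      rw [morComp]; omega
  refine ⟨(1 + N) * L, fun n hn i => ?_⟩
  have := hk L i
  have := morPow_length_mono h.ne_nil hn i
  omega

lemma exists_forall_infix (h : IsMixing φ) {u : List 𝒜} (hu : u ∈ language φ) :
    ∃ n₀, ∀ n ≥ n₀, ∀ i, u <:+: morPow φ n i := by
  obtain ⟨N, hN⟩ := h.mem_morPow
  obtain ⟨-, i, n, hi⟩ := hu
  refine ⟨n + N, fun m hm j => ?_⟩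
  obtain ⟨k, rfl⟩ := Nat.exists_eq_add_of_le hm
  rw [add_assoc, morPow_add]
  exact hi.trans (infix_extendWord_of_mem (morPow φ n) (hN (N + k) (by omega) j i))

end IsMixing

lemma exists_prefix_of_long {σ : 𝒜 → List ℬ} {M : ℕ} (hM : ∀ i, (σ i).length ≤ M) {u : List ℬ}
    {v : List 𝒜} (h : u <+: extendWord σ v) (hu : M ≤ u.length) (hu0 : u ≠ []) :
    ∃ j, σ j <+: u := by
  cases v with
  | nil => simp [hu0] at h
  | cons a v =>
    refine ⟨a, ?_⟩
    exact List.prefix_of_prefix_length_le (by simp) h ((hM a).trans hu)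

lemma exists_infix_of_long {σ : 𝒜 → List ℬ} {M : ℕ} (hM : ∀ i, (σ i).length ≤ M) {u : List ℬ}
    {v : List 𝒜} (h : u <:+: extendWord σ v) (hu : 2 * M < u.length) :
    ∃ j, σ j <:+: u := by
  induction v with
  | nil => simp at h; subst h; simp at hu
  | cons a v ih =>
    obtain ⟨p, s, hps⟩ := h
    rw [extendWord_cons, List.append_assoc] at hps
    rcases List.append_eq_append_iff.1 hps with ⟨t, h1, h2⟩ | ⟨t, h1, h2⟩
    · rcases List.append_eq_append_iff.1 h2 with ⟨r, h3, h4⟩ | ⟨r, h3, h4⟩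
      · exfalso
        have := congrArg List.length h3
        have := congrArg List.length h1
        have := hM a
        simp only [List.length_append] at *
        omega
      · have hr : r.length > M := by
          have := congrArg List.length h3
          have := congrArg List.length h1
          have := hM a
          simp only [List.length_append] at *
          omega
        obtain ⟨j, hj⟩ := exists_prefix_of_long hM (u := r) (v := v) ⟨s, h4.symm⟩ hr.le
          (by rintro rfl; simp at hr)
        exact ⟨j, hj.isInfix.trans ⟨t, [], by rw [h3]; simp⟩⟩
    · exact ih ⟨t, s, by rw [h2, List.append_assoc]⟩

namespace IsMixing

variable {φ : 𝒜 → List 𝒜}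

/-- Every word of the language occurs arbitrarily far to the right in every allowed word. -/
lemma exists_block_eq [Finite 𝒜] (h : IsMixing φ) {x : ℤ → 𝒜} (hx : x ∈ allowedWords φ)
    {u : List 𝒜} (hu : u ∈ language φ) (a : ℤ) : ∃ p ≥ a, block x p (p + u.length) = u := by
  obtain ⟨s, hs⟩ := h.exists_forall_infix hu
  obtain ⟨M, hM⟩ := exists_length_le (morPow φ s)
  -- A window of length `2M + 1` sits in some `φ^t(i)`. It is longer than every `φ^s(j)`, which
  -- forces `s ≤ t`, and a window of this length inside a concatenation of words `φ^s(j)` contains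
  -- one of them entirely, hence contains `u`.
  obtain ⟨-, i, t, ht⟩ := mem_language_iff.1 (hx a (a + (2 * M + 1 : ℕ)) (by push_cast; omega))
  have hlen := ht.length_le
  rw [length_block] at hlen
  have hst : s ≤ t := by
    by_contra! hts
    have := morPow_length_mono h.ne_nil hts.le i
    have := hM i
    omega
  obtain ⟨k, rfl⟩ := Nat.exists_eq_add_of_le hst
  rw [morPow_add] at ht
  obtain ⟨j, hj⟩ := exists_infix_of_long hM ht (by rw [length_block]; omega)
  obtain ⟨p, hp, -, hp'⟩ := exists_block_of_infix (by push_cast; omega) ((hs s le_rfl j).trans hj)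
  exact ⟨p, hp, hp'⟩

end IsMixing

lemma block_getD_infix (u : List 𝒜) (d : 𝒜) {a b h : ℤ} (ha : 0 ≤ a + h) (hab : a ≤ b)
    (hb : b + h ≤ u.length) : block (fun j => u.getD (j + h).toNat d) a b <:+: u := by
  have : block (fun j => u.getD (j + h).toNat d) a b =
      (u.drop (a + h).toNat).take (b - a).toNat := by
    apply List.ext_getElem
    · simp only [length_block, List.length_take, List.length_drop]; omega
    · intro m h1 h2
      simp only [List.length_take, List.length_drop] at h2
      rw [block_getElem, List.getElem_take, List.getElem_drop, ← List.getD_eq_getElem _ d]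
      congr 1
      omega
  rw [this]
  exact (List.take_prefix _ _).isInfix.trans (List.drop_suffix _ _).isInfix

namespace IsMixing

variable {φ : 𝒜 → List 𝒜}

lemma allowedWords_nonempty [Finite 𝒜] [Nonempty 𝒜] (h : IsMixing φ) :
    (allowedWords φ).Nonempty := by
  obtain ⟨i⟩ := ‹Nonempty 𝒜›
  -- The word `φ^n(i)` placed with its middle at the origin and padded with `i`; the padding recedes
  -- to infinity as `n` grows.
  let y : ℕ → ℤ → 𝒜 := fun n j =>
    (morPow φ n i).getD (j + ((morPow φ n i).length / 2 : ℕ)).toNat i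
  choose y0 hy0 using fun k => (Filter.hyperfilter ℕ).exists_eventually_eq fun n => y n k
  refine ⟨y0, fun a b hab => ?_⟩
  obtain ⟨n₀, hn₀⟩ := h.growing (2 * (max (-a) b).toNat + 2)
  obtain ⟨n, e1, e2⟩ := ((eventually_block_eq hy0 a b).and (hyperfilter_eventually_ge n₀)).exists
  have := hn₀ n e2 i
  have := le_max_left (-a) b
  have := le_max_right (-a) b
  rw [← e1]
  refine language_of_infix (morPow_mem_language h.ne_nil n i) ?_
    (block_getD_infix _ _ (by omega) hab.le (by omega))
  intro h0
  have := congrArg List.length h0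
  rw [length_block] at this
  simp at this; omega

/-- Each allowed word is a limit of shifts of any other. -/
lemma exists_shifts [Finite 𝒜] (h : IsMixing φ) {y x : ℤ → 𝒜} (hy : y ∈ allowedWords φ)
    (hx : x ∈ allowedWords φ) :
    ∃ p : ℕ → ℤ, ∀ n, ∀ᶠ m in (Filter.hyperfilter ℕ : Filter ℕ), y (n + p m) = x n := by
  have key : ∀ m : ℕ, ∃ p, ∀ n : ℤ, |n| ≤ m → y (n + p) = x n := fun m => by
    obtain ⟨p, -, hp⟩ := h.exists_block_eq hy (hx (-m) (m + 1) (by omega)) 0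
    refine ⟨p + m, fun n hn => ?_⟩
    rw [abs_le] at hn
    have h1 := ((block_eq_iff (by omega)).1 hp).2 (n + m).toNat (by rw [length_block]; omega)
    rw [block_getElem] at h1
    convert h1 using 2 <;> omega
  choose p hp using key
  refine ⟨p, fun n => ?_⟩
  filter_upwards [hyperfilter_eventually_ge n.natAbs] with m hm
  exact hp m n (by rw [abs_le]; constructor <;> omega)

end IsMixing

/-! ### Morphisms between substitutions -/

/-- `ρ` intertwines `φ'` with `φ` and maps letters to words of the language of `φ`. -/
structure Intertwines (φ' : ℬ → List ℬ) (φ : 𝒜 → List 𝒜) (ρ : ℬ → List 𝒜) : Prop where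
  comm : ∀ i, extendWord ρ (φ' i) = extendWord φ (ρ i)
  mem_language : ∀ i, ρ i ∈ language φ

namespace Intertwines

variable {φ' : ℬ → List ℬ} {φ : 𝒜 → List 𝒜} {ρ : ℬ → List 𝒜}

lemma ne_nil (h : Intertwines φ' φ ρ) (i : ℬ) : ρ i ≠ [] := (h.mem_language i).1

lemma self (h : ∀ i, φ i ≠ []) (n : ℕ) : Intertwines φ φ (morPow φ n) where
  comm i := by
    change morComp (morPow φ n) φ i = morComp φ (morPow φ n) i
    have h1 := congrFun (morPow_add φ n 1) i
    have h2 := congrFun (morPow_add φ 1 n) i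
    rw [morPow_one] at h1 h2
    rw [← h1, ← h2, add_comm]
  mem_language i := morPow_mem_language h n i

lemma comm_word (h : Intertwines φ' φ ρ) (u : List ℬ) :
    extendWord ρ (extendWord φ' u) = extendWord φ (extendWord ρ u) := by
  induction u with
  | nil => rfl
  | cons a u ih => simp [ih, h.comm]

lemma comm_morPow (h : Intertwines φ' φ ρ) (n : ℕ) (i : ℬ) :
    extendWord ρ (morPow φ' n i) = extendWord (morPow φ n) (ρ i) := by
  induction n with
  | zero => simp [morPow_zero, extendWord_morPow]
  | succ n ih =>
    rw [add_comm, morPow_add, morPow_one, morComp, h.comm_word, ih, extendWord_morPow,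
      extendWord_morPow, add_comm 1 n, Function.iterate_succ_apply']

lemma extendWord_mem_language (h : Intertwines φ' φ ρ) (hφ : ∀ i, φ i ≠ []) {u : List ℬ}
    (hu : u ∈ language φ') : extendWord ρ u ∈ language φ := by
  obtain ⟨h0, i, n, hi⟩ := mem_language_iff.1 hu
  refine language_of_infix (extendWord_morPow_mem_language hφ (h.mem_language i) n) ?_ ?_
  · rwa [Ne, extendWord_eq_nil_iff h.ne_nil]
  · rw [← h.comm_morPow]; exact extendWord_infix _ hi

lemma image_mem (h : Intertwines φ' φ ρ) (hφ : ∀ i, φ i ≠ []) {z : ℤ → ℬ}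
    (hz : z ∈ allowedWords φ') {c : ℤ → ℤ} {y : ℤ → 𝒜} (hc : IsImage ρ z c y) :
    y ∈ allowedWords φ := by
  refine allowedWords_of_cofinal fun L => ?_
  have hmono := hc.strictMono h.ne_nil
  obtain ⟨k, hk, -⟩ := hmono.exists_int_floor (-L)
  obtain ⟨l, -, hl⟩ := hmono.exists_int_floor (max L (-L))
  have h1 := le_max_left L (-L)
  have h2 := le_max_right L (-L)
  have hkl : k < l + 1 := hmono.lt_iff_lt.1 (by omega)
  refine ⟨c k, c (l + 1), hk, by omega, ?_⟩
  rw [hc.block_extend hkl.le]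
  exact h.extendWord_mem_language hφ (hz _ _ hkl)

/-- The image of a single allowed word of `φ'` is an allowed word of `φ`, and by minimality every
other one is a limit of its shifts; normalized preimages of these shifts converge to a preimage of
the limit. -/
lemma exists_preimage [Finite 𝒜] [Finite ℬ] [Nonempty ℬ] (h : Intertwines φ' φ ρ)
    (hφ : IsMixing φ) (hφ' : IsMixing φ') {x : ℤ → 𝒜} (hx : x ∈ allowedWords φ) :
    ∃ z ∈ allowedWords φ', ∃ c, IsImage ρ z c x := by
  obtain ⟨z, hz⟩ := hφ'.allowedWords_nonempty
  obtain ⟨c, y, -, hc⟩ := IsImage.exists_image h.ne_nil z 0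
  obtain ⟨p, hp⟩ := hφ.exists_shifts (h.image_mem hφ.ne_nil hz hc) hx
  choose j hj1 hj2 using fun m => hc.exists_normalized h.ne_nil (p m)
  obtain ⟨z0, c0, h1, -, h3, -⟩ := IsImage.limit (Filter.hyperfilter ℕ)
    (fun m => (hc.shift (j m)).translate (p m)) (fun m => by have := hj1 m; omega)
    (fun m => by have := hj2 m; omega) hp
  exact ⟨z0, allowedWords_of_eventually (fun m => allowedWords_shift hz (j m)) h3, c0, h1⟩

end Intertwines

/-! ### Local recognizability -/

lemma Recognizable.eq_of_normalized {σ : 𝒜 → List ℬ} {X : Set (ℤ → 𝒜)} (hσ : ∀ i, σ i ≠ [])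
    (h : Recognizable σ X) {z z' : ℤ → 𝒜} (hz : z ∈ X) (hz' : z' ∈ X) {c c' : ℤ → ℤ}
    {y : ℤ → ℬ} (hc : IsImage σ z c y) (hc' : IsImage σ z' c' y) {n : ℤ}
    (h0 : c 0 ≤ n) (h1 : n < c 1) (h0' : c' 0 ≤ n) (h1' : n < c' 1) : z' = z ∧ c' = c := by
  obtain ⟨j, hj⟩ := h z hz z' hz' c c' y hc hc'
  have hj0 : 0 = j := (hc.strictMono hσ).int_floor_unique (n := n) h0 (by simpa using h1)
    (by have := (hj 0).2; rw [zero_add] at this; omega)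
    (by have := (hj 1).2; rw [add_comm] at this; omega)
  subst hj0
  exact ⟨funext fun k => by simpa using (hj k).1, funext fun k => by simpa using (hj k).2⟩

/-- If every window size failed, the counterexamples would have as limits two normalized
representations of the same point that differ in their block at the origin. -/
lemma Recognizable.exists_local [Finite 𝒜] [Finite ℬ] {φ : 𝒜 → List 𝒜} {σ : 𝒜 → List ℬ}
    (hσ : ∀ i, σ i ≠ []) (h : Recognizable σ (allowedWords φ)) :
    ∃ L₀ : ℕ, ∀ z ∈ allowedWords φ, ∀ z' ∈ allowedWords φ, ∀ c c' y y', IsImage σ z c y →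
      IsImage σ z' c' y' → c 0 ≤ 0 → 0 < c 1 → c' 0 ≤ 0 → 0 < c' 1 →
      (∀ n : ℤ, |n| ≤ L₀ → y n = y' n) → z 0 = z' 0 ∧ c 0 = c' 0 := by
  by_contra! hcon
  choose z hz z' hz' c c' y y' h1 h2 h3 h4 h5 h6 h7 h8 using hcon
  choose y0 hy0 using fun k => (Filter.hyperfilter ℕ).exists_eventually_eq fun n => y n k
  have hy0' : ∀ k, ∀ᶠ n in (Filter.hyperfilter ℕ : Filter ℕ), y' n k = y0 k := fun k => by
    filter_upwards [hy0 k, hyperfilter_eventually_ge k.natAbs] with n e1 e2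
    rw [← e1, h7 n k (by rw [abs_le]; constructor <;> omega)]
  obtain ⟨z0, c0, g1, g2, g3, g4⟩ := IsImage.limit (Filter.hyperfilter ℕ) h1 h3 h4 hy0
  obtain ⟨z0', c0', g1', g2', g3', g4'⟩ := IsImage.limit (Filter.hyperfilter ℕ) h2 h5 h6 hy0'
  obtain ⟨rfl, rfl⟩ := h.eq_of_normalized hσ (allowedWords_of_eventually hz g3)
    (allowedWords_of_eventually hz' g3') g1 g1' g2.1 g2.2 g2'.1 g2'.2
  obtain ⟨n, e1, e2, e3, e4⟩ := ((g3 0).and ((g3' 0).and ((g4 0).and (g4' 0)))).exists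
  exact h8 n (e1.trans e2.symm) (e3.trans e4.symm)

end Mixing

/-! ### Factorization of morphisms through small alphabets -/

section Defect

variable {𝒜 ℬ 𝒞 𝒟 : Type*}

/-- `σ` is a composition of nonerasing morphisms through an alphabet with `d` letters. -/
def FactorsThrough (σ : 𝒜 → List ℬ) (d : ℕ) : Prop :=
  ∃ (τ : 𝒜 → List (Fin d)) (σ' : Fin d → List ℬ), (∀ i, τ i ≠ []) ∧ (∀ i, σ' i ≠ []) ∧
    σ = morComp σ' τ

lemma morComp_assoc (ρ : 𝒞 → List 𝒟) (σ : ℬ → List 𝒞) (τ : 𝒜 → List ℬ) :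
    morComp (morComp ρ σ) τ = morComp ρ (morComp σ τ) := by
  funext i; rw [morComp, extendWord_morComp]; rfl

lemma FactorsThrough.of_fintype [Fintype 𝒟] {σ : 𝒜 → List ℬ} (τ : 𝒜 → List 𝒟)
    (σ' : 𝒟 → List ℬ) (hτ : ∀ i, τ i ≠ []) (hσ' : ∀ i, σ' i ≠ []) (h : σ = morComp σ' τ) :
    FactorsThrough σ (Fintype.card 𝒟) := by
  have e := Fintype.equivFin 𝒟
  refine ⟨fun i => (τ i).map e, fun i => σ' (e.symm i), fun i => by simpa using hτ i,
    fun i => hσ' _, ?_⟩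
  rw [h]; funext i
  simp [morComp, extendWord, List.flatMap_map]

lemma FactorsThrough.comp {σ : ℬ → List 𝒞} {d : ℕ} (h : FactorsThrough σ d)
    {τ : 𝒜 → List ℬ} (hτ : ∀ i, τ i ≠ []) {ρ : 𝒞 → List 𝒟} (hρ : ∀ i, ρ i ≠ []) :
    FactorsThrough (morComp ρ (morComp σ τ)) d := by
  obtain ⟨τ', σ', h1, h2, rfl⟩ := h
  exact ⟨morComp τ' τ, morComp ρ σ', morComp_ne_nil h1 hτ, morComp_ne_nil hρ h2, by
    simp only [morComp_assoc]⟩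

lemma morComp_singleton_left (τ : 𝒜 → List ℬ) : morComp (fun i => [i]) τ = τ := by
  funext i; simp [morComp, extendWord]

lemma morComp_singleton_right (τ : 𝒜 → List ℬ) : morComp τ (fun i => [i]) = τ := by
  funext i; simp [morComp]

/-- Some arbitrarily long words beginning with `a` and with `b` have comparable images. -/
def Forks (σ : 𝒜 → List ℬ) (a b : 𝒜) : Prop :=
  a ≠ b ∧ ∀ n : ℕ, ∃ u v : List 𝒜, n ≤ u.length ∧ n ≤ v.length ∧
    (extendWord σ (a :: u) <+: extendWord σ (b :: v) ∨
      extendWord σ (b :: v) <+: extendWord σ (a :: u))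

lemma Forks.symm {σ : 𝒜 → List ℬ} {a b : 𝒜} (h : Forks σ a b) : Forks σ b a :=
  ⟨h.1.symm, fun n => let ⟨u, v, h1, h2, h3⟩ := h.2 n; ⟨v, u, h2, h1, h3.symm⟩⟩

/-- Replacing `b` by `a` does not change images, so the alphabet without `b` suffices. -/
lemma FactorsThrough.of_eq [Fintype 𝒜] {σ : 𝒜 → List ℬ} (hσ : ∀ i, σ i ≠ []) {a b : 𝒜}
    (hab : a ≠ b) (h : σ a = σ b) : ∃ d < Fintype.card 𝒜, FactorsThrough σ d := by
  classical
  refine ⟨_, Fintype.card_subtype_lt (p := (· ≠ b)) (x := b) (by simp),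
    FactorsThrough.of_fintype (𝒟 := {x // x ≠ b})
      (fun i => if hi : i = b then [⟨a, hab⟩] else [⟨i, hi⟩]) (fun i => σ i) (fun i => ?_)
      (fun i => hσ _) ?_⟩
  · split_ifs <;> simp
  · funext i
    by_cases hi : i = b <;> simp [morComp, hi, h]

/-- The elementary step: the image of `a` is cut off the image of `b`. -/
lemma Forks.step [Finite 𝒜] [DecidableEq 𝒜] {σ : 𝒜 → List ℬ} {a b : 𝒜} (h : Forks σ a b)
    {s : List ℬ} (hs : σ b = σ a ++ s) :
    σ = morComp (Function.update σ b s) (Function.update (fun i => [i]) b [a, b]) ∧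
      ∃ d, Forks (Function.update σ b s) d b := by
  set σ₁ := Function.update σ b s with hσ₁
  set τ : 𝒜 → List 𝒜 := Function.update (fun i => [i]) b [a, b] with hτ
  have e1 : σ = morComp σ₁ τ := by
    funext i
    by_cases hi : i = b
    · subst hi; simp [morComp, hτ, hσ₁, h.1, hs]
    · simp [morComp, hτ, hσ₁, hi]
  have hlen : ∀ u : List 𝒜, u.length ≤ (extendWord τ u).length :=
    length_le_length_extendWord fun i => by
      by_cases hi : i = b
      · subst hi; simp [hτ]
      · simp [hτ, hi]
  refine ⟨e1, ?_⟩
  -- Once the common prefix `σ a` is cancelled, the second word still begins with `b`, while the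
  -- first begins with the first letter of a `τ`-image, which is never `b` because `τ b` starts with
  -- `a`. That letter may depend on `n`; the ultrafilter below selects one that serves arbitrarily
  -- long words.
  have key : ∀ n : ℕ, ∃ d, d ≠ b ∧ ∃ u v : List 𝒜, n ≤ u.length ∧ n ≤ v.length ∧
      (extendWord σ₁ (d :: u) <+: extendWord σ₁ (b :: v) ∨
      extendWord σ₁ (b :: v) <+: extendWord σ₁ (d :: u)) := by
    intro n
    obtain ⟨u, v, hu, hv, huv⟩ := h.2 (n + 1)
    have hau : extendWord σ (a :: u) = σ a ++ extendWord σ₁ (extendWord τ u) := by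
      rw [← extendWord_morComp, ← e1]; simp
    have hbv : extendWord σ (b :: v) = σ a ++ extendWord σ₁ (b :: extendWord τ v) := by
      rw [extendWord_cons σ₁, ← extendWord_morComp, ← e1]; simp [hs, hσ₁]
    rw [hau, hbv, List.prefix_append_right_inj, List.prefix_append_right_inj] at huv
    cases u with
    | nil => simp at hu
    | cons e u =>
      have : ∃ d, d ≠ b ∧ ∃ t, extendWord τ (e :: u) = d :: t := by
        by_cases he : e = b
        · subst he
          exact ⟨a, h.1, e :: extendWord τ u, by simp [hτ]⟩
        · exact ⟨e, he, extendWord τ u, by simp [hτ, he]⟩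
      obtain ⟨d, hd, t, ht⟩ := this
      have h1 := hlen (e :: u)
      have h2 := hlen v
      rw [ht] at huv h1
      exact ⟨d, hd, t, extendWord τ v, by simp at h1 hu; omega, by omega, huv⟩
  choose d hd u v h1 h2 h3 using key
  obtain ⟨d₀, hd₀⟩ := (Filter.hyperfilter ℕ).exists_eventually_eq d
  refine ⟨d₀, ?_, fun n => ?_⟩
  · obtain ⟨n, hn⟩ := hd₀.exists
    rw [← hn]; exact hd n
  · obtain ⟨m, hm, hm'⟩ := (hd₀.and (hyperfilter_eventually_ge n)).exists
    subst hm
    exact ⟨u m, v m, hm'.trans (h1 m), hm'.trans (h2 m), h3 m⟩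

/-- A morphism that is not injective on right-infinite words factors through a smaller alphabet. -/
theorem Forks.factorsThrough [Fintype 𝒜] {σ : 𝒜 → List ℬ} (hσ : ∀ i, σ i ≠ []) {a b : 𝒜}
    (h : Forks σ a b) : ∃ d < Fintype.card 𝒜, FactorsThrough σ d := by
  classical
  -- Induction on the total length of the images: each elementary step removes `σ a` from the image
  -- of `b` and keeps a fork. The process ends when two letters have the same image.
  generalize hN : ∑ i, (σ i).length = N
  induction N using Nat.strong_induction_on generalizing σ a b with
  | _ N ih =>
    wlog hpre : σ a <+: σ b generalizing a b
    · refine this h.symm ?_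
      obtain ⟨u, v, -, -, huv⟩ := h.2 0
      simp only [extendWord_cons] at huv
      rcases huv with h1 | h1
      · rcases List.prefix_or_prefix_of_prefix ((List.prefix_append _ _).trans h1)
          (List.prefix_append (σ b) _) with h2 | h2
        · exact absurd h2 hpre
        · exact h2
      · rcases List.prefix_or_prefix_of_prefix ((List.prefix_append _ _).trans h1)
          (List.prefix_append (σ a) _) with h2 | h2
        · exact h2
        · exact absurd h2 hpre
    obtain ⟨s, hs⟩ := hpre
    rcases eq_or_ne s [] with rfl | hs0
    · exact FactorsThrough.of_eq hσ h.1 (by simpa using hs)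
    · obtain ⟨h1, d, h2⟩ := h.step hs.symm
      have hne : ∀ i, Function.update σ b s i ≠ [] := fun i => by
        by_cases hi : i = b
        · subst hi; simpa using hs0
        · simpa [hi] using hσ i
      obtain ⟨d, hd, hd'⟩ := ih _ (by
        rw [← hN]
        refine Finset.sum_lt_sum (fun i _ => ?_) ⟨b, Finset.mem_univ _, ?_⟩
        · by_cases hi : i = b
          · subst hi; simp [← hs]
          · simp [hi]
        · simpa [← hs] using List.length_pos_iff.2 (hσ a)) hne h2 rfl
      refine ⟨d, hd, ?_⟩
      have h3 := hd'.comp (τ := Function.update (fun i => [i]) b [a, b]) (fun i => by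
        by_cases hi : i = b
        · subst hi; simp
        · simp [hi]) (ρ := fun i => [i]) (by simp)
      rwa [morComp_singleton_left, ← h1] at h3

lemma extendWord_reverse (σ : 𝒜 → List ℬ) (u : List 𝒜) :
    extendWord (fun i => (σ i).reverse) u.reverse = (extendWord σ u).reverse := by
  induction u with
  | nil => rfl
  | cons a u ih => simp [ih]

lemma FactorsThrough.of_reverse {σ : 𝒜 → List ℬ} {d : ℕ}
    (h : FactorsThrough (fun i => (σ i).reverse) d) : FactorsThrough σ d := by
  obtain ⟨τ, σ', h1, h2, h3⟩ := h
  refine ⟨fun i => (τ i).reverse, fun i => (σ' i).reverse, fun i => by simpa using h1 i,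
    fun i => by simpa using h2 i, ?_⟩
  funext i
  rw [morComp, extendWord_reverse]
  exact (List.reverse_eq_iff.1 (congrFun h3 i))

/-- Two points with the same image and a common cutting point coincide. -/
def CutInjective (σ : 𝒜 → List ℬ) : Prop :=
  ∀ z z' c c' y, IsImage σ z c y → IsImage σ z' c' y → ∀ k l, c k = c' l →
    ∀ i, z' (l + i) = z (k + i) ∧ c' (l + i) = c (k + i)

/-- Different letters after a common cut would start arbitrarily long words with comparable images,
that is, a fork. Letters before a common cut are compared by applying the same argument to the
reversed morphism, so agreement spreads from the cut in both directions. -/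
theorem cutInjective_of_not_factorsThrough [Fintype 𝒜] {σ : 𝒜 → List ℬ} (hσ : ∀ i, σ i ≠ [])
    (h : ∀ d < Fintype.card 𝒜, ¬ FactorsThrough σ d) : CutInjective σ := by
  have right : ∀ z z' c c' y, IsImage σ z c y → IsImage σ z' c' y → ∀ k l, c k = c' l →
      z' l = z k := by
    intro z z' c c' y hc hc' k l hkl
    by_contra hne
    obtain ⟨d, hd, hd'⟩ := Forks.factorsThrough hσ (a := z' l) (b := z k) ⟨hne, fun n =>
      ⟨block z' (l + 1) (l + 1 + n), block z (k + 1) (k + 1 + n), by rw [length_block]; omega,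
        by rw [length_block]; omega, by
          have e1 := block_append z' (show l ≤ l + 1 by omega) (show l + 1 ≤ l + 1 + n by omega)
          have e2 := block_append z (show k ≤ k + 1 by omega) (show k + 1 ≤ k + 1 + n by omega)
          rw [block_succ, List.singleton_append] at e1 e2
          rw [e1, e2, ← hc.block_extend (by omega), ← hc'.block_extend (by omega), hkl]
          have m1 := hc'.monotone (show l ≤ l + 1 + n by omega)
          have m2 := hc.monotone (show k ≤ k + 1 + n by omega)
          rcases le_total (c' (l + 1 + n)) (c (k + 1 + n)) with h5 | h5
          · left; rw [← block_append y m1 h5]; exact List.prefix_append _ _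
          · right; rw [← block_append y (hkl ▸ m2) h5]; exact List.prefix_append _ _⟩⟩
    exact h d hd hd'
  have left : ∀ z z' c c' y, IsImage σ z c y → IsImage σ z' c' y → ∀ k l,
      c (k + 1) = c' (l + 1) → z' l = z k := by
    intro z z' c c' y hc hc' k l hkl
    by_contra hne
    obtain ⟨d, hd, hd'⟩ := Forks.factorsThrough (σ := fun i => (σ i).reverse) (by simpa using hσ)
      (a := z' l) (b := z k) ⟨hne, fun n =>
      ⟨(block z' (l - n) l).reverse, (block z (k - n) k).reverse,
        by rw [List.length_reverse, length_block]; omega,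
        by rw [List.length_reverse, length_block]; omega, by
          have e1 := block_append z' (show l - n ≤ l by omega) (show l ≤ l + 1 by omega)
          have e2 := block_append z (show k - n ≤ k by omega) (show k ≤ k + 1 by omega)
          rw [block_succ] at e1 e2
          have e1' := congrArg List.reverse e1
          have e2' := congrArg List.reverse e2
          rw [List.reverse_append, List.reverse_singleton, List.singleton_append] at e1' e2'
          rw [e1', e2', extendWord_reverse, extendWord_reverse, List.reverse_prefix,
            List.reverse_prefix, ← hc.block_extend (by omega), ← hc'.block_extend (by omega), hkl]
          have m1 := hc'.monotone (show l - n ≤ l + 1 by omega)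
          have m2 := hc.monotone (show k - n ≤ k + 1 by omega)
          rcases le_total (c' (l - n)) (c (k - n)) with h5 | h5
          · right; rw [← block_append y h5 (hkl ▸ m2)]; exact List.suffix_append _ _
          · left; rw [← block_append y h5 m1]; exact List.suffix_append _ _⟩⟩
    exact h d hd (FactorsThrough.of_reverse hd')
  intro z z' c c' y hc hc' k l hkl i
  have step : ∀ k l, c k = c' l → c' (l + 1) = c (k + 1) := fun k l hkl => by
    rw [hc.step, hc'.step, hkl, right z z' c c' y hc hc' k l hkl]
  have step' : ∀ k l, c (k + 1) = c' (l + 1) → c' l = c k := fun k l hkl => by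
    have := hc.step k
    have := hc'.step l
    rw [left z z' c c' y hc hc' k l hkl] at this
    omega
  have hcc : ∀ i, c' (l + i) = c (k + i) := by
    intro i
    induction i using Int.induction_on with
    | zero => simpa using hkl.symm
    | succ n ih => rw [← add_assoc, ← add_assoc]; exact step _ _ ih.symm
    | pred n ih =>
      refine step' _ _ ?_
      rw [show k + (-(n : ℤ) - 1) + 1 = k + -n by ring,
        show l + (-(n : ℤ) - 1) + 1 = l + -n by ring]
      exact ih.symm
  exact ⟨right z z' c c' y hc hc' _ _ (hcc i).symm, hcc i⟩

end Defect

/-! ### Recognizability of substitutions without periodic points -/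

section Recognizability

variable {𝒜 : Type*}

/-- No allowed word is periodic. -/
def HasNoPeriod (φ : 𝒜 → List 𝒜) : Prop :=
  ∀ x ∈ allowedWords φ, ∀ d : ℤ, 0 < d → ¬ ∀ k, x (k + d) = x k

/-- The finite word `w` has period `d`. -/
def PeriodicWord (w : List 𝒜) (d : ℕ) : Prop := ∀ m, m + d < w.length → w[m]? = w[m + d]?

lemma PeriodicWord.infix {u w : List 𝒜} {d : ℕ} (h : PeriodicWord w d) (huw : u <:+: w) :
    PeriodicWord u d := by
  obtain ⟨s, t, rfl⟩ := huw
  intro m hm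
  have := h (s.length + m) (by simp; omega)
  rwa [List.append_assoc, List.getElem?_append_right (Nat.le_add_right _ _), add_assoc,
    List.getElem?_append_right (Nat.le_add_right _ _), Nat.add_sub_cancel_left,
    Nat.add_sub_cancel_left, List.getElem?_append_left (by omega),
    List.getElem?_append_left (by omega)] at this

lemma IsMixing.exists_forall_pair_infix [Finite 𝒜] {φ : 𝒜 → List 𝒜} (h : IsMixing φ) :
    ∃ m, ∀ a b, [a, b] ∈ language φ → ∀ i, [a, b] <:+: morPow φ m i := by
  have : ∀ p : 𝒜 × 𝒜, ∃ n₀, [p.1, p.2] ∈ language φ → ∀ n ≥ n₀, ∀ i,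
      [p.1, p.2] <:+: morPow φ n i := fun p => by
    by_cases hp : [p.1, p.2] ∈ language φ
    · obtain ⟨n₀, hn₀⟩ := h.exists_forall_infix hp
      exact ⟨n₀, fun _ => hn₀⟩
    · exact ⟨0, fun h => absurd h hp⟩
  choose f hf using this
  obtain ⟨m, hm⟩ := (Set.finite_range f).bddAbove
  exact ⟨m, fun a b hab => hf (a, b) hab m (hm ⟨_, rfl⟩)⟩

/-- By primitivity `φ^r(j)` occurs in `φ^(r+N)(i)`, whose length is at most a constant times that of
`φ^r(i)`. The constant does not depend on `r`. -/
lemma IsMixing.exists_length_ratio [Finite 𝒜] {φ : 𝒜 → List 𝒜} (h : IsMixing φ) :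
    ∃ K, ∀ r i j, (morPow φ r j).length ≤ K * (morPow φ r i).length := by
  obtain ⟨N, hN⟩ := h.mem_morPow
  obtain ⟨K, hK⟩ := exists_length_le (morPow φ N)
  refine ⟨K, fun r i j => ?_⟩
  have h1 : (morPow φ r j).length ≤ (morPow φ (r + N) i).length := by
    rw [morPow_add]
    exact (infix_extendWord_of_mem (morPow φ r) (hN N le_rfl i j)).length_le
  rw [add_comm, morPow_add] at h1
  exact h1.trans (length_extendWord_le hK _)

/-- The words `φⁿ(i)` have no short periods. -/
lemma IsMixing.exists_period_bound [Finite 𝒜] [Nonempty 𝒜] {φ : 𝒜 → List 𝒜} (h : IsMixing φ)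
    (hper : HasNoPeriod φ) :
    ∃ Q : ℕ, 0 < Q ∧ ∀ n i d, 0 < d → PeriodicWord (morPow φ n i) d →
      (morPow φ n i).length ≤ Q * d := by
  obtain ⟨m, hm⟩ := h.exists_forall_pair_infix
  obtain ⟨K, hK⟩ := h.exists_length_ratio
  obtain ⟨M, hM⟩ := exists_length_le (morPow φ m)
  refine ⟨M * K + M + 1, by omega, fun n i d hd hp => ?_⟩
  -- Suppose `φ^n(i)` has a period `d` that is too short. The term `M` in the constant gives `n = r
  -- + m`, and the term `M * K` makes `d` shorter than every `φ^r(b)`. All allowed two-letter words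
  -- occur in `φ^m(i)`, so the image under `φ^r` of each of them has period `d`. Consecutive pairs
  -- overlap in a block longer than `d`, so the `φ^r`-image of a whole allowed word is `d`-periodic.
  by_contra! hlt
  have hmn : m ≤ n := by
    by_contra! hnm
    have h1 := morPow_length_mono h.ne_nil hnm.le i
    have h2 := hM i
    have h3 : M * 1 ≤ (M * K + M + 1) * d := Nat.mul_le_mul (by omega) hd
    omega
  obtain ⟨r, rfl⟩ := Nat.exists_eq_add_of_le' hmn
  have hd' : ∀ b, d < (morPow φ r b).length := by
    intro b
    by_contra! hb
    have h1 : (morPow φ (r + m) i).length ≤ (K * (morPow φ r b).length) * M := by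
      rw [morPow_add]
      exact (length_extendWord_le (hK r b) _).trans (Nat.mul_le_mul_left _ (hM i))
    have h2 : (K * (morPow φ r b).length) * M ≤ M * K * d := by
      calc _ ≤ (K * d) * M := by gcongr
        _ = M * K * d := by ring
    nlinarith
  obtain ⟨z, hz⟩ := h.allowedWords_nonempty
  obtain ⟨c, y, -, hc⟩ := IsImage.exists_image (morPow_ne_nil h.ne_nil r) z 0
  refine hper y ((Intertwines.self h.ne_nil r).image_mem h.ne_nil hz hc) d (by omega) fun k => ?_
  obtain ⟨l, h1, h2⟩ := (hc.strictMono (morPow_ne_nil h.ne_nil r)).exists_int_floor k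
  have h3 : block y (c l) (c (l + 2)) <:+: morPow φ (r + m) i := by
    rw [hc.block_extend (by omega), morPow_add]
    refine extendWord_infix _ ?_
    have h4 : block z l (l + 2) = [z l, z (l + 1)] := by
      rw [← block_append z (show l ≤ l + 1 by omega) (show l + 1 ≤ l + 2 by omega), block_succ,
        show l + 2 = l + 1 + 1 by ring, block_succ]; rfl
    rw [h4]
    refine hm _ _ ?_ i
    rw [← h4]; exact hz _ _ (by omega)
  have h5 := hc.step (l + 1)
  have h6 := hd' (z (l + 1))
  rw [show l + 1 + 1 = l + 2 by ring] at h5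
  have h7 := hp.infix h3 (k - c l).toNat (by rw [length_block]; omega)
  rw [List.getElem?_eq_getElem (by rw [length_block]; omega),
    List.getElem?_eq_getElem (by rw [length_block]; omega), Option.some_inj, block_getElem,
    block_getElem] at h7
  symm
  convert h7 using 2 <;> push_cast <;> omega

/-- The ways to write `x` as the image under `σ` of an allowed word, normalized so that the
block number `0` contains the origin. -/
def representations (φ σ : 𝒜 → List 𝒜) (x : ℤ → 𝒜) : Set ((ℤ → 𝒜) × (ℤ → ℤ)) :=
  {p | p.1 ∈ allowedWords φ ∧ IsImage σ p.1 p.2 x ∧ p.2 0 ≤ 0 ∧ 0 < p.2 1}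

/-- A common cut makes the two representations equal up to a shift of indices, and the normalization
at the origin leaves only the trivial shift. -/
lemma representations_eq_of_cut {φ σ : 𝒜 → List 𝒜} (hσ : ∀ i, σ i ≠ []) (hcut : CutInjective σ)
    {x : ℤ → 𝒜} {p q : (ℤ → 𝒜) × (ℤ → ℤ)} (hp : p ∈ representations φ σ x)
    (hq : q ∈ representations φ σ x) {k l : ℤ} (h : p.2 k = q.2 l) : p = q ∧ k = l := by
  obtain ⟨z, c⟩ := p
  obtain ⟨z', c'⟩ := q
  have key := hcut z z' c c' x hp.2.1 hq.2.1 k l h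
  have h0 := (key (-l)).2
  have h1 := (key (1 - l)).2
  rw [add_neg_cancel] at h0
  rw [show l + (1 - l) = 1 by ring, show k + (1 - l) = k + -l + 1 by ring] at h1
  have h2 : 0 = k + -l := (hp.2.1.strictMono hσ).int_floor_unique (n := 0) hp.2.2.1
    (by simpa using hp.2.2.2) (h0.symm.trans_le hq.2.2.1) (hq.2.2.2.trans_eq h1)
  have hkl : k = l := by omega
  subst hkl
  refine ⟨Prod.ext (funext fun i => ?_) (funext fun i => ?_), rfl⟩
  · simpa using (key (i - k)).1.symm
  · simpa using (key (i - k)).2.symm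

/-- Every allowed word has at least `K` representations. -/
def ManyRepresentations (φ σ : 𝒜 → List 𝒜) (K : ℕ) : Prop :=
  ∀ x ∈ allowedWords φ, ∃ f : Fin K → (ℤ → 𝒜) × (ℤ → ℤ),
    Function.Injective f ∧ ∀ i, f i ∈ representations φ σ x

/-- Every allowed word is a limit of shifts of `x`, and the `K` representations pass to the limit.
They stay distinct: equal limits would mean a common cut at some stage, hence equality of the
original representations. -/
lemma manyRepresentations_of_one [Finite 𝒜] {φ σ : 𝒜 → List 𝒜} (h : IsMixing φ)
    (hσ : ∀ i, σ i ≠ []) (hcut : CutInjective σ) {K : ℕ} {x : ℤ → 𝒜} (hx : x ∈ allowedWords φ)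
    {f : Fin K → (ℤ → 𝒜) × (ℤ → ℤ)} (hf : Function.Injective f)
    (hf' : ∀ i, f i ∈ representations φ σ x) : ManyRepresentations φ σ K := by
  intro y hy
  obtain ⟨p, hp⟩ := h.exists_shifts hx hy
  choose j hj1 hj2 using fun i m => (hf' i).2.1.exists_normalized hσ (p m)
  choose z0 c0 h1 h2 h3 h4 using fun i => IsImage.limit (Filter.hyperfilter ℕ)
    (fun m => ((hf' i).2.1.shift (j i m)).translate (p m)) (fun m => by have := hj1 i m; omega)
    (fun m => by have := hj2 i m; omega) hp
  refine ⟨fun i => (z0 i, c0 i), fun i i' hii => ?_, fun i => ⟨allowedWords_of_eventually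
    (fun m => allowedWords_shift (hf' i).1 (j i m)) (h3 i), h1 i, h2 i⟩⟩
  obtain ⟨m, e1, e2⟩ := ((h4 i 0).and (h4 i' 0)).exists
  have hcc := congrFun (congrArg Prod.snd hii) 0
  simp only at hcc
  rw [← e1, ← e2, sub_left_inj] at hcc
  exact hf (representations_eq_of_cut hσ hcut (hf' i) (hf' i') hcc).1

/-- Each of the `K` preimages of `x` has `K` preimages of its own. Two composite representations
with a common cut have the same outer representation and the same cut index in it, so the inner
representations also share a cut. -/
lemma ManyRepresentations.square {φ : 𝒜 → List 𝒜} (hφ : ∀ i, φ i ≠ []) {n : ℕ}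
    (hcut : CutInjective (morPow φ n)) {K : ℕ} (h : ManyRepresentations φ (morPow φ n) K) :
    ManyRepresentations φ (morPow φ (n + n)) (K * K) := by
  have hσ := morPow_ne_nil hφ n
  intro x hx
  obtain ⟨f, hf, hf'⟩ := h x hx
  choose g hg hg' using fun i => h (f i).1 (hf' i).1
  suffices ∃ f : Fin K × Fin K → (ℤ → 𝒜) × (ℤ → ℤ),
      Function.Injective f ∧ ∀ i, f i ∈ representations φ (morPow φ (n + n)) x by
    obtain ⟨f, h1, h2⟩ := this
    exact ⟨f ∘ finProdFinEquiv.symm, h1.comp finProdFinEquiv.symm.injective, fun i => h2 _⟩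
  refine ⟨fun q => ((g q.1 q.2).1, fun k => (f q.1).2 ((g q.1 q.2).2 k)), ?_, ?_⟩
  · rintro ⟨i, k⟩ ⟨i', k'⟩ heq
    have h1 := congrArg Prod.fst heq
    have h2 := congrFun (congrArg Prod.snd heq) 0
    simp only at h1 h2
    obtain ⟨h3, h4⟩ := representations_eq_of_cut hσ hcut (hf' i) (hf' i') h2
    obtain rfl := hf h3
    obtain ⟨h5, -⟩ := representations_eq_of_cut hσ hcut (hg' i k) (hg' i k') h4
    rw [hg i h5]
  · rintro ⟨i, k⟩
    have hfm := ((hf' i).2.1.strictMono hσ).monotone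
    refine ⟨(hg' i k).1, ?_, ?_, ?_⟩
    · rw [morPow_add]; exact (hg' i k).2.1.comp (hf' i).2.1
    · exact (hfm (hg' i k).2.2.1).trans (hf' i).2.2.1
    · exact (hf' i).2.2.2.trans_le (hfm (Int.add_one_le_of_lt (hg' i k).2.2.2))

/-- A representation is coded by the letter of its block at the origin and by the offset of the
origin in that block, rounded to a multiple of `1/Q` of the block length. Two representations with
the same code place the same word at two positions at a distance `d` with `Q * d` less than its
length, which makes `d` a forbidden period. The bound does not involve `n`. -/
lemma card_le_of_representations [Fintype 𝒜] {φ : 𝒜 → List 𝒜} {n : ℕ} (hφ : ∀ i, φ i ≠ [])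
    (hcut : CutInjective (morPow φ n)) {Q : ℕ}
    (hQ' : ∀ i d, 0 < d → PeriodicWord (morPow φ n i) d → (morPow φ n i).length ≤ Q * d)
    {x : ℤ → 𝒜} {K : ℕ} {f : Fin K → (ℤ → 𝒜) × (ℤ → ℤ)} (hf : Function.Injective f)
    (hf' : ∀ i, f i ∈ representations φ (morPow φ n) x) : K ≤ Fintype.card 𝒜 * Q := by
  have hσ := morPow_ne_nil hφ n
  have hoff : ∀ i, (-(f i).2 0).toNat < (morPow φ n ((f i).1 0)).length := fun i => by
    have h1 := (hf' i).2.1.step 0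
    have h2 := (hf' i).2.2.2
    have h3 := (hf' i).2.2.1
    rw [zero_add] at h1
    omega
  let b : Fin K → 𝒜 × Fin Q := fun i => ((f i).1 0,
    ⟨Q * (-(f i).2 0).toNat / (morPow φ n ((f i).1 0)).length, by
      rcases Nat.eq_zero_or_pos Q with hQ | hQ
      · exfalso
        subst hQ
        have h1 := hQ' ((f i).1 0) (morPow φ n ((f i).1 0)).length
          (by have := hoff i; omega) (fun m hm => by omega)
        have := hoff i
        omega
      · rw [Nat.div_lt_iff_lt_mul (by have := hoff i; omega)]
        exact (Nat.mul_lt_mul_left hQ).2 (hoff i)⟩)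
  have hb : Function.Injective b := by
    intro i i' hii
    by_contra hne
    wlog hle : (f i).2 0 ≤ (f i').2 0 generalizing i i'
    · exact this hii.symm (Ne.symm hne) (by omega)
    have h1 : (f i).1 0 = (f i').1 0 := congrArg Prod.fst hii
    have h2 := congrArg (fun p => (Prod.snd p).1) hii
    simp only [b] at h2
    have hlt : (f i).2 0 < (f i').2 0 := by
      refine lt_of_le_of_ne hle fun h3 => hne (hf ?_)
      exact (representations_eq_of_cut hσ hcut (hf' i) (hf' i') h3).1
    rw [← h1] at h2
    have hoi := hoff i
    obtain ⟨w, hw⟩ : ∃ w, w = morPow φ n ((f i).1 0) := ⟨_, rfl⟩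
    obtain ⟨d, hd⟩ : ∃ d, d = ((f i').2 0 - (f i).2 0).toNat := ⟨_, rfl⟩
    rw [← hw] at h2 hoi
    have hper : PeriodicWord w d := by
      intro m hm
      rw [List.getElem?_eq_getElem (by omega), List.getElem?_eq_getElem (by omega),
        Option.some_inj]
      have e1 := (hf' i).2.1.getElem 0 (m + d) (by rw [← hw]; exact hm)
      have e2 := (hf' i').2.1.getElem 0 m (by rw [← h1, ← hw]; omega)
      simp only [← h1] at e2
      simp only [← hw] at e1 e2
      rw [← e1, ← e2]
      congr 1; push_cast; omega
    have h3 := hQ' ((f i).1 0) d (by omega) (hw ▸ hper)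
    rw [← hw] at h3
    have h4 := Nat.lt_div_mul_add (a := Q * (-(f i).2 0).toNat) (b := w.length)
      (by omega)
    have h5 := Nat.div_mul_le_self (Q * (-(f i').2 0).toNat) w.length
    rw [h2] at h4
    have h6 : (-(f i).2 0).toNat = (-(f i').2 0).toNat + d := by
      have := (hf' i').2.2.1
      omega
    rw [h6, mul_add] at h4
    omega
  have := Fintype.card_le_of_injective b hb
  simpa using this

/-- A second representation of one point gives every point two; repeated squaring then gives
arbitrarily many under higher powers, against the uniform bound. -/
theorem recognizable_of_cutInjective [Fintype 𝒜] [Nonempty 𝒜] {φ : 𝒜 → List 𝒜}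
    (h : IsMixing φ) (hper : HasNoPeriod φ) (hcut : ∀ n, CutInjective (morPow φ n)) (n : ℕ) :
    Recognizable (morPow φ n) (allowedWords φ) := by
  have hσ := morPow_ne_nil h.ne_nil n
  intro z hz z' hz' c c' y hc hc'
  obtain ⟨j, hj1, hj2⟩ := hc.exists_normalized hσ 0
  obtain ⟨j', hj1', hj2'⟩ := hc'.exists_normalized hσ 0
  have hy := (Intertwines.self h.ne_nil n).image_mem h.ne_nil hz hc
  let f : Fin 2 → (ℤ → 𝒜) × (ℤ → ℤ) :=
    ![(fun k => z (k + j), fun k => c (k + j)), (fun k => z' (k + j'), fun k => c' (k + j'))]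
  have hf' : ∀ i, f i ∈ representations φ (morPow φ n) y := by
    intro i
    fin_cases i
    · exact ⟨allowedWords_shift hz j, hc.shift j, hj1, hj2⟩
    · exact ⟨allowedWords_shift hz' j', hc'.shift j', hj1', hj2'⟩
  have heq : f 0 = f 1 := by
    by_contra hne
    have hf : Function.Injective f := by
      intro i i' hii
      fin_cases i <;> fin_cases i' <;> first | rfl | exact absurd hii hne | exact absurd hii.symm hne
    have many : ∀ t : ℕ, ∃ m K, 2 ≤ K ∧ t ≤ K ∧ ManyRepresentations φ (morPow φ m) K := by
      intro t
      induction t with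
      | zero => exact ⟨n, 2, le_rfl, by omega,
          manyRepresentations_of_one h hσ (hcut n) hy hf hf'⟩
      | succ t ih =>
        obtain ⟨m, K, h1, h2, h3⟩ := ih
        exact ⟨m + m, K * K, by nlinarith, by nlinarith, h3.square h.ne_nil (hcut m)⟩
    obtain ⟨Q, -, hQ⟩ := h.exists_period_bound hper
    obtain ⟨m, K, -, h2, h3⟩ := many (Fintype.card 𝒜 * Q + 1)
    obtain ⟨g, hg, hg'⟩ := h3 y hy
    have := card_le_of_representations h.ne_nil (hcut m) (hQ m) hg hg'
    omega
  refine ⟨j - j', fun k => ⟨?_, ?_⟩⟩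
  · have := congrFun (congrArg Prod.fst heq) (k - j')
    simp only [f, Matrix.cons_val_zero, Matrix.cons_val_one, sub_add_cancel] at this
    rw [← this]; congr 1; ring
  · have := congrFun (congrArg Prod.snd heq) (k - j')
    simp only [f, Matrix.cons_val_zero, Matrix.cons_val_one, sub_add_cancel] at this
    rw [← this]; congr 1; ring

end Recognizability

/-! ### Recognizability through a factorization over a minimal alphabet -/

section MinimalAlphabet

variable {𝒜 ℬ : Type*}

lemma iterate_extendWord_morComp (α : 𝒜 → List ℬ) (β : ℬ → List 𝒜) (k : ℕ) (u : List 𝒜) :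
    (extendWord (morComp α β))^[k] (extendWord α u) =
      extendWord α ((extendWord (morComp β α))^[k] u) := by
  induction k generalizing u with
  | zero => rfl
  | succ k ih =>
    rw [Function.iterate_succ_apply, Function.iterate_succ_apply, ← ih]
    congr 1
    rw [extendWord_morComp, extendWord_morComp]

lemma morPow_morPow (φ : 𝒜 → List 𝒜) (n k : ℕ) : morPow (morPow φ n) k = morPow φ (n * k) := by
  induction k with
  | zero => rfl
  | succ k ih => rw [morPow_add, ih, morPow_one, ← morPow_add, mul_add, mul_one]

lemma morPow_morComp (α : 𝒜 → List ℬ) (β : ℬ → List 𝒜) (k : ℕ) :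
    morComp β (morComp (morPow (morComp α β) k) α) = morPow (morComp β α) (k + 1) := by
  funext i
  have h1 := iterate_extendWord_morComp α β k [i]
  rw [extendWord_singleton] at h1
  rw [morComp, morComp, extendWord_morPow, h1, ← extendWord_morComp, morPow,
    Function.iterate_succ_apply']

lemma morPow_morComp_succ (α : 𝒜 → List ℬ) (β : ℬ → List 𝒜) (k : ℕ) (i : ℬ) :
    morPow (morComp α β) (k + 1) i = extendWord α (extendWord (morPow (morComp β α) k) (β i)) := by
  rw [extendWord_morPow, ← iterate_extendWord_morComp, morPow, Function.iterate_succ_apply,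
    extendWord_singleton]
  rfl

namespace IsMixing

variable {φ : 𝒜 → List 𝒜}

lemma morPow_isMixing (h : IsMixing φ) {n : ℕ} (hn : 1 ≤ n) : IsMixing (morPow φ n) where
  ne_nil := morPow_ne_nil h.ne_nil n
  mem_morPow := by
    obtain ⟨N, hN⟩ := h.mem_morPow
    exact ⟨N, fun k hk i j => by rw [morPow_morPow]; exact hN _ (by nlinarith) i j⟩
  two_le := by
    obtain ⟨i, hi⟩ := h.two_le
    refine ⟨i, hi.trans ?_⟩
    have := morPow_length_mono h.ne_nil hn i
    rwa [morPow_one] at this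

lemma language_morPow (h : IsMixing φ) {n : ℕ} (hn : 1 ≤ n) :
    language (morPow φ n) = language φ := by
  ext u
  constructor
  · rintro ⟨h0, i, k, hk⟩
    exact mem_language_iff.2 ⟨h0, i, n * k, by rw [← morPow_morPow]; exact hk⟩
  · intro hu
    obtain ⟨m, hm⟩ := h.exists_forall_infix hu
    obtain ⟨h0, i, -⟩ := mem_language_iff.1 hu
    exact mem_language_iff.2 ⟨h0, i, m, by rw [morPow_morPow]; exact hm _ (by nlinarith) i⟩

lemma allowedWords_morPow (h : IsMixing φ) {n : ℕ} (hn : 1 ≤ n) :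
    allowedWords (morPow φ n) = allowedWords φ := by
  simp only [allowedWords, h.language_morPow hn]

/-- If `β ∘ α` is mixing and every letter occurs in the image of `α`, then `α ∘ β` is mixing. -/
lemma swap [Finite 𝒜] [Nonempty 𝒜] [Finite ℬ] {α : 𝒜 → List ℬ} {β : ℬ → List 𝒜}
    (h : IsMixing (morComp β α)) (hα : ∀ i, α i ≠ []) (hβ : ∀ i, β i ≠ [])
    (hsurj : ∀ b, ∃ a, b ∈ α a) : IsMixing (morComp α β) where
  ne_nil := morComp_ne_nil hα hβ
  mem_morPow := by
    obtain ⟨N, hN⟩ := h.mem_morPow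
    refine ⟨N + 1, fun n hn i j => ?_⟩
    obtain ⟨k, rfl⟩ := Nat.exists_eq_add_of_le' (show 1 ≤ n by omega)
    rw [morPow_morComp_succ]
    obtain ⟨a, ha⟩ := hsurj j
    obtain ⟨a', ha'⟩ := List.exists_mem_of_ne_nil _ (hβ i)
    refine ((infix_extendWord_of_mem α (a := a) ?_)).subset ha
    exact (infix_extendWord_of_mem _ ha').subset (hN k (by omega) a' a)
  two_le := by
    -- If `α ∘ β` lengthened no word, then `(β ∘ α)^(n+1) = β ∘ (α ∘ β)^n ∘ α` would have images of
    -- bounded length.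
    by_contra! hcon
    obtain ⟨a⟩ := ‹Nonempty 𝒜›
    obtain ⟨M, hM⟩ := exists_length_le β
    have h1 : ∀ (k : ℕ) (u : List ℬ), ((extendWord (morComp α β))^[k] u).length ≤ u.length := by
      intro k
      induction k with
      | zero => intro u; rfl
      | succ k ih =>
        intro u
        rw [Function.iterate_succ_apply]
        refine (ih _).trans ?_
        simpa using length_extendWord_le (M := 1) (fun i => by have := hcon i; omega) u
    obtain ⟨n, hn⟩ := h.growing (M * (α a).length + 1)
    have h2 := hn (n + 1) (by omega) a
    rw [← morPow_morComp, morComp, morComp, extendWord_morPow] at h2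
    have h3 := length_extendWord_le hM ((extendWord (morComp α β))^[n] (α a))
    have h4 := Nat.mul_le_mul_left M (h1 n (α a))
    omega

end IsMixing

lemma IsImage.periodic {σ : 𝒜 → List ℬ} (hσ : ∀ i, σ i ≠ []) {z : ℤ → 𝒜} {c : ℤ → ℤ} {y : ℤ → ℬ}
    (h : IsImage σ z c y) {d : ℤ} (hz : ∀ k, z (k + d) = z k) (n : ℤ) :
    y (n + (c d - c 0)) = y n := by
  have h1 := h.shift d
  simp only [hz] at h1
  simpa using (IsImage.unique hσ h h1).2 n

/-- A factorization through an alphabet with an unused letter can be shortened. -/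
lemma FactorsThrough.of_unused {𝒞 𝒟 : Type*} [Fintype 𝒟] [Nonempty 𝒞] {σ : 𝒞 → List ℬ}
    {τ : 𝒞 → List 𝒟} {σ' : 𝒟 → List ℬ} (hτ : ∀ i, τ i ≠ []) (hσ' : ∀ i, σ' i ≠ [])
    (h : σ = morComp σ' τ) {d₀ : 𝒟} (hd : ∀ i, d₀ ∉ τ i) :
    ∃ d < Fintype.card 𝒟, FactorsThrough σ d := by
  classical
  obtain ⟨i₀⟩ := ‹Nonempty 𝒞›
  obtain ⟨e, he⟩ := List.exists_mem_of_ne_nil _ (hτ i₀)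
  have hed : e ≠ d₀ := fun h => hd i₀ (h ▸ he)
  let r : 𝒟 → {x // x ≠ d₀} := fun x => if hx : x = d₀ then ⟨e, hed⟩ else ⟨x, hx⟩
  refine ⟨_, Fintype.card_subtype_lt (p := (· ≠ d₀)) (x := d₀) (by simp),
    FactorsThrough.of_fintype (𝒟 := {x // x ≠ d₀}) (fun i => (τ i).map r) (fun i => σ' i)
      (fun i => by simpa using hτ i) (fun i => hσ' _) ?_⟩
  rw [h]; funext i
  simp only [morComp, extendWord, List.flatMap_map]
  refine List.flatMap_congr fun x hx => ?_
  have : x ≠ d₀ := fun h => hd i (h ▸ hx)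
  simp [r, this]

/-- A mixing substitution without periodic points is recognizable. -/
theorem IsMixing.recognizable [Fintype 𝒜] [Nonempty 𝒜] {φ : 𝒜 → List 𝒜} (h : IsMixing φ)
    (hper : HasNoPeriod φ) : Recognizable φ (allowedWords φ) := by
  classical
  have hex : ∃ d n, 1 ≤ n ∧ FactorsThrough (morPow φ n) d := by
    refine ⟨_, 1, le_rfl, FactorsThrough.of_fintype (𝒟 := 𝒜) (fun i => [i]) (morPow φ 1)
      (by simp) (morPow_ne_nil h.ne_nil 1) ?_⟩
    rw [morComp_singleton_right]
  -- The alphabet size is minimal over all factorizations of all positive powers of `φ`, not just of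
  -- `φ` itself; this is what lets the powers of `α ∘ β` be treated together.
  obtain ⟨n, hn, α, β, hα, hβ, hαβ⟩ := Nat.find_spec hex
  have hmin := fun d hd => Nat.find_min hex (m := d) hd
  generalize Nat.find hex = N at α β hα hβ hαβ hmin
  have hsurj : ∀ b, ∃ a, b ∈ α a := by
    by_contra! hcon
    obtain ⟨b, hb⟩ := hcon
    obtain ⟨d, hd, hd'⟩ := FactorsThrough.of_unused hα hβ hαβ hb
    exact hmin d (by simpa using hd) ⟨n, hn, hd'⟩
  have hmix := h.morPow_isMixing hn
  have hXX := h.allowedWords_morPow hn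
  rw [hαβ] at hmix hXX
  have hmixψ := hmix.swap hα hβ hsurj
  have hint : Intertwines (morComp α β) (morComp β α) β := by
    refine ⟨fun i => by rw [extendWord_morComp]; rfl, fun i => ?_⟩
    obtain ⟨a, ha⟩ := hsurj i
    refine mem_language_iff.2 ⟨hβ i, a, 1, ?_⟩
    rw [morPow_one]
    exact infix_extendWord_of_mem β ha
  have hperψ : HasNoPeriod (morComp α β) := by
    intro z hz d hd hcon
    obtain ⟨c, y, -, hc⟩ := IsImage.exists_image hβ z 0
    refine hper y (hXX ▸ hint.image_mem hmix.ne_nil hz hc) (c d - c 0) ?_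
      (hc.periodic hβ hcon)
    have := hc.strictMono hβ hd
    omega
  -- A factorization of `(α ∘ β)^k` through fewer letters would give one of `β ∘ (α ∘ β)^k ∘ α =
  -- φ^(n(k+1))`.
  have hcut : ∀ k, CutInjective (morPow (morComp α β) k) := fun k =>
    cutInjective_of_not_factorsThrough (morPow_ne_nil hmixψ.ne_nil k) fun d hd hcon => by
      refine hmin d (by simpa using hd) ⟨n * (k + 1), by nlinarith, ?_⟩
      have := hcon.comp hα hβ
      rwa [morPow_morComp, ← hαβ, morPow_morPow] at this
  have hne : Nonempty (Fin N) := by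
    obtain ⟨a⟩ := ‹Nonempty 𝒜›
    obtain ⟨e, -⟩ := List.exists_mem_of_ne_nil _ (hα a)
    exact ⟨e⟩
  -- The square is used because `(α ∘ β)² = α ∘ φ^n ∘ β`. As `β` maps onto the allowed words of `φ`,
  -- it can be removed on the right; then `α` and the remaining power of `φ` are removed on the
  -- left.
  have h2 := recognizable_of_cutInjective hmixψ hperψ hcut (1 + 1)
  rw [morPow_add, morPow_one] at h2
  have e1 : morComp (morComp α β) (morComp α β) = morComp (morComp α (morComp β α)) β := by
    simp only [morComp_assoc]
  rw [e1] at h2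
  have h3 : Recognizable (morComp α (morComp β α)) (allowedWords φ) :=
    h2.of_surjective hβ fun y hy => hint.exists_preimage hmix hmixψ (hXX ▸ hy)
  have h4 := h3.of_morComp hα
  obtain ⟨k, rfl⟩ := Nat.exists_eq_add_of_le' hn
  rw [← hαβ, morPow_add, morPow_one] at h4
  exact h4.of_morComp (morPow_ne_nil h.ne_nil k)

end MinimalAlphabet

/-! ### Rational matrices with a simple real eigenvalue -/

section RationalMatrices

open Matrix Polynomial

variable {m n n' : Type*} [Fintype m] [Fintype n] [DecidableEq n] [Fintype n'] [DecidableEq n']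

/-- The real matrix with the same entries as the rational matrix `M`. -/
noncomputable abbrev Matrix.toReal {m n : Type*} (M : Matrix m n ℚ) : Matrix m n ℝ := M.map (algebraMap ℚ ℝ)

/-- A rational matrix that is singular over `ℝ` is singular over `ℚ`. -/
lemma Matrix.exists_rational_mulVec_eq_zero (M : Matrix m n ℚ) {z : n → ℝ} (hz : z ≠ 0)
    (h : M.toReal *ᵥ z = 0) : ∃ y : n → ℚ, y ≠ 0 ∧ M *ᵥ y = 0 := by
  -- Passing to the Gram matrix makes the system square, so that singularity is the vanishing of a
  -- rational determinant. Over `ℚ` the identity `y ⬝ᵥ MᵀM y = My ⬝ᵥ My` brings the kernel back to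
  -- `M`.
  have h1 : (Mᵀ * M).toReal *ᵥ z = 0 := by
    rw [Matrix.toReal, Matrix.map_mul, ← Matrix.mulVec_mulVec, h, Matrix.mulVec_zero]
  have h2 : (Mᵀ * M).toReal.det = 0 := Matrix.exists_mulVec_eq_zero_iff.1 ⟨z, hz, h1⟩
  have h3 : (Mᵀ * M).det = 0 := by
    have : (algebraMap ℚ ℝ) (Mᵀ * M).det = 0 := by
      rw [RingHom.map_det]; exact h2
    simpa using this
  obtain ⟨y, hy, hy'⟩ := Matrix.exists_mulVec_eq_zero_iff.2 h3
  refine ⟨y, hy, ?_⟩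
  have := congrArg (fun v => y ⬝ᵥ v) hy'
  simp only [dotProduct_zero] at this
  rw [← Matrix.mulVec_mulVec, Matrix.dotProduct_mulVec, Matrix.vecMul_transpose] at this
  exact dotProduct_self_eq_zero.1 this

/-- `lam` is a geometrically simple eigenvalue of the rational matrix `A`, with a right
eigenvector `ω` and a left eigenvector `ℓ` that do not annihilate each other. -/
structure IsSimpleEigen (A : Matrix n n ℚ) (lam : ℝ) (ω ℓ : n → ℝ) : Prop where
  integral : IsIntegral ℚ lam
  right : A.toReal *ᵥ ω = lam • ω
  left : ℓ ᵥ* A.toReal = lam • ℓ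
  ne_zero : ℓ ⬝ᵥ ω ≠ 0
  simple : ∀ z, A.toReal *ᵥ z = lam • z → ∃ c : ℝ, z = c • ω

lemma Matrix.vecMul_aeval {R : Type*} [Field R] {A : Matrix n n R} {ℓ : n → R} {lam : R}
    (h : ℓ ᵥ* A = lam • ℓ) (p : R[X]) : ℓ ᵥ* aeval A p = p.eval lam • ℓ := by
  induction p using Polynomial.induction_on' with
  | add p q hp hq => rw [map_add, Matrix.vecMul_add, hp, hq, eval_add, add_smul]
  | monomial k a =>
    have hk : ∀ k : ℕ, ℓ ᵥ* A ^ k = lam ^ k • ℓ := fun k => by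
      induction k with
      | zero => simp
      | succ k ih => rw [pow_succ, ← Matrix.vecMul_vecMul, ih, Matrix.smul_vecMul, h, smul_smul,
          pow_succ]
    rw [aeval_monomial, eval_monomial, Algebra.algebraMap_eq_smul_one, Matrix.smul_mul,
      Matrix.one_mul, Matrix.vecMul_smul, hk, smul_smul]

lemma Matrix.toReal_aeval (A : Matrix n n ℚ) (p : ℚ[X]) :
    (aeval A p).toReal = aeval A.toReal (p.map (algebraMap ℚ ℝ)) := by
  have := Polynomial.aeval_algHom_apply ((Algebra.ofId ℚ ℝ).mapMatrix (m := n)) A p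
  rw [aeval_map_algebraMap]
  exact this.symm

lemma Matrix.toReal_mulVec {k l : Type*} [Fintype l] {M : Matrix k l ℚ} (y : l → ℚ) :
    M.toReal *ᵥ (fun i => (y i : ℝ)) = fun i => ((M *ᵥ y) i : ℝ) := by
  funext i
  simp [Matrix.mulVec, dotProduct]

namespace IsSimpleEigen

variable {A : Matrix n n ℚ} {lam : ℝ} {ω ℓ : n → ℝ}

lemma aeval_minpoly_left (h : IsSimpleEigen A lam ω ℓ) :
    ℓ ᵥ* (aeval A (minpoly ℚ lam)).toReal = 0 := by
  rw [Matrix.toReal_aeval, Matrix.vecMul_aeval h.left, eval_map_algebraMap, minpoly.aeval,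
    zero_smul]

/-- A left eigenvector does not vanish on nonzero rational vectors of `ker m(A)`. -/
lemma eq_zero_of_dotProduct (h : IsSimpleEigen A lam ω ℓ) {y : n → ℚ}
    (hy : aeval A (minpoly ℚ lam) *ᵥ y = 0) (hℓ : ℓ ⬝ᵥ (fun i => (y i : ℝ)) = 0) : y = 0 := by
  set μ := minpoly ℚ lam with hμ
  set yR : n → ℝ := fun i => (y i : ℝ) with hyR
  have hirr := minpoly.irreducible h.integral
  have hroot : (μ.map (algebraMap ℚ ℝ)).IsRoot lam := by
    rw [IsRoot, eval_map_algebraMap, minpoly.aeval]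
  -- Write `μ = (X - lam) m₁` over `ℝ`. Then `m₁(A) y` is a `lam`-eigenvector killed by `ℓ`, hence
  -- zero by simplicity.
  obtain ⟨m₁, hm₁⟩ := dvd_iff_isRoot.2 hroot
  have hμ0 : μ.map (algebraMap ℚ ℝ) ≠ 0 := (map_ne_zero hirr.ne_zero)
  have hm₁0 : m₁ ≠ 0 := by rintro rfl; simp at hm₁; exact hirr.ne_zero hm₁
  have hdeg : m₁.natDegree < μ.natDegree := by
    have h1 := congrArg natDegree hm₁
    rw [natDegree_map, natDegree_mul (X_sub_C_ne_zero lam) hm₁0, natDegree_X_sub_C] at h1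
    omega
  have hv : aeval A.toReal m₁ *ᵥ yR = 0 := by
    have h1 : A.toReal *ᵥ (aeval A.toReal m₁ *ᵥ yR) = lam • (aeval A.toReal m₁ *ᵥ yR) := by
      have h2 : (aeval A μ).toReal *ᵥ yR = 0 := by
        rw [Matrix.toReal_mulVec, hy]; simp; rfl
      rw [Matrix.toReal_aeval, hm₁, map_mul, map_sub, aeval_X, aeval_C, ← Matrix.mulVec_mulVec,
        Matrix.sub_mulVec, sub_eq_zero] at h2
      rw [h2, Algebra.algebraMap_eq_smul_one, Matrix.smul_mulVec, Matrix.one_mulVec]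
    obtain ⟨c, hc⟩ := h.simple _ h1
    have h3 : ℓ ⬝ᵥ (aeval A.toReal m₁ *ᵥ yR) = 0 := by
      rw [Matrix.dotProduct_mulVec, Matrix.vecMul_aeval h.left, smul_dotProduct, hℓ, smul_zero]
    rw [hc, dotProduct_smul, smul_eq_mul, mul_eq_zero, or_iff_left h.ne_zero] at h3
    rw [hc, h3, zero_smul]
  -- The columns `y, Ay, A²y, …`, fewer than `deg μ + 1` of them, satisfy a real linear relation
  -- with the coefficients of `m₁`, so they satisfy a nontrivial rational one. The resulting `p` has
  -- degree below that of the irreducible `μ` and is coprime to it, and `p(A) y = μ(A) y = 0` forces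
  -- `y = 0`.
  let Y : Matrix n (Fin μ.natDegree) ℚ := Matrix.of fun j i => ((A ^ (i : ℕ)) *ᵥ y) j
  obtain ⟨q, hq0, hq⟩ := Y.exists_rational_mulVec_eq_zero
    (z := fun i => m₁.coeff i) (by
      intro h0
      have := congrFun h0 ⟨m₁.natDegree, hdeg⟩
      simp only [Pi.zero_apply, coeff_natDegree, leadingCoeff_eq_zero] at this
      exact hm₁0 this) (by
      rw [← hv, aeval_eq_sum_range' hdeg, Matrix.sum_mulVec, ← Fin.sum_univ_eq_sum_range
        (fun i => (m₁.coeff i • A.toReal ^ i) *ᵥ yR)]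
      funext j
      simp only [Matrix.mulVec, dotProduct, Finset.sum_apply]
      refine Finset.sum_congr rfl fun i _ => ?_
      have h4 : (A ^ (i : ℕ)).toReal *ᵥ yR = fun j => (((A ^ (i : ℕ)) *ᵥ y) j : ℝ) :=
        Matrix.toReal_mulVec y
      have h5 : A.toReal ^ (i : ℕ) = (A ^ (i : ℕ)).toReal :=
        (map_pow ((algebraMap ℚ ℝ).mapMatrix) A i).symm
      have h6 : ((m₁.coeff i • A.toReal ^ (i : ℕ)) *ᵥ yR) j = m₁.coeff i * ((A ^ (i : ℕ)) *ᵥ y) j := by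
        rw [Matrix.smul_mulVec, h5, h4]; rfl
      change _ = ((m₁.coeff i • A.toReal ^ (i : ℕ)) *ᵥ yR) j
      rw [h6, mul_comm]; rfl)
  let p : ℚ[X] := ∑ i : Fin μ.natDegree, C (q i) * X ^ (i : ℕ)
  have hpcoeff : ∀ i : Fin μ.natDegree, p.coeff i = q i := fun i => by
    simp only [p, finsetSum_coeff, coeff_C_mul, coeff_X_pow]
    rw [Finset.sum_eq_single i]
    · simp
    · intro b _ hb
      simp [Fin.val_inj, hb.symm]
    · simp
  have hp0 : p ≠ 0 := by
    intro h0
    refine hq0 (funext fun i => ?_)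
    rw [← hpcoeff, h0]; simp
  have hpdeg : p.degree < μ.degree := by
    rw [degree_eq_natDegree hirr.ne_zero]
    refine (degree_sum_fin_lt q).trans_le ?_
    rfl
  have hpy : aeval A p *ᵥ y = 0 := by
    rw [← hq]
    simp only [p, map_sum, map_mul, aeval_C, map_pow, aeval_X, Matrix.sum_mulVec]
    funext j
    simp only [Finset.sum_apply]
    simp only [Matrix.mulVec, dotProduct, Y, Matrix.of_apply]
    refine Finset.sum_congr rfl fun i _ => ?_
    rw [Algebra.algebraMap_eq_smul_one, Matrix.smul_mul, Matrix.one_mul, Finset.sum_mul]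
    refine Finset.sum_congr rfl fun k _ => ?_
    simp only [Matrix.smul_apply, smul_eq_mul]; ring
  have hcop : IsCoprime μ p := hirr.coprime_iff_not_dvd.2 fun hdvd =>
    absurd (degree_le_of_dvd hdvd hp0) (not_le.2 hpdeg)
  obtain ⟨u, w, huw⟩ := hcop
  have := congrArg (fun r => aeval A r *ᵥ y) huw
  simp only [map_add, map_mul, map_one, Matrix.add_mulVec, Matrix.one_mulVec,
    ← Matrix.mulVec_mulVec, hy, hpy, Matrix.mulVec_zero, add_zero] at this
  exact this.symm

/-- The minimal polynomial of a simple eigenvalue divides an annihilating polynomial just once. -/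
lemma exists_coprime (h : IsSimpleEigen A lam ω ℓ) :
    ∃ q : ℚ[X], IsCoprime (minpoly ℚ lam) q ∧ aeval A (minpoly ℚ lam * q) = 0 := by
  set μ := minpoly ℚ lam with hμ
  have hirr := minpoly.irreducible h.integral
  obtain ⟨a, q, hq, hχ⟩ : ∃ a q, ¬ μ ∣ q ∧ A.charpoly = μ ^ a * q :=
    let ⟨q, h1, h2⟩ := (FiniteMultiplicity.of_not_isUnit hirr.not_isUnit
      A.charpoly_monic.ne_zero).exists_eq_pow_mul_and_not_dvd
    ⟨_, q, h2, h1⟩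
  -- The rational vector `μ(A) v` lies in `ker μ(A)` and is killed by `ℓ`, because `ℓ μ(A) = 0`.
  -- Thus `μ(A)` has no nilpotent part on rational vectors, and one factor `μ` of the characteristic
  -- polynomial suffices.
  have step : ∀ v : n → ℚ, aeval A μ *ᵥ (aeval A μ *ᵥ v) = 0 → aeval A μ *ᵥ v = 0 := by
    intro v hv
    refine h.eq_zero_of_dotProduct hv ?_
    rw [← Matrix.toReal_mulVec, Matrix.dotProduct_mulVec, h.aeval_minpoly_left, zero_dotProduct]
  have steps : ∀ (a : ℕ) (v : n → ℚ), aeval A (μ ^ a) *ᵥ v = 0 → aeval A μ *ᵥ v = 0 := by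
    intro a
    induction a with
    | zero => intro v hv; simp only [pow_zero, map_one, Matrix.one_mulVec] at hv; simp [hv]
    | succ a ih =>
      intro v hv
      refine step v (ih _ ?_)
      rw [pow_succ, map_mul, ← Matrix.mulVec_mulVec] at hv
      exact hv
  refine ⟨q, hirr.coprime_iff_not_dvd.2 hq, ?_⟩
  refine Matrix.mulVec_injective (funext fun y => ?_)
  rw [map_mul, ← Matrix.mulVec_mulVec, Matrix.zero_mulVec]
  refine steps a _ ?_
  rw [Matrix.mulVec_mulVec, ← map_mul, ← hχ, Matrix.aeval_self_charpoly, Matrix.zero_mulVec]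

/-- An intertwining rational matrix is injective on `ker m(A)`. -/
lemma eq_zero_of_mulVec_eq_zero (h : IsSimpleEigen A lam ω ℓ) (P : Matrix m n ℚ) {ℓ' : m → ℝ}
    (hℓ : ℓ' ᵥ* P.toReal = ℓ) {z : n → ℝ}
    (hz : (aeval A (minpoly ℚ lam)).toReal *ᵥ z = 0) (hPz : P.toReal *ᵥ z = 0) : z = 0 := by
  by_contra hz0
  -- Stacking the two conditions turns a real common kernel vector into a rational one, on which `ℓ
  -- = ℓ' P` vanishes.
  let M := Matrix.fromRows (aeval A (minpoly ℚ lam)) P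
  obtain ⟨y, hy0, hy⟩ := M.exists_rational_mulVec_eq_zero hz0 (by
    funext i
    rcases i with i | i
    · exact congrFun hz i
    · exact congrFun hPz i)
  refine hy0 (h.eq_zero_of_dotProduct (funext fun i => congrFun hy (Sum.inl i)) ?_)
  have hy2 : P *ᵥ y = 0 := funext fun i => congrFun hy (Sum.inr i)
  rw [← hℓ, ← Matrix.dotProduct_mulVec, Matrix.toReal_mulVec, hy2]
  simp [dotProduct]

end IsSimpleEigen

lemma Matrix.finrank_ker_transpose (M : Matrix n n ℝ) :
    Module.finrank ℝ (LinearMap.ker (Matrix.toLin' Mᵀ)) =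
      Module.finrank ℝ (LinearMap.ker (Matrix.toLin' M)) := by
  have h1 := (Matrix.toLin' M).finrank_range_add_finrank_ker
  have h2 := (Matrix.toLin' Mᵀ).finrank_range_add_finrank_ker
  have h3 := M.rank_transpose
  rw [Matrix.rank, Matrix.rank] at h3
  change Module.finrank ℝ (LinearMap.range (Matrix.toLin' Mᵀ)) =
    Module.finrank ℝ (LinearMap.range (Matrix.toLin' M)) at h3
  omega

end RationalMatrices

/-! ### The Perron-Frobenius eigenvalue of a primitive matrix -/

section Perron

open Matrix Polynomial

variable {n n' : Type*} [Fintype n] [DecidableEq n]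

lemma Matrix.pow_mulVec_of_eigen {B : Matrix n n ℝ} {lam : ℝ} {z : n → ℝ}
    (h : B *ᵥ z = lam • z) (k : ℕ) : (B ^ k) *ᵥ z = lam ^ k • z := by
  induction k with
  | zero => simp
  | succ k ih =>
    rw [pow_succ, ← Matrix.mulVec_mulVec, h, Matrix.mulVec_smul, ih, smul_smul, pow_succ']

lemma Matrix.aeval_mulVec {B : Matrix n n ℝ} {lam : ℝ} {z : n → ℝ} (h : B *ᵥ z = lam • z)
    (p : ℝ[X]) : aeval B p *ᵥ z = p.eval lam • z := by
  induction p using Polynomial.induction_on' with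
  | add p q hp hq => rw [map_add, Matrix.add_mulVec, hp, hq, eval_add, add_smul]
  | monomial k a =>
    rw [aeval_monomial, eval_monomial, Algebra.algebraMap_eq_smul_one, Matrix.smul_mul,
      Matrix.one_mul, Matrix.smul_mulVec, Matrix.pow_mulVec_of_eigen h, smul_smul]

/-- Subtracting the largest multiple of `ω` that keeps `z - cω` nonnegative leaves an eigenvector
with a zero entry. A nonzero nonnegative vector would become strictly positive under `B^k`. -/
lemma Matrix.simple_of_pos [Nonempty n] {B : Matrix n n ℝ} {lam : ℝ} {ω : n → ℝ} {k : ℕ}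
    (hB : ∀ i j, 0 < (B ^ k) i j) (hω : ∀ i, 0 < ω i) (h : B *ᵥ ω = lam • ω) (z : n → ℝ)
    (hz : B *ᵥ z = lam • z) : ∃ c : ℝ, z = c • ω := by
  obtain ⟨i₀, hi₀⟩ := Finite.exists_min fun i => z i / ω i
  refine ⟨z i₀ / ω i₀, ?_⟩
  set c := z i₀ / ω i₀ with hc
  have hw : B *ᵥ (z - c • ω) = lam • (z - c • ω) := by
    rw [Matrix.mulVec_sub, Matrix.mulVec_smul, hz, h, smul_sub, smul_comm]
  have hnn : ∀ i, 0 ≤ (z - c • ω) i := fun i => by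
    have := hi₀ i
    rw [le_div_iff₀ (hω i)] at this
    simpa using this
  have h0 : (z - c • ω) i₀ = 0 := by
    simp [hc, div_mul_cancel₀ _ (hω i₀).ne']
  have hk := congrFun (Matrix.pow_mulVec_of_eigen hw k) i₀
  rw [Pi.smul_apply, h0, smul_zero] at hk
  have hall := (Finset.sum_eq_zero_iff_of_nonneg fun j _ =>
    mul_nonneg (hB i₀ j).le (hnn j)).1 hk
  rw [← sub_eq_zero]
  funext j
  have := hall j (Finset.mem_univ j)
  exact (mul_eq_zero.1 this).resolve_left (hB i₀ j).ne'

/-- Since `lam` is also an eigenvalue of the transpose, there is a left eigenvector `y`, and the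
triangle inequality gives `|y| B ≥ lam |y|`. Pairing with the positive `ω` forces equality, and
positivity of `B^k` makes `|y|` positive. -/
lemma Matrix.exists_left_eigenvector [Nonempty n] {B : Matrix n n ℝ} {lam : ℝ} {ω : n → ℝ} {k : ℕ}
    (hnn : ∀ i j, 0 ≤ B i j) (hB : ∀ i j, 0 < (B ^ k) i j) (hω : ∀ i, 0 < ω i) (hlam : 0 < lam)
    (h : B *ᵥ ω = lam • ω) : ∃ ℓ : n → ℝ, (∀ i, 0 < ℓ i) ∧ ℓ ᵥ* B = lam • ℓ := by
  have hω0 : ω ≠ 0 := by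
    obtain ⟨i⟩ := ‹Nonempty n›
    exact fun h0 => (hω i).ne' (congrFun h0 i)
  have hdet : (B - lam • 1).det = 0 := Matrix.exists_mulVec_eq_zero_iff.1
    ⟨ω, hω0, by rw [Matrix.sub_mulVec, h, Matrix.smul_mulVec, Matrix.one_mulVec, sub_self]⟩
  obtain ⟨y, hy0, hy⟩ := Matrix.exists_vecMul_eq_zero_iff.2 hdet
  rw [Matrix.vecMul_sub, Matrix.vecMul_smul, Matrix.vecMul_one, sub_eq_zero] at hy
  let ℓ : n → ℝ := fun i => |y i|
  have hle : ∀ j, 0 ≤ (ℓ ᵥ* B) j - lam * ℓ j := fun j => by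
    have h1 : |(y ᵥ* B) j| ≤ (ℓ ᵥ* B) j := by
      simp only [Matrix.vecMul, dotProduct, ℓ]
      refine (Finset.abs_sum_le_sum_abs _ _).trans (Finset.sum_le_sum fun i _ => ?_)
      rw [abs_mul, abs_of_nonneg (hnn i j)]
    rw [hy, Pi.smul_apply, smul_eq_mul, abs_mul, abs_of_pos hlam] at h1
    exact sub_nonneg.2 h1
  have hsum : ∑ j, ((ℓ ᵥ* B) j - lam * ℓ j) * ω j = 0 := by
    have h1 : (ℓ ᵥ* B) ⬝ᵥ ω = lam * (ℓ ⬝ᵥ ω) := by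
      rw [← Matrix.dotProduct_mulVec, h, dotProduct_smul, smul_eq_mul]
    simp only [sub_mul, Finset.sum_sub_distrib]
    rw [sub_eq_zero]
    change (ℓ ᵥ* B) ⬝ᵥ ω = _
    rw [h1, dotProduct, Finset.mul_sum]
    exact Finset.sum_congr rfl fun i _ => by ring
  have heq : ℓ ᵥ* B = lam • ℓ := by
    funext j
    have := (Finset.sum_eq_zero_iff_of_nonneg fun j _ =>
      mul_nonneg (hle j) (hω j).le).1 hsum j (Finset.mem_univ j)
    have := (mul_eq_zero.1 this).resolve_right (hω j).ne'
    simpa [sub_eq_zero] using this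
  refine ⟨ℓ, fun j => ?_, heq⟩
  obtain ⟨i, hi⟩ := Function.ne_iff.1 hy0
  have hT : Bᵀ *ᵥ ℓ = lam • ℓ := by rw [Matrix.mulVec_transpose, heq]
  have hk := congrFun (Matrix.pow_mulVec_of_eigen hT k) j
  have hpos : 0 < ((Bᵀ ^ k) *ᵥ ℓ) j := by
    refine Finset.sum_pos' (fun a _ => mul_nonneg ?_ (abs_nonneg _)) ⟨i, Finset.mem_univ i, ?_⟩
    · rw [← Matrix.transpose_pow]; exact (hB a j).le
    · rw [← Matrix.transpose_pow]; exact mul_pos (hB i j) (abs_pos.2 hi)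
  rw [hk, Pi.smul_apply, smul_eq_mul] at hpos
  exact pos_of_mul_pos_right hpos (pow_pos hlam k).le

end Perron

/-! ### The Pisot subspace -/

section PisotSpace

open Matrix Polynomial

variable {𝒜 ℬ : Type*} [Fintype 𝒜] [DecidableEq 𝒜] [Fintype ℬ] [DecidableEq ℬ]

/-- The abelianization as a rational matrix. -/
def abelQ (ρ : ℬ → List 𝒜) : Matrix 𝒜 ℬ ℚ := Matrix.of fun i j => ((ρ j).count i : ℚ)

lemma toReal_abelQ (ρ : ℬ → List 𝒜) : (abelQ ρ).toReal = abelianization ρ := by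
  ext i j; simp [abelQ, abelianization]

lemma abelianization_mulVec_single (ρ : ℬ → List 𝒜) (b : ℬ) :
    abelianization ρ *ᵥ Pi.single b 1 =
      ((ρ b).map fun i => (Pi.single i 1 : 𝒜 → ℝ)).sum := by
  have : ∀ u : List 𝒜, (fun i => ((u.count i : ℕ) : ℝ)) =
      (u.map fun i => (Pi.single i 1 : 𝒜 → ℝ)).sum := fun u => by
    induction u with
    | nil => funext i; simp
    | cons a u ih =>
      rw [List.map_cons, List.sum_cons, ← ih]
      funext i
      rw [List.count_cons, Pi.add_apply, Pi.single_apply]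
      by_cases h : i = a
      · subst h; simp [add_comm]
      · simp [h, Ne.symm h]
  rw [← this]
  funext i
  simp [abelianization, Matrix.mulVec, dotProduct, Pi.single_apply]

lemma abelianization_mulVec_sum (ρ : ℬ → List 𝒜) (u : List ℬ) :
    abelianization ρ *ᵥ (u.map fun i => (Pi.single i 1 : ℬ → ℝ)).sum =
      ((extendWord ρ u).map fun i => (Pi.single i 1 : 𝒜 → ℝ)).sum := by
  induction u with
  | nil => simp
  | cons a u ih =>
    rw [List.map_cons, List.sum_cons, Matrix.mulVec_add, ih, abelianization_mulVec_single,
      extendWord_cons, List.map_append, List.sum_append]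

lemma abelianization_morComp {𝒞 : Type*} [Fintype 𝒞] [DecidableEq 𝒞] (σ : ℬ → List 𝒜)
    (τ : 𝒞 → List ℬ) :
    abelianization (morComp σ τ) = abelianization σ * abelianization τ := by
  refine Matrix.ext_of_mulVec_single fun c => ?_
  rw [← Matrix.mulVec_mulVec, abelianization_mulVec_single, abelianization_mulVec_single,
    abelianization_mulVec_sum]
  rfl

lemma abelianization_morPow (φ : 𝒜 → List 𝒜) (k : ℕ) :
    abelianization (morPow φ k) = abelianization φ ^ k := by
  induction k with
  | zero =>
    refine Matrix.ext_of_mulVec_single fun c => ?_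
    rw [abelianization_mulVec_single, pow_zero, Matrix.one_mulVec]; simp [morPow]
  | succ k ih => rw [morPow_add, abelianization_morComp, ih, morPow_one, pow_succ]

lemma abelianization_pos_iff (ρ : ℬ → List 𝒜) (i : 𝒜) (j : ℬ) :
    0 < abelianization ρ i j ↔ i ∈ ρ j := by
  simp [abelianization, List.count_pos_iff]

lemma abelianization_nonneg (ρ : ℬ → List 𝒜) (i : 𝒜) (j : ℬ) : 0 ≤ abelianization ρ i j := by
  simp [abelianization]

lemma minpolyEnd_eq (φ : 𝒜 → List 𝒜) :
    minpolyEnd φ = Matrix.toLin' (aeval (abelQ φ) (minpoly ℚ (pfEigenvalue φ))).toReal := by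
  rw [Matrix.toReal_aeval, toReal_abelQ, minpolyEnd, abelianEnd]
  exact Polynomial.aeval_algHom_apply (Matrix.toLinAlgEquiv' : Matrix 𝒜 𝒜 ℝ ≃ₐ[ℝ] _).toAlgHom
    (abelianization φ) _

lemma minpolyEnd_apply (φ : 𝒜 → List 𝒜) (x : 𝒜 → ℝ) : minpolyEnd φ x =
    (aeval (abelQ φ) (minpoly ℚ (pfEigenvalue φ))).toReal *ᵥ x := by
  rw [minpolyEnd_eq]; rfl

lemma mem_pisotSpace_iff {φ : 𝒜 → List 𝒜} {x : 𝒜 → ℝ} : x ∈ pisotSpace φ ↔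
    (aeval (abelQ φ) (minpoly ℚ (pfEigenvalue φ))).toReal *ᵥ x = 0 := by
  rw [← minpolyEnd_apply]; rfl

open Classical in
/-- A positive left eigenvector of the abelianization for the Perron-Frobenius eigenvalue. -/
noncomputable def leftVector (φ : 𝒜 → List 𝒜) : 𝒜 → ℝ :=
  if h : ∃ ℓ : 𝒜 → ℝ, (∀ i, 0 < ℓ i) ∧ ℓ ᵥ* abelianization φ = pfEigenvalue φ • ℓ
  then h.choose else 0

/-- The coordinate along the expanding line, given by the left eigenvector. -/
noncomputable def height (φ : 𝒜 → List 𝒜) : pisotSpace φ →ₗ[ℝ] ℝ where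
  toFun y := leftVector φ ⬝ᵥ (y : 𝒜 → ℝ)
  map_add' x y := by simp
  map_smul' c x := by simp

lemma height_apply (φ : 𝒜 → List 𝒜) (y : pisotSpace φ) :
    height φ y = leftVector φ ⬝ᵥ (y : 𝒜 → ℝ) := rfl

namespace IsPisotSubstitution

variable {φ : 𝒜 → List 𝒜} (hφ : IsPisotSubstitution φ)
include hφ

lemma one_lt : 1 < pfEigenvalue φ := hφ.pisot.1

lemma integral : IsIntegral ℚ (pfEigenvalue φ) := hφ.pisot.2.1.tower_top

lemma exists_perronPair : ∃ ω, IsPerronPair (abelianization φ) (pfEigenvalue φ) ω := by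
  by_cases h : ∃ lam ω, IsPerronPair (abelianization φ) lam ω
  · have := h.choose_spec
    rwa [pfEigenvalue, dif_pos h]
  · have := hφ.one_lt
    rw [pfEigenvalue, dif_neg h] at this
    norm_num at this

lemma pfVector_perron : IsPerronPair (abelianization φ) (pfEigenvalue φ) (pfVector φ) := by
  have h : ∃ ω : pisotSpace φ, IsPerronPair (abelianization φ) (pfEigenvalue φ) ω := by
    obtain ⟨ω, hω⟩ := hφ.exists_perronPair
    refine ⟨⟨ω, ?_⟩, hω⟩
    rw [mem_pisotSpace_iff, Matrix.toReal_aeval, toReal_abelQ, Matrix.aeval_mulVec hω.2,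
      eval_map_algebraMap, minpoly.aeval, zero_smul]
  rw [pfVector, dif_pos h]
  exact h.choose_spec

lemma leftVector_spec [Nonempty 𝒜] : (∀ i, 0 < leftVector φ i) ∧
    leftVector φ ᵥ* abelianization φ = pfEigenvalue φ • leftVector φ := by
  have h : ∃ ℓ : 𝒜 → ℝ, (∀ i, 0 < ℓ i) ∧ ℓ ᵥ* abelianization φ = pfEigenvalue φ • ℓ := by
    obtain ⟨k, -, hk⟩ := hφ.primitive.exists_pos_pow
    exact Matrix.exists_left_eigenvector (abelianization_nonneg φ) hk hφ.pfVector_perron.1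
      (one_pos.trans hφ.one_lt) hφ.pfVector_perron.2
  rw [leftVector, dif_pos h]
  exact h.choose_spec

lemma leftVector_dot_pfVector_pos [Nonempty 𝒜] : 0 < leftVector φ ⬝ᵥ (pfVector φ : 𝒜 → ℝ) :=
  Finset.sum_pos (fun i _ => mul_pos (hφ.leftVector_spec.1 i) (hφ.pfVector_perron.1 i))
    Finset.univ_nonempty

lemma isSimpleEigen [Nonempty 𝒜] :
    IsSimpleEigen (abelQ φ) (pfEigenvalue φ) (pfVector φ) (leftVector φ) where
  integral := hφ.integral
  right := by rw [toReal_abelQ]; exact hφ.pfVector_perron.2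
  left := by rw [toReal_abelQ]; exact hφ.leftVector_spec.2
  ne_zero := hφ.leftVector_dot_pfVector_pos.ne'
  simple := by
    obtain ⟨k, -, hk⟩ := hφ.primitive.exists_pos_pow
    rw [toReal_abelQ]
    exact Matrix.simple_of_pos hk hφ.pfVector_perron.1 hφ.pfVector_perron.2

lemma isSimpleEigen_transpose [Nonempty 𝒜] :
    IsSimpleEigen (abelQ φ)ᵀ (pfEigenvalue φ) (leftVector φ) (pfVector φ) where
  integral := hφ.integral
  right := by
    rw [Matrix.toReal, Matrix.transpose_map, ← Matrix.toReal, toReal_abelQ, Matrix.mulVec_transpose]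
    exact hφ.leftVector_spec.2
  left := by
    rw [Matrix.toReal, Matrix.transpose_map, ← Matrix.toReal, toReal_abelQ, Matrix.vecMul_transpose]
    exact hφ.pfVector_perron.2
  ne_zero := by rw [dotProduct_comm]; exact hφ.leftVector_dot_pfVector_pos.ne'
  simple := by
    obtain ⟨k, -, hk⟩ := hφ.primitive.exists_pos_pow
    rw [Matrix.toReal, Matrix.transpose_map, ← Matrix.toReal, toReal_abelQ]
    refine Matrix.simple_of_pos (k := k) ?_ hφ.leftVector_spec.1 ?_
    · intro i j
      rw [← Matrix.transpose_pow]; exact hk j i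
    · rw [Matrix.mulVec_transpose]; exact hφ.leftVector_spec.2

/-- With `uμ + wq = 1` and `(μq)(A) = 0`, the operators `(wq)(A)` and `(uμ)(A)` are complementary
projections onto the kernel and the range of `μ(A)`. -/
lemma isCompl [Nonempty 𝒜] : IsCompl (pisotSpace φ) (pisotCompl φ) := by
  obtain ⟨q, ⟨u, w, huw⟩, hq⟩ := hφ.isSimpleEigen.exists_coprime
  set μ := minpoly ℚ (pfEigenvalue φ) with hμ
  have h1 : ∀ x : 𝒜 → ℝ, (aeval (abelQ φ) (u * μ)).toReal *ᵥ x +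
      (aeval (abelQ φ) (w * q)).toReal *ᵥ x = x := by
    intro x
    rw [← Matrix.add_mulVec]
    have : (aeval (abelQ φ) (u * μ)).toReal + (aeval (abelQ φ) (w * q)).toReal =
        (aeval (abelQ φ) (u * μ + w * q)).toReal := by
      rw [map_add]; exact (Matrix.map_add _ (map_add _) _ _).symm
    rw [this, huw, map_one, Matrix.toReal, Matrix.map_one _ (map_zero _) (map_one _),
      Matrix.one_mulVec]
  have hmul : ∀ (p r : ℚ[X]) (x : 𝒜 → ℝ), (aeval (abelQ φ) (p * r)).toReal *ᵥ x =
      (aeval (abelQ φ) p).toReal *ᵥ ((aeval (abelQ φ) r).toReal *ᵥ x) := by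
    intro p r x
    rw [map_mul, Matrix.toReal, Matrix.map_mul, ← Matrix.mulVec_mulVec]
  have h0 : ∀ (p : ℚ[X]) (x : 𝒜 → ℝ), (aeval (abelQ φ) (p * (μ * q))).toReal *ᵥ x = 0 := by
    intro p x
    rw [map_mul, hq, mul_zero, Matrix.toReal, Matrix.map_zero _ (map_zero _), Matrix.zero_mulVec]
  constructor
  · rw [Submodule.disjoint_def]
    rintro _ hx ⟨y, rfl⟩
    rw [mem_pisotSpace_iff, minpolyEnd_apply] at hx
    rw [minpolyEnd_apply]
    have h2 := h1 ((aeval (abelQ φ) μ).toReal *ᵥ y)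
    rw [hmul u μ, hx, Matrix.mulVec_zero, zero_add, ← hmul, mul_assoc, mul_comm q μ, h0] at h2
    exact h2.symm
  · rw [codisjoint_iff, Submodule.eq_top_iff']
    intro x
    rw [← h1 x, add_comm]
    refine Submodule.add_mem_sup ?_ ⟨(aeval (abelQ φ) u).toReal *ᵥ x, ?_⟩
    · rw [mem_pisotSpace_iff, ← hmul, show μ * (w * q) = w * (μ * q) by ring, h0]
    · rw [minpolyEnd_apply, ← hmul, mul_comm]

lemma prV_coe [Nonempty 𝒜] (x : pisotSpace φ) : prV φ (x : 𝒜 → ℝ) = x := by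
  rw [prV, dif_pos hφ.isCompl]
  exact Submodule.projectionOnto_apply_left hφ.isCompl x

/-- The left eigenvector vanishes on the range of `μ(A)`, so projecting to `V` preserves the height.
In particular all `v_i` have positive height. -/
lemma leftVector_dot_prV [Nonempty 𝒜] (x : 𝒜 → ℝ) :
    leftVector φ ⬝ᵥ (prV φ x : 𝒜 → ℝ) = leftVector φ ⬝ᵥ x := by
  have hx : x ∈ pisotSpace φ ⊔ pisotCompl φ := by rw [hφ.isCompl.sup_eq_top]; trivial
  obtain ⟨y, hy, _, ⟨z, rfl⟩, rfl⟩ := Submodule.mem_sup.mp hx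
  have h1 : prV φ (minpolyEnd φ z) = 0 := by
    rw [prV, dif_pos hφ.isCompl]
    exact (Submodule.projectionOnto_apply_eq_zero_iff hφ.isCompl).2 ⟨z, rfl⟩
  have h2 := hφ.prV_coe ⟨y, hy⟩
  simp only at h2
  rw [map_add, h1, h2, add_zero, dotProduct_add, minpolyEnd_apply, Matrix.dotProduct_mulVec,
    hφ.isSimpleEigen.aeval_minpoly_left, zero_dotProduct, add_zero]

lemma height_segVec [Nonempty 𝒜] (i : 𝒜) : height φ (segVec φ i) = leftVector φ i := by
  rw [height_apply, segVec, hφ.leftVector_dot_prV]; simp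

lemma height_segVec_pos [Nonempty 𝒜] (i : 𝒜) : 0 < height φ (segVec φ i) := by
  rw [hφ.height_segVec]; exact hφ.leftVector_spec.1 i

lemma height_abelianV [Nonempty 𝒜] (y : pisotSpace φ) :
    height φ (abelianV φ y) = pfEigenvalue φ * height φ y := by
  change leftVector φ ⬝ᵥ (abelianization φ *ᵥ (y : 𝒜 → ℝ)) = _
  rw [Matrix.dotProduct_mulVec, hφ.leftVector_spec.2, smul_dotProduct]; rfl

lemma height_pfVector_pos [Nonempty 𝒜] : 0 < height φ (pfVector φ) :=
  hφ.leftVector_dot_pfVector_pos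

lemma abelianV_pfVector : abelianV φ (pfVector φ) = pfEigenvalue φ • pfVector φ :=
  Subtype.ext hφ.pfVector_perron.2

/-- Each vector of `V` is the combination of the `v_i` with its own coordinates. -/
lemma eq_sum_segVec [Nonempty 𝒜] (y : pisotSpace φ) :
    y = ∑ i, (y : 𝒜 → ℝ) i • segVec φ i := by
  conv_lhs => rw [← hφ.prV_coe y, pi_eq_sum_univ' (y : 𝒜 → ℝ), map_sum]
  refine Finset.sum_congr rfl fun i _ => ?_
  rw [map_smul, segVec]

lemma isMixing [Nonempty 𝒜] : IsMixing φ where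
  ne_nil := hφ.ne_nil
  mem_morPow := by
    obtain ⟨k, -, hk⟩ := hφ.primitive.exists_pos_pow
    refine ⟨k, fun n hn i j => ?_⟩
    obtain ⟨m, rfl⟩ := Nat.exists_eq_add_of_le hn
    rw [morPow_add]
    obtain ⟨a, ha⟩ := List.exists_mem_of_ne_nil _ (morPow_ne_nil hφ.ne_nil m i)
    refine (infix_extendWord_of_mem (morPow φ k) ha).subset ?_
    rw [← abelianization_pos_iff, abelianization_morPow]
    exact hk j a
  two_le := by
    -- If every image were a single letter, the column sums of `A` would be `1`; summing the
    -- coordinates of `Aω = lam ω` would give `lam = 1`.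
    by_contra! hcon
    have h1 : ∀ j, ∑ i, abelianization φ i j = 1 := fun j => by
      have h2 := List.length_pos_iff.2 (hφ.ne_nil j)
      have h3 : (φ j).length = 1 := by have := hcon j; omega
      have h4 : ∑ i, (φ j).count i = 1 := by
        rw [← h3, ← Multiset.coe_card, ← Multiset.sum_count_eq_card (s := Finset.univ)]
        · simp
        · simp
      simp only [abelianization, Matrix.of_apply]
      exact_mod_cast h4
    have h2 := congrArg (fun v => ∑ i, v i) hφ.pfVector_perron.2
    simp only [Matrix.mulVec, dotProduct, Pi.smul_apply, smul_eq_mul] at h2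
    rw [Finset.sum_comm] at h2
    simp only [← Finset.sum_mul, ← Finset.mul_sum, h1, one_mul] at h2
    have h3 : 0 < ∑ i, (pfVector φ : 𝒜 → ℝ) i :=
      Finset.sum_pos (fun i _ => hφ.pfVector_perron.1 i) Finset.univ_nonempty
    have := hφ.one_lt
    nlinarith

end IsPisotSubstitution

end PisotSpace

/-! ### Contraction on the stable subspace -/

section Decay

open Matrix Polynomial

variable {n : Type*} [Fintype n] [DecidableEq n]

lemma geometric_bound {E : Type*} [SeminormedAddCommGroup E] [NormedSpace ℂ E] {a b : ℕ → E} {z : ℂ}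
    {θ D : ℝ} (hz : ‖z‖ < θ) (hD : 0 ≤ D) (hb : ∀ k, ‖b k‖ ≤ D * θ ^ k)
    (ha : ∀ k, a (k + 1) = z • a k + b k) : ∃ D', 0 ≤ D' ∧ ∀ k, ‖a k‖ ≤ D' * θ ^ k := by
  have hθ : 0 < θ := (norm_nonneg z).trans_lt hz
  refine ⟨max ‖a 0‖ (D / (θ - ‖z‖)), (norm_nonneg _).trans (le_max_left _ _), fun k => ?_⟩
  have h1 : D ≤ max ‖a 0‖ (D / (θ - ‖z‖)) * (θ - ‖z‖) := by
    have := le_max_right ‖a 0‖ (D / (θ - ‖z‖))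
    rwa [div_le_iff₀ (sub_pos.2 hz)] at this
  set D' := max ‖a 0‖ (D / (θ - ‖z‖)) with hD'
  induction k with
  | zero => rw [pow_zero, mul_one]; exact le_max_left _ _
  | succ k ih =>
    rw [ha]
    refine (norm_add_le _ _).trans ?_
    rw [norm_smul]
    calc ‖z‖ * ‖a k‖ + ‖b k‖ ≤ ‖z‖ * (D' * θ ^ k) + D * θ ^ k := by
          gcongr
          exact hb k
      _ = (‖z‖ * D' + D) * θ ^ k := by ring
      _ ≤ (θ * D') * θ ^ k := by
          gcongr
          linarith
      _ = D' * θ ^ (k + 1) := by ring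

/-- One linear factor is removed at a time: `(B - z) v` decays by induction, and `B^k v` solves the
recursion `a (k+1) = z a k + b k` with this decaying inhomogeneity. Diagonalizability is not needed.
-/
lemma Matrix.decay_of_roots (B : Matrix n n ℂ) {θ : ℝ} (Z : Multiset ℂ) (hZ : ∀ z ∈ Z, ‖z‖ < θ)
    (v : n → ℂ) (hv : aeval B (Z.map fun z => X - C z).prod *ᵥ v = 0) :
    ∃ D, 0 ≤ D ∧ ∀ k : ℕ, ‖(B ^ k) *ᵥ v‖ ≤ D * θ ^ k := by
  induction Z using Multiset.induction_on generalizing v with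
  | empty =>
    simp only [Multiset.map_zero, Multiset.prod_zero, map_one, Matrix.one_mulVec] at hv
    subst hv
    exact ⟨0, le_rfl, fun k => by simp⟩
  | cons z Z ih =>
    have h1 : aeval B (Z.map fun z => X - C z).prod *ᵥ ((B - z • 1) *ᵥ v) = 0 := by
      have h2 : B - z • 1 = aeval B (X - C z) := by
        rw [map_sub, aeval_X, aeval_C, Algebra.algebraMap_eq_smul_one]
      rw [h2, Matrix.mulVec_mulVec, ← map_mul, mul_comm]
      rwa [Multiset.map_cons, Multiset.prod_cons] at hv
    obtain ⟨D, hD, hD'⟩ := ih (fun z hz => hZ z (Multiset.mem_cons_of_mem hz)) _ h1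
    refine geometric_bound (z := z) (b := fun k => (B ^ k) *ᵥ ((B - z • 1) *ᵥ v))
      (hZ z (Multiset.mem_cons_self _ _)) hD hD' fun k => ?_
    rw [Matrix.mulVec_mulVec, mul_sub, Matrix.sub_mulVec, ← pow_succ, mul_smul_comm, mul_one,
      Matrix.smul_mulVec]
    abel

end Decay

section StableNorms

open Matrix Polynomial

variable {𝒜 : Type*} [Fintype 𝒜] [DecidableEq 𝒜]

/-- A seminorm on the Pisot subspace that vanishes on the expanding line, is a norm transversally
to it, and is contracted by `A`. -/
structure StableNorm (φ : 𝒜 → List 𝒜) where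
  N : Seminorm ℝ (pisotSpace φ)
  θ : ℝ
  C : ℝ
  θ_nonneg : 0 ≤ θ
  θ_lt : θ < 1
  C_pos : 0 < C
  map_le : ∀ y, N (abelianV φ y) ≤ θ * N y
  pf : N (pfVector φ) = 0
  le : ∀ y, N y ≤ C * ‖y‖
  norm_le : ∀ y, ‖y‖ ≤ C * (|height φ y| + N y)

lemma Matrix.map_mulVec_ofReal {n m : Type*} [Fintype n] (M : Matrix m n ℝ) (y : n → ℝ) :
    (M.map (algebraMap ℝ ℂ)) *ᵥ (fun i => (y i : ℂ)) = fun i => ((M *ᵥ y) i : ℂ) := by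
  funext i
  simp [Matrix.mulVec, dotProduct]

namespace IsPisotSubstitution

variable {φ : 𝒜 → List 𝒜} (hφ : IsPisotSubstitution φ)
include hφ

lemma exists_roots : ∃ Z : Multiset ℂ, (∀ z ∈ Z, ‖z‖ < 1) ∧
    (minpoly ℚ (pfEigenvalue φ)).map (algebraMap ℚ ℂ) =
      (X - C (pfEigenvalue φ : ℂ)) * (Z.map fun z => X - C z).prod := by
  set μ := minpoly ℚ (pfEigenvalue φ) with hμ
  have hmonic : μ.Monic := minpoly.monic hφ.integral
  have hirr : Irreducible μ := minpoly.irreducible hφ.integral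
  have hne : μ.map (algebraMap ℚ ℂ) ≠ 0 := (hmonic.map _).ne_zero
  have hlam : (pfEigenvalue φ : ℂ) ∈ (μ.map (algebraMap ℚ ℂ)).roots := by
    rw [mem_roots hne, IsRoot, eval_map_algebraMap]
    have h1 := aeval_algebraMap_apply ℂ (pfEigenvalue φ) μ
    rw [minpoly.aeval, map_zero] at h1
    exact h1
  have hnodup : (μ.map (algebraMap ℚ ℂ)).roots.Nodup := nodup_roots (hirr.separable.map)
  obtain ⟨Z, hZ⟩ := Multiset.exists_cons_of_mem hlam
  refine ⟨Z, fun z hz => ?_, ?_⟩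
  · have hz' : z ∈ (μ.map (algebraMap ℚ ℂ)).roots := by
      rw [hZ]; exact Multiset.mem_cons_of_mem hz
    rw [mem_roots hne, IsRoot, eval_map_algebraMap] at hz'
    refine hφ.pisot.2.2 z hz' ?_
    rintro rfl
    rw [hZ, Multiset.nodup_cons] at hnodup
    exact hnodup.1 hz
  · rw [← Multiset.prod_cons, ← Multiset.map_cons (fun z => X - C z), ← hZ]
    exact (IsAlgClosed.splits _).eq_prod_roots_of_monic (hmonic.map _)

/-- Apply to `y` the product of `A - z` over the conjugates `z ≠ lam`. The result is a
`lam`-eigenvector of height `0`, hence zero, so `y` is annihilated by a polynomial whose roots all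
lie in the open unit disc. -/
lemma exists_theta : ∃ θ : ℝ, 0 < θ ∧ θ < 1 ∧ ∀ y : pisotSpace φ, height φ y = 0 →
    ∃ D, 0 ≤ D ∧ ∀ k : ℕ, ‖(abelianV φ ^ k) y‖ ≤ D * θ ^ k := by
  obtain hemp | hne := isEmpty_or_nonempty 𝒜
  · refine ⟨1 / 2, by norm_num, by norm_num, fun y _ => ⟨0, le_rfl, fun k => ?_⟩⟩
    have : (abelianV φ ^ k) y = 0 := Subtype.ext (Subsingleton.elim _ _)
    rw [this]; simp
  obtain ⟨Z, hZ, hμ⟩ := hφ.exists_roots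
  obtain ⟨θ, hθ0, hθ1, hθ⟩ : ∃ θ : ℝ, 0 < θ ∧ θ < 1 ∧ ∀ z ∈ Z, ‖z‖ < θ := by
    clear hμ
    induction Z using Multiset.induction_on with
    | empty => exact ⟨1 / 2, by norm_num, by norm_num, by simp⟩
    | cons z Z ih =>
      obtain ⟨θ, h1, h2, h3⟩ := ih fun z hz => hZ z (Multiset.mem_cons_of_mem hz)
      obtain ⟨r, hr1, hr2⟩ := exists_between (hZ z (Multiset.mem_cons_self _ _))
      refine ⟨max θ r, lt_max_of_lt_left h1, max_lt h2 hr2, fun w hw => ?_⟩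
      rcases Multiset.mem_cons.1 hw with rfl | hw
      · exact lt_max_of_lt_right hr1
      · exact lt_max_of_lt_left (h3 w hw)
  refine ⟨θ, hθ0, hθ1, fun y hy => ?_⟩
  set B : Matrix 𝒜 𝒜 ℂ := (abelianization φ).map (algebraMap ℝ ℂ) with hB
  set yC : 𝒜 → ℂ := fun i => ((y : 𝒜 → ℝ) i : ℂ) with hyC
  set v := aeval B (Z.map fun z => X - C z).prod *ᵥ yC with hv
  have h1 : B *ᵥ v = (pfEigenvalue φ : ℂ) • v := by
    have h2 : aeval B ((minpoly ℚ (pfEigenvalue φ)).map (algebraMap ℚ ℂ)) *ᵥ yC = 0 := by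
      have h3 := Polynomial.aeval_algHom_apply ((Algebra.ofId ℚ ℂ).mapMatrix (m := 𝒜)) (abelQ φ)
        (minpoly ℚ (pfEigenvalue φ))
      have h4 : (Algebra.ofId ℚ ℂ).mapMatrix (abelQ φ) = B := by
        rw [hB, ← toReal_abelQ]; ext i j; simp
      rw [h4] at h3
      rw [aeval_map_algebraMap, h3]
      have h5 := mem_pisotSpace_iff.1 y.2
      have h6 := Matrix.map_mulVec_ofReal
        (aeval (abelQ φ) (minpoly ℚ (pfEigenvalue φ))).toReal (y : 𝒜 → ℝ)
      rw [h5] at h6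
      rw [hyC]
      refine Eq.trans ?_ (h6.trans (by funext i; simp))
      congr 1
    rw [hμ, map_mul, ← Matrix.mulVec_mulVec, map_sub, aeval_X, aeval_C, Matrix.sub_mulVec,
      sub_eq_zero, Algebra.algebraMap_eq_smul_one, Matrix.smul_mulVec, Matrix.one_mulVec] at h2
    exact h2
  have h2 : (fun i => (leftVector φ i : ℂ)) ⬝ᵥ v = 0 := by
    have h3 : (fun i => (leftVector φ i : ℂ)) ᵥ* B =
        (pfEigenvalue φ : ℂ) • fun i => (leftVector φ i : ℂ) := by
      rw [← Matrix.mulVec_transpose]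
      refine (Matrix.map_mulVec_ofReal (abelianization φ)ᵀ (leftVector φ)).trans ?_
      rw [Matrix.mulVec_transpose, hφ.leftVector_spec.2]
      funext i; simp
    rw [hv, Matrix.dotProduct_mulVec, Matrix.vecMul_aeval h3, smul_dotProduct]
    have h4 : (fun i => (leftVector φ i : ℂ)) ⬝ᵥ yC = (height φ y : ℂ) := by
      simp [dotProduct, hyC, height_apply]
    rw [h4, hy]; simp
  -- Simplicity of the eigenvalue is available over `ℝ`, so it is applied to real-linear images of
  -- `v`; the real and imaginary parts are taken below.
  have part : ∀ f : ℂ →ₗ[ℝ] ℝ, ∀ i, f (v i) = 0 := by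
    intro f
    have hf : ∀ (r : ℝ) (w : ℂ), f ((r : ℂ) * w) = r * f w := fun r w => by
      rw [← smul_eq_mul, ← smul_eq_mul, ← map_smul]; congr 1
    have e1 : abelianization φ *ᵥ (fun i => f (v i)) = pfEigenvalue φ • fun i => f (v i) := by
      funext i
      have := congrArg f (congrFun h1 i)
      simp only [Matrix.mulVec, dotProduct, map_sum, Pi.smul_apply, smul_eq_mul, hf] at this ⊢
      rw [← this]
      exact Finset.sum_congr rfl fun j _ => (hf _ _).symm
    have e2 : leftVector φ ⬝ᵥ (fun i => f (v i)) = 0 := by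
      have := congrArg f h2
      simp only [dotProduct, map_sum, hf, map_zero] at this ⊢
      exact this
    rw [← toReal_abelQ] at e1
    obtain ⟨c, hc⟩ := hφ.isSimpleEigen.simple _ e1
    rw [hc, dotProduct_smul, smul_eq_mul, mul_eq_zero,
      or_iff_left hφ.isSimpleEigen.ne_zero] at e2
    intro i
    have := congrFun hc i
    rw [e2, zero_smul] at this
    exact this
  have hv0 : v = 0 := funext fun i => Complex.ext
    (by simpa using part Complex.reLm i) (by simpa using part Complex.imLm i)
  obtain ⟨D, hD, hD'⟩ := Matrix.decay_of_roots B Z hθ yC hv0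
  refine ⟨D, hD, fun k => le_trans ?_ (hD' k)⟩
  have h3 : (B ^ k) *ᵥ yC = fun i => (((abelianV φ ^ k) y : 𝒜 → ℝ) i : ℂ) := by
    induction k with
    | zero => simp [hyC]
    | succ k ih =>
      rw [pow_succ', ← Matrix.mulVec_mulVec, ih, hB, Matrix.map_mulVec_ofReal, pow_succ']
      rfl
  rw [h3]
  change ‖((abelianV φ ^ k) y : 𝒜 → ℝ)‖ ≤ _
  refine (pi_norm_le_iff_of_nonneg (norm_nonneg _)).2 fun i => ?_
  have h4 := norm_le_pi_norm (fun i => (((abelianV φ ^ k) y : 𝒜 → ℝ) i : ℂ)) i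
  simpa using h4

/-- The usual adapted norm: with `s` the projection to height `0` along `ω`, take `N y = sup_k
θ^(-k) ‖A^k (s y)‖`. Replacing `y` by `A y` shifts the index and gains a factor `θ`; the supremum is
finite because the decay holds for the finitely many spanning vectors `v_i`. -/
theorem nonempty_stableNorm [Nonempty 𝒜] : Nonempty (StableNorm φ) := by
  obtain ⟨θ, hθ0, hθ1, hθ⟩ := hφ.exists_theta
  have hω := hφ.height_pfVector_pos
  let s : pisotSpace φ →ₗ[ℝ] pisotSpace φ :=
    LinearMap.id - ((height φ (pfVector φ))⁻¹ • height φ).smulRight (pfVector φ)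
  have hs : ∀ y, s y = y - ((height φ (pfVector φ))⁻¹ * height φ y) • pfVector φ := fun y => rfl
  have hs0 : ∀ y, height φ (s y) = 0 := fun y => by
    rw [hs, map_sub, map_smul, smul_eq_mul]; field_simp; ring
  have hsA : ∀ y, s (abelianV φ y) = abelianV φ (s y) := fun y => by
    rw [hs, hs, map_sub, map_smul, hφ.abelianV_pfVector, hφ.height_abelianV, smul_smul]
    congr 2; ring
  choose D hD0 hD using fun i => hθ (s (segVec φ i)) (hs0 _)
  set D₀ := ∑ i, D i with hD₀
  have hD₀0 : 0 ≤ D₀ := Finset.sum_nonneg fun i _ => hD0 i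
  have hbound : ∀ (y : pisotSpace φ) (k : ℕ), ‖(abelianV φ ^ k) (s y)‖ ≤ D₀ * ‖y‖ * θ ^ k := by
    intro y k
    conv_lhs => rw [hφ.eq_sum_segVec y]
    rw [map_sum, map_sum, hD₀, Finset.sum_mul, Finset.sum_mul]
    refine (norm_sum_le _ _).trans (Finset.sum_le_sum fun i _ => ?_)
    rw [map_smul, map_smul, norm_smul]
    have h1 : ‖(y : 𝒜 → ℝ) i‖ ≤ ‖y‖ := norm_le_pi_norm (y : 𝒜 → ℝ) i
    calc _ ≤ ‖y‖ * (D i * θ ^ k) := mul_le_mul h1 (hD i k) (norm_nonneg _) (norm_nonneg _)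
      _ = _ := by ring
  let f : pisotSpace φ → ℕ → ℝ := fun y k => (θ ^ k)⁻¹ * ‖(abelianV φ ^ k) (s y)‖
  have hf : ∀ y k, f y k ≤ D₀ * ‖y‖ := fun y k => by
    rw [inv_mul_le_iff₀ (pow_pos hθ0 k), mul_comm]; exact hbound y k
  have hbdd : ∀ y, BddAbove (Set.range (f y)) := fun y => ⟨_, by rintro _ ⟨k, rfl⟩; exact hf y k⟩
  have hfle : ∀ y k, f y k ≤ ⨆ k, f y k := fun y k => le_ciSup (hbdd y) k
  have hle : ∀ y, ⨆ k, f y k ≤ D₀ * ‖y‖ := fun y => ciSup_le (hf y)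
  let N : Seminorm ℝ (pisotSpace φ) := Seminorm.ofSMulLE (fun y => ⨆ k, f y k)
    (by
      have : ∀ k, f 0 k = 0 := fun k => by simp [f]
      simp [this])
    (fun x y => ciSup_le fun k => by
      refine le_trans ?_ (add_le_add (hfle x k) (hfle y k))
      simp only [f]
      rw [← mul_add, map_add, map_add]
      exact mul_le_mul_of_nonneg_left (norm_add_le _ _) (by positivity))
    (fun r x => ciSup_le fun k => by
      refine le_trans (le_of_eq ?_) (mul_le_mul_of_nonneg_left (hfle x k) (norm_nonneg r))
      simp only [f]
      rw [map_smul, map_smul, norm_smul]; ring)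
  have hN : ∀ y, N y = ⨆ k, f y k := fun y => rfl
  have hsN : ∀ y, ‖s y‖ ≤ N y := fun y => by
    refine le_trans (le_of_eq ?_) (hfle y 0)
    simp [f]
  set C := max (D₀ + 1) (1 + (height φ (pfVector φ))⁻¹ * ‖pfVector φ‖) with hC
  refine ⟨⟨N, θ, C, hθ0.le, hθ1, lt_max_of_lt_left (by positivity), ?_, ?_, ?_, ?_⟩⟩
  · intro y
    refine ciSup_le fun k => ?_
    have h1 : f (abelianV φ y) k = θ * f y (k + 1) := by
      simp only [f, hsA]
      rw [pow_succ (abelianV φ), Module.End.mul_apply, pow_succ θ, mul_inv]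
      field_simp
    rw [h1]
    exact mul_le_mul_of_nonneg_left (hfle y _) hθ0.le
  · have h1 : s (pfVector φ) = 0 := by
      rw [hs, inv_mul_cancel₀ hω.ne', one_smul, sub_self]
    rw [hN]
    have : ∀ k, f (pfVector φ) k = 0 := fun k => by simp [f, h1]
    simp [this]
  · intro y
    refine (hle y).trans (mul_le_mul_of_nonneg_right ?_ (norm_nonneg _))
    exact le_trans (by linarith) (le_max_left _ _)
  · intro y
    have h1 : y = s y + ((height φ (pfVector φ))⁻¹ * height φ y) • pfVector φ := by
      rw [hs, sub_add_cancel]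
    have h2 : ‖y‖ ≤ N y + (height φ (pfVector φ))⁻¹ * ‖pfVector φ‖ * |height φ y| := by
      calc ‖y‖ ≤ ‖s y‖ + ‖((height φ (pfVector φ))⁻¹ * height φ y) • pfVector φ‖ := by
            conv_lhs => rw [h1]
            exact norm_add_le _ _
        _ ≤ _ := by
            rw [norm_smul, norm_mul, Real.norm_of_nonneg (inv_nonneg.2 hω.le), Real.norm_eq_abs]
            have := hsN y
            nlinarith
    have h3 : 1 + (height φ (pfVector φ))⁻¹ * ‖pfVector φ‖ ≤ C := le_max_right _ _
    have h4 : 0 ≤ (height φ (pfVector φ))⁻¹ * ‖pfVector φ‖ := by positivity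
    have h5 : 0 ≤ N y := apply_nonneg N y
    have h6 : 0 ≤ |height φ y| := abs_nonneg _
    have h7 := mul_le_mul_of_nonneg_right h3 (add_nonneg h6 h5)
    nlinarith [mul_nonneg h4 h5]

end IsPisotSubstitution

end StableNorms

/-! ### Paths: parametrized strands -/

section Paths

open Matrix Polynomial

variable {𝒜 ℬ : Type*} [Fintype 𝒜] [DecidableEq 𝒜] [Fintype ℬ] [DecidableEq ℬ]

/-- `x` is the sequence of vertices of a strand with the edge types `w`. -/
def IsPath (φ : 𝒜 → List 𝒜) (w : ℤ → 𝒜) (x : ℤ → pisotSpace φ) : Prop :=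
  ∀ k, x (k + 1) = x k + segVec φ (w k)

/-- The set of edges of a path. -/
def pathEdges {φ : 𝒜 → List 𝒜} (w : ℤ → 𝒜) (x : ℤ → pisotSpace φ) : Set (Edge φ) :=
  Set.range fun k => (w k, x k)

lemma mem_pathEdges {φ : 𝒜 → List 𝒜} {w : ℤ → 𝒜} {x : ℤ → pisotSpace φ} {e : Edge φ} :
    e ∈ pathEdges w x ↔ ∃ k, w k = e.1 ∧ x k = e.2 := by
  simp [pathEdges, Prod.ext_iff]

/-- The vector of a word: the sum of the vectors of its letters. -/
noncomputable def wordVec (φ : 𝒜 → List 𝒜) (u : List 𝒜) : pisotSpace φ := (u.map (segVec φ)).sum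

@[simp] lemma wordVec_nil (φ : 𝒜 → List 𝒜) : wordVec φ [] = 0 := rfl

@[simp] lemma wordVec_cons (φ : 𝒜 → List 𝒜) (a : 𝒜) (u : List 𝒜) :
    wordVec φ (a :: u) = segVec φ a + wordVec φ u := by simp [wordVec]

@[simp] lemma wordVec_append (φ : 𝒜 → List 𝒜) (u v : List 𝒜) :
    wordVec φ (u ++ v) = wordVec φ u + wordVec φ v := by simp [wordVec]

lemma Strand.exists_path {φ : 𝒜 → List 𝒜} (γ : Strand φ) :
    ∃ w x, IsPath φ w x ∧ γ.edges = pathEdges w x := by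
  obtain ⟨w, x, h1, h2⟩ := γ.2
  exact ⟨w, x, h1, h2⟩

/-- The strand of a path. -/
def IsPath.strand {φ : 𝒜 → List 𝒜} {w : ℤ → 𝒜} {x : ℤ → pisotSpace φ} (h : IsPath φ w x) :
    Strand φ := ⟨pathEdges w x, w, x, h, rfl⟩

@[simp] lemma IsPath.edges_strand {φ : 𝒜 → List 𝒜} {w : ℤ → 𝒜} {x : ℤ → pisotSpace φ}
    (h : IsPath φ w x) : h.strand.edges = pathEdges w x := rfl

lemma Strand.ext_edges {φ : 𝒜 → List 𝒜} {γ γ' : Strand φ} (h : γ.edges = γ'.edges) : γ = γ' :=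
  Subtype.ext h

lemma exists_isPath (φ : 𝒜 → List 𝒜) (w : ℤ → 𝒜) (a : ℤ) (v : pisotSpace φ) :
    ∃ x, x a = v ∧ IsPath φ w x := by
  obtain ⟨F, -, hF⟩ := exists_int_sum (fun k => segVec φ (w k)) 0
  exact ⟨fun k => F k + (v - F a), by simp, fun k => by beta_reduce; rw [hF]; abel⟩

namespace IsPath

variable {φ : 𝒜 → List 𝒜} {w : ℤ → 𝒜} {x : ℤ → pisotSpace φ}

lemma shift (h : IsPath φ w x) (j : ℤ) : IsPath φ (fun k => w (k + j)) (fun k => x (k + j)) :=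
  fun k => by
    have := h (k + j)
    beta_reduce
    rw [← this, add_right_comm]

lemma pathEdges_shift (w : ℤ → 𝒜) (x : ℤ → pisotSpace φ) (j : ℤ) :
    pathEdges (fun k => w (k + j)) (fun k => x (k + j)) = pathEdges w x := by
  ext e
  simp only [mem_pathEdges]
  exact ⟨fun ⟨k, hk⟩ => ⟨k + j, hk⟩, fun ⟨k, hk⟩ => ⟨k - j, by simpa using hk⟩⟩

lemma add_const (h : IsPath φ w x) (v : pisotSpace φ) : IsPath φ w (fun k => x k + v) :=
  fun k => by beta_reduce; rw [h]; abel

lemma sum_block (h : IsPath φ w x) {a b : ℤ} (hab : a ≤ b) :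
    x b = x a + wordVec φ (block w a b) := by
  obtain ⟨n, rfl⟩ := Int.le.dest hab
  clear hab
  induction n with
  | zero => simp [block_self]
  | succ n ih =>
    push_cast
    rw [← add_assoc, h, ih, ← block_append w (show a ≤ a + n by omega)
      (show a + (n : ℤ) ≤ a + n + 1 by omega), block_succ, wordVec_append]
    simp [add_assoc]

lemma unique {x' : ℤ → pisotSpace φ} (h : IsPath φ w x) (h' : IsPath φ w x') (k : ℤ) :
    x' k = x k + (x' 0 - x 0) :=
  eq_add_of_step_eq (fun k => by rw [h, h']; abel) k

end IsPath

lemma Strand.edges_translate {φ : 𝒜 → List 𝒜} (γ : Strand φ) (v : pisotSpace φ) (e : Edge φ) :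
    e ∈ (γ.translate v).edges ↔ (e.1, e.2 - v) ∈ γ.edges := by
  change e ∈ (fun e : Edge φ => (e.1, e.2 + v)) '' γ.edges ↔ _
  constructor
  · rintro ⟨f, hf, rfl⟩
    simpa using hf
  · intro h
    exact ⟨_, h, by simp⟩

lemma Strand.edges_flow {φ : 𝒜 → List 𝒜} (γ : Strand φ) (t : ℝ) (e : Edge φ) :
    e ∈ (γ.flow t).edges ↔ (e.1, e.2 + t • pfVector φ) ∈ γ.edges := by
  rw [Strand.flow, Strand.edges_translate, sub_neg_eq_add]

namespace IsPisotSubstitution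

variable {φ : 𝒜 → List 𝒜} [Nonempty 𝒜] (hφ : IsPisotSubstitution φ)
include hφ

lemma exists_height_bounds : ∃ δ M : ℝ, 0 < δ ∧ 0 < M ∧ ∀ i, δ ≤ height φ (segVec φ i) ∧
    height φ (segVec φ i) ≤ M := by
  obtain ⟨i, hi⟩ := Finite.exists_min fun i => height φ (segVec φ i)
  obtain ⟨j, hj⟩ := Finite.exists_max fun i => height φ (segVec φ i)
  exact ⟨_, _, hφ.height_segVec_pos i, hφ.height_segVec_pos j, fun k => ⟨hi k, hj k⟩⟩

/-- The height orders the vertices of a strand; it replaces the index when edges near the origin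
have to be located. -/
lemma height_strictMono {w : ℤ → 𝒜} {x : ℤ → pisotSpace φ} (h : IsPath φ w x) :
    StrictMono fun k => height φ (x k) :=
  strictMono_of_step fun k => by
    rw [h, map_add]
    have := hφ.height_segVec_pos (w k)
    linarith

lemma vertex_injective {w : ℤ → 𝒜} {x : ℤ → pisotSpace φ} (h : IsPath φ w x) :
    Function.Injective x :=
  fun _ _ hkl => (hφ.height_strictMono h).injective (congrArg (height φ) hkl)

lemma height_sub_ge {δ : ℝ} (hδ : ∀ i, δ ≤ height φ (segVec φ i)) {w : ℤ → 𝒜}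
    {x : ℤ → pisotSpace φ} (h : IsPath φ w x) {k l : ℤ} (hkl : k ≤ l) :
    δ * (l - k : ℤ) ≤ height φ (x l) - height φ (x k) := by
  obtain ⟨n, rfl⟩ := Int.le.dest hkl
  clear hkl
  induction n with
  | zero => simp
  | succ n ih =>
    have h1 := hδ (w (k + n))
    push_cast at ih ⊢
    rw [← add_assoc k, h, map_add]
    linarith

lemma exists_height_floor {w : ℤ → 𝒜} {x : ℤ → pisotSpace φ} (h : IsPath φ w x) (t : ℝ) :
    ∃ k, height φ (x k) ≤ t ∧ t < height φ (x (k + 1)) := by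
  obtain ⟨δ, M, hδ, -, hb⟩ := hφ.exists_height_bounds
  have hge := fun {k l} => hφ.height_sub_ge (fun i => (hb i).1) h (k := k) (l := l)
  obtain ⟨N, hN⟩ := exists_nat_gt (|t - height φ (x 0)| / δ)
  rw [div_lt_iff₀ hδ] at hN
  obtain ⟨k, hk, hk'⟩ := Int.exists_greatest_of_bdd (P := fun k => height φ (x k) ≤ t)
    ⟨N, fun z hz => by
      by_contra! hlt
      have h1 := hge (show (0 : ℤ) ≤ z by omega)
      have h2 := le_abs_self (t - height φ (x 0))
      have h3 : ((N : ℤ) : ℝ) ≤ (z - 0 : ℤ) := by exact_mod_cast (by omega)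
      have h4 := mul_le_mul_of_nonneg_left h3 hδ.le
      push_cast at h4 h1
      linarith⟩
    ⟨-(N : ℤ), by
      have h1 := hge (show -(N : ℤ) ≤ 0 by omega)
      have h2 := neg_abs_le (t - height φ (x 0))
      push_cast at h1
      linarith⟩
  refine ⟨k, hk, ?_⟩
  by_contra! hle
  have := hk' (k + 1) hle
  omega

/-- A strand has just one parametrization, up to a shift. -/
lemma path_unique {w w' : ℤ → 𝒜} {x x' : ℤ → pisotSpace φ} (h : IsPath φ w x)
    (h' : IsPath φ w' x') (heq : pathEdges w x = pathEdges w' x') :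
    ∃ j, ∀ k, w' k = w (k + j) ∧ x' k = x (k + j) := by
  obtain ⟨j, hj1, hj2⟩ := mem_pathEdges.1 (heq ▸ mem_pathEdges.2 ⟨0, rfl, rfl⟩ :
    ((w' 0, x' 0) : Edge φ) ∈ pathEdges w x)
  have hlabel : ∀ k, x' k = x (k + j) → w' k = w (k + j) := by
    intro k hk
    obtain ⟨l, hl1, hl2⟩ := mem_pathEdges.1 (heq ▸ mem_pathEdges.2 ⟨k, rfl, rfl⟩ :
      ((w' k, x' k) : Edge φ) ∈ pathEdges w x)
    simp only at hl1 hl2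
    rw [hk] at hl2
    rw [← hl1, hφ.vertex_injective h hl2]
  have hx : ∀ k, x' k = x (k + j) := by
    intro k
    induction k using Int.induction_on with
    | zero => simpa using hj2.symm
    | succ n ih =>
      rw [h', ih, hlabel _ ih, ← h]; congr 1; ring
    | pred n ih =>
      obtain ⟨l, hl1, hl2⟩ := mem_pathEdges.1 (heq ▸ mem_pathEdges.2 ⟨-(n : ℤ) - 1, rfl, rfl⟩ :
        ((w' (-(n : ℤ) - 1), x' (-(n : ℤ) - 1)) : Edge φ) ∈ pathEdges w x)
      simp only at hl1 hl2
      have h1 := h l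
      have h2 := h' (-(n : ℤ) - 1)
      rw [hl1, hl2, ← h2, sub_add_cancel, ih] at h1
      have h3 := hφ.vertex_injective h h1
      rw [← hl2]; congr 1; omega
  exact ⟨j, fun k => ⟨hlabel k (hx k), hx k⟩⟩

/-- The parametrization of a strand for which the edge number `0` lies over the height `0`. -/
lemma exists_normalized_path (γ : Strand φ) : ∃ w x, IsPath φ w x ∧ γ.edges = pathEdges w x ∧
    height φ (x 0) ≤ 0 ∧ 0 < height φ (x 1) := by
  obtain ⟨w, x, h1, h2⟩ := γ.exists_path
  obtain ⟨k, h3, h4⟩ := hφ.exists_height_floor h1 0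
  exact ⟨_, _, h1.shift k, by rw [IsPath.pathEdges_shift, h2], by simpa using h3,
    by simpa [add_comm] using h4⟩

end IsPisotSubstitution

/-! ### The maps of strands induced by morphisms -/

/-- A morphism that intertwines two Pisot substitutions. -/
structure IsPisotMorphism (φ' : ℬ → List ℬ) (φ : 𝒜 → List 𝒜) (ρ : ℬ → List 𝒜) : Prop where
  source : IsPisotSubstitution φ'
  target : IsPisotSubstitution φ
  comm : ∀ i, extendWord ρ (φ' i) = extendWord φ (ρ i)
  ne_nil : ∀ i, ρ i ≠ []

/-- The linear map of Pisot subspaces induced by a morphism. -/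
noncomputable def abelMap (φ' : ℬ → List ℬ) (φ : 𝒜 → List 𝒜) (ρ : ℬ → List 𝒜) :
    pisotSpace φ' →ₗ[ℝ] pisotSpace φ :=
  prV φ ∘ₗ Matrix.toLin' (abelianization ρ) ∘ₗ (pisotSpace φ').subtype

lemma IsPisotSubstitution.isPisotMorphism {φ : 𝒜 → List 𝒜} (hφ : IsPisotSubstitution φ) :
    IsPisotMorphism φ φ φ := ⟨hφ, hφ, fun _ => rfl, hφ.ne_nil⟩

lemma Matrix.toReal_mul {l m n : Type*} [Fintype m] (M : Matrix l m ℚ) (N : Matrix m n ℚ) :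
    (M * N).toReal = M.toReal * N.toReal := Matrix.map_mul

lemma Matrix.aeval_mul_comm {n m : Type*} [Fintype n] [DecidableEq n] [Fintype m] [DecidableEq m]
    {A : Matrix n n ℚ} {A' : Matrix m m ℚ} {P : Matrix n m ℚ} (h : A * P = P * A') (p : ℚ[X]) :
    aeval A p * P = P * aeval A' p := by
  induction p using Polynomial.induction_on' with
  | add p q hp hq => rw [map_add, map_add, Matrix.add_mul, Matrix.mul_add, hp, hq]
  | monomial k a =>
    have hk : ∀ k : ℕ, A ^ k * P = P * A' ^ k := fun k => by
      induction k with
      | zero => simp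
      | succ k ih => rw [pow_succ, Matrix.mul_assoc, h, ← Matrix.mul_assoc, ih, Matrix.mul_assoc,
          ← pow_succ]
    rw [aeval_monomial, aeval_monomial, Algebra.algebraMap_eq_smul_one,
      Algebra.algebraMap_eq_smul_one, smul_mul_assoc, one_mul, smul_mul_assoc, one_mul,
      Matrix.smul_mul, Matrix.mul_smul, hk]

lemma Matrix.aeval_transpose {n : Type*} [Fintype n] [DecidableEq n] (A : Matrix n n ℚ)
    (p : ℚ[X]) : aeval Aᵀ p = (aeval A p)ᵀ := by
  induction p using Polynomial.induction_on' with
  | add p q hp hq => rw [map_add, map_add, Matrix.transpose_add, hp, hq]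
  | monomial k a =>
    rw [aeval_monomial, aeval_monomial, Algebra.algebraMap_eq_smul_one, smul_mul_assoc, one_mul,
      smul_mul_assoc, one_mul, Matrix.transpose_smul, Matrix.transpose_pow]

namespace IsPisotMorphism

variable {φ' : ℬ → List ℬ} {φ : 𝒜 → List 𝒜} {ρ : ℬ → List 𝒜}
  (h : IsPisotMorphism φ' φ ρ)

section

include h

lemma abelQ_comm : abelQ φ * abelQ ρ = abelQ ρ * abelQ φ' := by
  have h1 : abelianization φ * abelianization ρ = abelianization ρ * abelianization φ' := by
    rw [← abelianization_morComp, ← abelianization_morComp]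
    congr 1
    funext i; exact (h.comm i).symm
  rw [← toReal_abelQ, ← toReal_abelQ, ← toReal_abelQ, ← Matrix.toReal_mul,
    ← Matrix.toReal_mul] at h1
  exact Matrix.map_injective (algebraMap ℚ ℝ).injective h1

lemma abelianization_comm :
    abelianization φ * abelianization ρ = abelianization ρ * abelianization φ' := by
  rw [← toReal_abelQ, ← toReal_abelQ, ← toReal_abelQ, ← Matrix.toReal_mul, ← Matrix.toReal_mul,
    h.abelQ_comm]

variable [Nonempty 𝒜] [Nonempty ℬ]

lemma leftVector_vecMul_pos (b : ℬ) : 0 < (leftVector φ ᵥ* abelianization ρ) b := by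
  obtain ⟨a, ha⟩ := List.exists_mem_of_ne_nil _ (h.ne_nil b)
  exact Finset.sum_pos' (fun i _ => mul_nonneg (h.target.leftVector_spec.1 i).le
    (abelianization_nonneg ρ i b)) ⟨a, Finset.mem_univ a, mul_pos (h.target.leftVector_spec.1 a)
    ((abelianization_pos_iff ρ a b).2 ha)⟩

/-- Evaluate `ℓ A P ω' = ℓ P A' ω'` in both ways; `ℓ P ω'` is positive. -/
lemma pfEigenvalue_eq : pfEigenvalue φ' = pfEigenvalue φ := by
  have h1 : leftVector φ ⬝ᵥ (abelianization φ *ᵥ (abelianization ρ *ᵥ (pfVector φ' : ℬ → ℝ))) =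
      leftVector φ ⬝ᵥ (abelianization ρ *ᵥ (abelianization φ' *ᵥ (pfVector φ' : ℬ → ℝ))) := by
    rw [Matrix.mulVec_mulVec, Matrix.mulVec_mulVec, h.abelianization_comm]
  rw [h.source.pfVector_perron.2, Matrix.dotProduct_mulVec, h.target.leftVector_spec.2,
    Matrix.mulVec_smul, dotProduct_smul, smul_dotProduct, Matrix.dotProduct_mulVec,
    smul_eq_mul, smul_eq_mul] at h1
  have h2 : 0 < (leftVector φ ᵥ* abelianization ρ) ⬝ᵥ (pfVector φ' : ℬ → ℝ) :=
    Finset.sum_pos (fun i _ => mul_pos (h.leftVector_vecMul_pos i)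
      (h.source.pfVector_perron.1 i)) Finset.univ_nonempty
  exact (mul_right_cancel₀ h2.ne' h1).symm

lemma minpolyEnd_mulVec (x : ℬ → ℝ) : minpolyEnd φ (abelianization ρ *ᵥ x) =
    abelianization ρ *ᵥ minpolyEnd φ' x := by
  rw [minpolyEnd_apply, minpolyEnd_apply, ← toReal_abelQ, Matrix.mulVec_mulVec,
    Matrix.mulVec_mulVec, ← Matrix.toReal_mul, ← Matrix.toReal_mul,
    Matrix.aeval_mul_comm h.abelQ_comm, h.pfEigenvalue_eq]

lemma mulVec_mem (y : pisotSpace φ') : abelianization ρ *ᵥ (y : ℬ → ℝ) ∈ pisotSpace φ := by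
  have hy : minpolyEnd φ' y = 0 := y.2
  change minpolyEnd φ _ = 0
  rw [h.minpolyEnd_mulVec, hy, Matrix.mulVec_zero]

lemma abelMap_coe (y : pisotSpace φ') :
    (abelMap φ' φ ρ y : 𝒜 → ℝ) = abelianization ρ *ᵥ (y : ℬ → ℝ) :=
  congrArg Subtype.val (h.target.prV_coe ⟨_, h.mulVec_mem y⟩)

lemma prV_mulVec (x : ℬ → ℝ) :
    prV φ (abelianization ρ *ᵥ x) = abelMap φ' φ ρ (prV φ' x) := by
  have hx : x ∈ pisotSpace φ' ⊔ pisotCompl φ' := by rw [h.source.isCompl.sup_eq_top]; trivial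
  obtain ⟨y, hy, _, ⟨z, rfl⟩, rfl⟩ := Submodule.mem_sup.mp hx
  have key : ∀ {𝒞 : Type _} [Fintype 𝒞] [DecidableEq 𝒞] [Nonempty 𝒞] {ψ : 𝒞 → List 𝒞}
      (hψ : IsPisotSubstitution ψ) (z : 𝒞 → ℝ), prV ψ (minpolyEnd ψ z) = 0 := by
    intro 𝒞 _ _ _ ψ hψ z
    rw [prV, dif_pos hψ.isCompl]
    exact (Submodule.projectionOnto_apply_eq_zero_iff hψ.isCompl).2 ⟨z, rfl⟩
  have key' : prV φ (minpolyEnd φ (abelianization ρ *ᵥ z)) = 0 := by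
    rw [prV, dif_pos h.target.isCompl]
    exact (Submodule.projectionOnto_apply_eq_zero_iff h.target.isCompl).2 ⟨_, rfl⟩
  have h1 := h.source.prV_coe ⟨y, hy⟩
  simp only at h1
  rw [map_add, h1, key h.source, add_zero, Matrix.mulVec_add, ← h.minpolyEnd_mulVec, map_add, key',
    add_zero]
  rfl

lemma abelMap_segVec (b : ℬ) : abelMap φ' φ ρ (segVec φ' b) = wordVec φ (ρ b) := by
  rw [segVec, ← h.prV_mulVec, abelianization_mulVec_single, map_list_sum, List.map_map]
  rfl

lemma abelMap_wordVec (u : List ℬ) :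
    abelMap φ' φ ρ (wordVec φ' u) = wordVec φ (extendWord ρ u) := by
  induction u with
  | nil => simp
  | cons a u ih => rw [wordVec_cons, map_add, ih, h.abelMap_segVec, extendWord_cons, wordVec_append]

lemma abelMap_comm (y : pisotSpace φ') :
    abelianV φ (abelMap φ' φ ρ y) = abelMap φ' φ ρ (abelianV φ' y) := by
  apply Subtype.ext
  rw [h.abelMap_coe]
  change abelianization φ *ᵥ (abelMap φ' φ ρ y : 𝒜 → ℝ) =
    abelianization ρ *ᵥ (abelianization φ' *ᵥ (y : ℬ → ℝ))
  rw [h.abelMap_coe, Matrix.mulVec_mulVec, Matrix.mulVec_mulVec, h.abelianization_comm]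

lemma exists_abelMap_pfVector : ∃ c : ℝ, abelMap φ' φ ρ (pfVector φ') = c • pfVector φ := by
  have h1 : (abelQ φ).toReal *ᵥ (abelMap φ' φ ρ (pfVector φ') : 𝒜 → ℝ) =
      pfEigenvalue φ • (abelMap φ' φ ρ (pfVector φ') : 𝒜 → ℝ) := by
    rw [toReal_abelQ]
    refine (congrArg Subtype.val (h.abelMap_comm (pfVector φ'))).trans ?_
    rw [h.source.abelianV_pfVector, map_smul, h.pfEigenvalue_eq]; rfl
  obtain ⟨c, hc⟩ := h.target.isSimpleEigen.simple _ h1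
  exact ⟨c, Subtype.ext hc⟩

lemma abelMap_injective : Function.Injective (abelMap φ' φ ρ) := by
  rw [injective_iff_map_eq_zero]
  intro y hy
  have hleft : ((leftVector φ) ᵥ* (abelQ ρ).toReal) ᵥ* (abelQ φ').toReal =
      pfEigenvalue φ' • ((leftVector φ) ᵥ* (abelQ ρ).toReal) := by
    rw [toReal_abelQ, toReal_abelQ, Matrix.vecMul_vecMul, ← h.abelianization_comm,
      ← Matrix.vecMul_vecMul, h.target.leftVector_spec.2, Matrix.smul_vecMul, h.pfEigenvalue_eq]
  have hs : IsSimpleEigen (abelQ φ') (pfEigenvalue φ') (pfVector φ')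
      ((leftVector φ) ᵥ* (abelQ ρ).toReal) :=
    { h.source.isSimpleEigen with
      left := hleft
      ne_zero := by
        rw [toReal_abelQ]
        exact (Finset.sum_pos (fun i _ => mul_pos (h.leftVector_vecMul_pos i)
          (h.source.pfVector_perron.1 i)) Finset.univ_nonempty).ne' }
  refine Subtype.ext (hs.eq_zero_of_mulVec_eq_zero (abelQ ρ) rfl (mem_pisotSpace_iff.1 y.2) ?_)
  rw [toReal_abelQ, ← h.abelMap_coe, hy]; rfl

/-- Injectivity bounds one dimension by the other. For the reverse inequality the same rationality
argument shows that the transpose of `P` is injective from `ker μ(Aᵀ)` to `ker μ(A'ᵀ)`, and a matrix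
and its transpose have kernels of equal dimension. -/
lemma abelMap_bijective : Function.Bijective (abelMap φ' φ ρ) := by
  have hfin : Module.finrank ℝ (pisotSpace φ') = Module.finrank ℝ (pisotSpace φ) := by
    apply le_antisymm (LinearMap.finrank_le_finrank_of_injective h.abelMap_injective)
    set M := (aeval (abelQ φ) (minpoly ℚ (pfEigenvalue φ))).toReal with hM
    set M' := (aeval (abelQ φ') (minpoly ℚ (pfEigenvalue φ'))).toReal with hM'
    rw [pisotSpace, pisotSpace, minpolyEnd_eq, minpolyEnd_eq, ← hM, ← hM',
      ← Matrix.finrank_ker_transpose, ← Matrix.finrank_ker_transpose M']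
    have hcomm : (abelianization ρ)ᵀ * Mᵀ = M'ᵀ * (abelianization ρ)ᵀ := by
      rw [← Matrix.transpose_mul, ← Matrix.transpose_mul, hM, hM', ← toReal_abelQ,
        ← Matrix.toReal_mul, ← Matrix.toReal_mul, Matrix.aeval_mul_comm h.abelQ_comm,
        h.pfEigenvalue_eq]
    have hmem : ∀ z ∈ LinearMap.ker (Matrix.toLin' Mᵀ), Matrix.toLin' (abelianization ρ)ᵀ z ∈
        LinearMap.ker (Matrix.toLin' M'ᵀ) := by
      intro z hz
      rw [LinearMap.mem_ker, Matrix.toLin'_apply] at hz ⊢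
      rw [Matrix.toLin'_apply, Matrix.mulVec_mulVec, ← hcomm, ← Matrix.mulVec_mulVec, hz,
        Matrix.mulVec_zero]
    refine LinearMap.finrank_le_finrank_of_injective
      (f := (Matrix.toLin' (abelianization ρ)ᵀ).restrict hmem) ?_
    rw [injective_iff_map_eq_zero]
    intro z hz
    have hz1 : (abelianization ρ)ᵀ *ᵥ (z : 𝒜 → ℝ) = 0 := congrArg Subtype.val hz
    have hz2 : Mᵀ *ᵥ (z : 𝒜 → ℝ) = 0 := z.2
    have hright : (abelQ φ).toReal *ᵥ ((abelQ ρ).toReal *ᵥ (pfVector φ' : ℬ → ℝ)) =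
        pfEigenvalue φ • ((abelQ ρ).toReal *ᵥ (pfVector φ' : ℬ → ℝ)) := by
      rw [toReal_abelQ, toReal_abelQ, Matrix.mulVec_mulVec, h.abelianization_comm,
        ← Matrix.mulVec_mulVec, h.source.pfVector_perron.2, Matrix.mulVec_smul, h.pfEigenvalue_eq]
    have hs : IsSimpleEigen (abelQ φ)ᵀ (pfEigenvalue φ) (leftVector φ)
        ((pfVector φ' : ℬ → ℝ) ᵥ* (abelQ ρ)ᵀ.toReal) :=
      { h.target.isSimpleEigen_transpose with
        left := by
          have h1 : (abelQ ρ)ᵀ.toReal = (abelQ ρ).toRealᵀ := rfl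
          have h2 : (abelQ φ)ᵀ.toReal = (abelQ φ).toRealᵀ := rfl
          rw [h1, h2, Matrix.vecMul_transpose, Matrix.vecMul_transpose, hright]
        ne_zero := by
          have h1 : (abelQ ρ)ᵀ.toReal = (abelQ ρ).toRealᵀ := rfl
          rw [h1, Matrix.vecMul_transpose, dotProduct_comm, Matrix.dotProduct_mulVec, toReal_abelQ]
          exact (Finset.sum_pos (fun i _ => mul_pos (h.leftVector_vecMul_pos i)
            (h.source.pfVector_perron.1 i)) Finset.univ_nonempty).ne' }
    refine Subtype.ext (hs.eq_zero_of_mulVec_eq_zero (abelQ ρ)ᵀ rfl ?_ ?_)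
    · have h3 : aeval (abelQ φ)ᵀ (minpoly ℚ (pfEigenvalue φ)) =
          (aeval (abelQ φ) (minpoly ℚ (pfEigenvalue φ)))ᵀ := Matrix.aeval_transpose _ _
      rw [h3]
      exact hz2
    · have h1 : (abelQ ρ)ᵀ.toReal = (abelQ ρ).toRealᵀ := rfl
      rw [h1, toReal_abelQ]; exact hz1
  exact ⟨h.abelMap_injective,
    (LinearMap.injective_iff_surjective_of_finrank_eq_finrank hfin).1 h.abelMap_injective⟩

/-- The image of a path: its vertices over the cutting points are the images of the vertices. -/
lemma edgeMap_pathEdges {z : ℤ → ℬ} {x : ℤ → pisotSpace φ'} (hx : IsPath φ' z x) {c : ℤ → ℤ}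
    {y : ℤ → 𝒜} (hc : IsImage ρ z c y) {X : ℤ → pisotSpace φ} (hX : IsPath φ y X) {k₀ : ℤ}
    (h0 : X (c k₀) = abelMap φ' φ ρ (x k₀)) :
    (∀ k, X (c k) = abelMap φ' φ ρ (x k)) ∧
      edgeMap φ' φ ρ (pathEdges z x) = pathEdges y X := by
  have hcut : ∀ k, X (c k) = abelMap φ' φ ρ (x k) := by
    have h1 := eq_add_of_step_eq (F := fun k => abelMap φ' φ ρ (x k)) (F' := fun k => X (c k))
      fun k => by
        rw [hX.sum_block (hc.monotone (show k ≤ k + 1 by omega)), hc.block_eq, hx k, map_add,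
          h.abelMap_segVec]
        abel
    have h2 := h1 k₀
    beta_reduce at h1 h2
    rw [h0, left_eq_add] at h2
    intro k
    rw [h1 k, h2, add_zero]
  have hoff : ∀ (k : ℤ) (p s : List 𝒜) (a : 𝒜), ρ (z k) = p ++ a :: s →
      y (c k + p.length) = a ∧ X (c k + p.length) = abelMap φ' φ ρ (x k) + wordVec φ p := by
    intro k p s a hps
    have hlen : p.length < (ρ (z k)).length := by rw [hps]; simp
    constructor
    · rw [hc.getElem k p.length hlen]
      simp [hps]
    · rw [hX.sum_block (show c k ≤ c k + p.length by omega), hcut]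
      congr 2
      rw [block_eq_iff (by omega)]
      refine ⟨rfl, fun m hm => ?_⟩
      rw [hc.getElem k m (by omega)]
      simp only [hps]
      rw [List.getElem_append_left hm]
  refine ⟨hcut, ?_⟩
  ext e
  rw [mem_pathEdges]
  constructor
  · rintro ⟨f, hf, p, s, hps, he⟩
    obtain ⟨k, hk1, hk2⟩ := mem_pathEdges.1 hf
    rw [← hk1] at hps
    obtain ⟨h1, h2⟩ := hoff k p s e.1 hps
    refine ⟨c k + p.length, h1, h2.trans (Subtype.ext ?_)⟩
    rw [he, ← hk2, Submodule.coe_add, h.abelMap_coe]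
    rfl
  · rintro ⟨n, hn1, hn2⟩
    obtain ⟨k, hk1, hk2⟩ := (hc.strictMono h.ne_nil).exists_int_floor n
    rw [hc.step] at hk2
    have hm : (n - c k).toNat < (ρ (z k)).length := by omega
    have hsplit : ρ (z k) = (ρ (z k)).take (n - c k).toNat ++
        e.1 :: (ρ (z k)).drop ((n - c k).toNat + 1) := by
      have h1 := hc.getElem k (n - c k).toNat hm
      rw [show c k + ((n - c k).toNat : ℤ) = n by omega, hn1] at h1
      rw [h1, List.getElem_cons_drop, List.take_append_drop]
    obtain ⟨-, h2⟩ := hoff k _ _ _ hsplit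
    rw [List.length_take, min_eq_left hm.le, show c k + ((n - c k).toNat : ℤ) = n by omega,
      hn2] at h2
    refine ⟨(z k, x k), mem_pathEdges.2 ⟨k, rfl, rfl⟩, _, _, hsplit, ?_⟩
    rw [h2, Submodule.coe_add, h.abelMap_coe]
    rfl

/-- Each path has an image path. -/
lemma exists_image_path {z : ℤ → ℬ} {x : ℤ → pisotSpace φ'} (hx : IsPath φ' z x) :
    ∃ c y X, IsImage ρ z c y ∧ IsPath φ y X ∧ (∀ k, X (c k) = abelMap φ' φ ρ (x k)) ∧
      edgeMap φ' φ ρ (pathEdges z x) = pathEdges y X := by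
  obtain ⟨c, y, hc0, hc⟩ := IsImage.exists_image h.ne_nil z 0
  obtain ⟨X, hX0, hX⟩ := exists_isPath φ y (c 0) (abelMap φ' φ ρ (x 0))
  obtain ⟨h1, h2⟩ := h.edgeMap_pathEdges hx hc hX hX0
  exact ⟨c, y, X, hc, hX, h1, h2⟩

end

variable [Nonempty 𝒜] [Nonempty ℬ]

/-- The map of strands induced by a morphism. -/
def strandMap (γ : Strand φ') : Strand φ :=
  ⟨edgeMap φ' φ ρ γ.edges, by
    obtain ⟨z, x, hx, he⟩ := γ.exists_path
    obtain ⟨c, y, X, -, hX, -, h2⟩ := h.exists_image_path hx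
    exact ⟨y, X, hX, by rw [he, h2]; rfl⟩⟩

lemma edges_strandMap (γ : Strand φ') : (h.strandMap γ).edges = edgeMap φ' φ ρ γ.edges := rfl

end IsPisotMorphism

end Paths

/-! ### The topology on strands -/

section StrandTopology

open Filter Topology

variable {𝒜 ℬ : Type*} [Fintype 𝒜] [DecidableEq 𝒜] [Fintype ℬ] [DecidableEq ℬ]

namespace IsPath

variable {φ : 𝒜 → List 𝒜} {w w' : ℤ → 𝒜} {x x' : ℤ → pisotSpace φ}

lemma sub_const_of_agree (h : IsPath φ w x) (h' : IsPath φ w' x') {a b j : ℤ}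
    (hw : ∀ k, a ≤ k → k < b → w' (k + j) = w k) {k : ℤ} (hak : a ≤ k) (hkb : k ≤ b) :
    x' (k + j) - x k = x' (a + j) - x a := by
  induction k, hak using Int.leInduction with
  | base => rfl
  | succ k hak ih =>
    rw [← ih (by omega), add_right_comm, h, h', hw k hak (by omega)]
    abel

lemma eq_add_of_agree (h : IsPath φ w x) (h' : IsPath φ w' x') {a b j : ℤ} {v : pisotSpace φ}
    (hw : ∀ k, a ≤ k → k < b → w' (k + j) = w k) {k₀ : ℤ} (hk₀ : a ≤ k₀) (hk₀' : k₀ ≤ b)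
    (hx : x' (k₀ + j) = x k₀ + v) {k : ℤ} (hak : a ≤ k) (hkb : k ≤ b) :
    x' (k + j) = x k + v := by
  have h1 := h.sub_const_of_agree h' hw hak hkb
  rw [← h.sub_const_of_agree h' hw hk₀ hk₀', hx, add_sub_cancel_left] at h1
  rw [← h1, add_sub_cancel]

end IsPath

namespace Strand

variable {φ : 𝒜 → List 𝒜}

lemma Close.refl {ε : ℝ} (hε : 0 < ε) (γ : Strand φ) : Close ε γ γ :=
  ⟨0, by simpa, fun e _ => by rw [edges_translate, sub_zero]⟩

/-- The radius `η = δ / (2 + δ²)` is tuned so that two translations shorter than `η` add up to at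
most `δ`, and a point of the ball of radius `1/δ` moved by less than `η` stays in the ball of radius
`1/η = 2/δ + δ`. -/
lemma close_radius {δ : ℝ} (hδ : 0 < δ) : 0 < δ / (2 + δ ^ 2) ∧
    δ / (2 + δ ^ 2) + δ / (2 + δ ^ 2) ≤ δ ∧
    δ⁻¹ + δ / (2 + δ ^ 2) ≤ (δ / (2 + δ ^ 2))⁻¹ := by
  have h1 : δ / (2 + δ ^ 2) ≤ δ / 2 := by gcongr; nlinarith
  refine ⟨by positivity, by linarith, ?_⟩
  rw [inv_div]
  have h2 : (2 + δ ^ 2) / δ = 2 * δ⁻¹ + δ := by field_simp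
  have := inv_pos.2 hδ
  linarith

lemma Close.trans {δ : ℝ} (hδ : 0 < δ) {γ γ' γ'' : Strand φ}
    (h : Close (δ / (2 + δ ^ 2)) γ γ') (h' : Close (δ / (2 + δ ^ 2)) γ' γ'') : Close δ γ γ'' := by
  obtain ⟨h0, h2, h3⟩ := close_radius hδ
  set η := δ / (2 + δ ^ 2)
  obtain ⟨v, hv, he⟩ := h
  obtain ⟨v', hv', he'⟩ := h'
  refine ⟨v + v', (norm_add_le _ _).trans_lt (by linarith), fun e h => ?_⟩
  rw [← he' e (by linarith), edges_translate, edges_translate, ← he, edges_translate]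
  · simp [sub_sub, add_comm]
  · have := norm_sub_le e.2 v'
    simp only
    linarith

lemma Close.symm {δ : ℝ} (hδ : 0 < δ) {γ γ' : Strand φ}
    (h : Close (δ / (2 + δ ^ 2)) γ γ') : Close δ γ' γ := by
  obtain ⟨h0, h2, h3⟩ := close_radius hδ
  set η := δ / (2 + δ ^ 2)
  obtain ⟨v, hv, he⟩ := h
  refine ⟨-v, by rw [norm_neg]; linarith, fun e h => ?_⟩
  rw [edges_translate, ← he, edges_translate]
  · simp
  · have := norm_sub_le e.2 (-v)
    rw [norm_neg] at this
    simp only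
    linarith

lemma mem_nhds_iff_close {γ : Strand φ} {U : Set (Strand φ)} :
    U ∈ 𝓝 γ ↔ ∃ ε : ℝ, 0 < ε ∧ ∀ γ', Close ε γ γ' → γ' ∈ U := by
  constructor
  · intro h
    obtain ⟨O, hO, hopen, hγ⟩ := mem_nhds_iff.1 h
    obtain ⟨ε, hε, h⟩ := hopen γ hγ
    exact ⟨ε, hε, fun γ' h' => hO (h γ' h')⟩
  · rintro ⟨ε, hε, h⟩
    refine mem_nhds_iff.2 ⟨{γ' | ∃ δ : ℝ, 0 < δ ∧ ∀ γ'', Close δ γ' γ'' → γ'' ∈ U},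
      fun γ' ⟨δ, hδ, h⟩ => h γ' (Close.refl hδ γ'), ?_, ⟨ε, hε, h⟩⟩
    rintro γ' ⟨δ, hδ, h⟩
    have h0 := (close_radius hδ).1
    exact ⟨_, h0, fun γ₁ h1 => ⟨_, h0, fun γ₂ h2 => h γ₂ (Close.trans hδ h1 h2)⟩⟩

lemma tendsto_iff_close {ι : Type*} {l : Filter ι} {f : ι → Strand φ} {γ : Strand φ} :
    Tendsto f l (𝓝 γ) ↔ ∀ ε : ℝ, 0 < ε → ∀ᶠ i in l, Close ε γ (f i) := by
  constructor
  · intro h ε hε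
    exact h (mem_nhds_iff_close.2 ⟨ε, hε, fun _ h => h⟩)
  · intro h U hU
    obtain ⟨ε, hε, hU⟩ := mem_nhds_iff_close.1 hU
    exact (h ε hε).mono fun i hi => hU _ hi

end Strand

namespace IsPisotSubstitution

variable {φ : 𝒜 → List 𝒜} [Nonempty 𝒜] (hφ : IsPisotSubstitution φ)

lemma exists_abs_height_le (φ : 𝒜 → List 𝒜) :
    ∃ H : ℝ, 0 < H ∧ ∀ y, |height φ y| ≤ H * ‖y‖ := by
  obtain ⟨H, hH, h⟩ := (LinearMap.toContinuousLinearMap (height φ)).bound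
  exact ⟨H, hH, h⟩

include hφ

/-- Close strands have the same edges near the origin, up to a small translation. -/
lemma exists_copy {w w' : ℤ → 𝒜} {x x' : ℤ → pisotSpace φ} (h : IsPath φ w x)
    (h' : IsPath φ w' x') {γ γ' : Strand φ} (hγ : γ.edges = pathEdges w x)
    (hγ' : γ'.edges = pathEdges w' x') {ε : ℝ} (hc : Strand.Close ε γ γ') {a b : ℤ} (hab : a < b)
    (hb : ∀ k, a ≤ k → k < b → ‖x k‖ + ε < ε⁻¹) :
    ∃ v j, ‖v‖ < ε ∧ ∀ k, a ≤ k → k < b → w' (k + j) = w k ∧ x' (k + j) = x k + v := by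
  obtain ⟨v, hv, he⟩ := hc
  have hmem : ∀ k, a ≤ k → k < b → ∃ l, w' l = w k ∧ x' l = x k + v := by
    intro k hak hkb
    have h1 := hb k hak hkb
    have h2 := he (w k, x k + v) ((norm_add_le _ _).trans_lt (by linarith))
    rw [Strand.edges_translate, hγ, hγ', mem_pathEdges, mem_pathEdges] at h2
    exact h2.1 ⟨k, rfl, by simp⟩
  obtain ⟨l, hl1, hl2⟩ := hmem a le_rfl hab
  refine ⟨v, l - a, hv, fun k hak => ?_⟩
  induction k, hak using Int.leInduction with
  | base => intro; simpa using ⟨hl1, hl2⟩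
  | succ k hak ih =>
    intro hkb
    obtain ⟨h1, h2⟩ := ih (by omega)
    have h3 : x' (k + 1 + (l - a)) = x (k + 1) + v := by
      rw [add_right_comm, h', h1, h2, h]; abel
    obtain ⟨l', h4, h5⟩ := hmem (k + 1) (by omega) hkb
    rw [← h3] at h5
    exact ⟨by rw [← hφ.vertex_injective h' h5, h4], h3⟩

/-- Two strands with the same word over a large window are close. -/
lemma close_of_agree {w w' : ℤ → 𝒜} {x x' : ℤ → pisotSpace φ} (h : IsPath φ w x)
    (h' : IsPath φ w' x') {γ γ' : Strand φ} (hγ : γ.edges = pathEdges w x)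
    (hγ' : γ'.edges = pathEdges w' x') {ε : ℝ} {a b j : ℤ} {v : pisotSpace φ} (hv : ‖v‖ < ε)
    (hw : ∀ k, a ≤ k → k < b → w' (k + j) = w k) {k₀ : ℤ} (hk₀ : a ≤ k₀) (hk₀' : k₀ ≤ b)
    (hx : x' (k₀ + j) = x k₀ + v)
    (hh : ∀ y : pisotSpace φ, ‖y‖ < ε⁻¹ → height φ (x a) + height φ v ≤ height φ y ∧
      height φ y < height φ (x b) + height φ v) : Strand.Close ε γ γ' := by
  have hagree := fun {k} => h.eq_add_of_agree h' hw hk₀ hk₀' hx (k := k)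
  have hmono := hφ.height_strictMono h
  have hmono' := hφ.height_strictMono h'
  refine ⟨v, hv, fun e he => ?_⟩
  obtain ⟨hy1, hy2⟩ := hh e.2 he
  rw [Strand.edges_translate, hγ, hγ', mem_pathEdges, mem_pathEdges]
  constructor
  · rintro ⟨k, hk1, hk2⟩
    simp only at hk1 hk2
    have h3 : height φ (x k) = height φ e.2 - height φ v := by rw [hk2, map_sub]
    have h4 : a ≤ k := hmono.le_iff_le.1 (by linarith)
    have h5 : k < b := hmono.lt_iff_lt.1 (by linarith)
    exact ⟨k + j, by rw [hw k h4 h5, hk1], by rw [hagree h4 h5.le, hk2, sub_add_cancel]⟩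
  · rintro ⟨k, hk1, hk2⟩
    have h3 : height φ (x' (a + j)) = height φ (x a) + height φ v := by
      rw [hagree le_rfl (hk₀.trans hk₀'), map_add]
    have h4 : height φ (x' (b + j)) = height φ (x b) + height φ v := by
      rw [hagree (hk₀.trans hk₀') le_rfl, map_add]
    have h5 : a + j ≤ k := hmono'.le_iff_le.1 (by rw [hk2]; linarith)
    have h6 : k < b + j := hmono'.lt_iff_lt.1 (by rw [hk2]; linarith)
    refine ⟨k - j, ?_, ?_⟩
    · have := hw (k - j) (by omega) (by omega)
      rw [← this, sub_add_cancel, hk1]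
    · have := hagree (k := k - j) (by omega) (by omega)
      rw [sub_add_cancel, hk2] at this
      simp only
      rw [this, add_sub_cancel_right]

/-- Two limits of one ultrafilter are close at every scale, so each edge of one is an arbitrarily
small translate of an edge of the other. Heights of vertices of a strand are spaced by at least `d`,
hence the small translation is unique and must be zero. -/
lemma t2Space : T2Space (Strand φ) := by
  rw [t2_iff_ultrafilter]
  intro γ γ' U hU hU'
  have hclose : ∀ {γ γ' : Strand φ}, ↑U ≤ 𝓝 γ → ↑U ≤ 𝓝 γ' → ∀ δ : ℝ, 0 < δ →
      Strand.Close δ γ γ' := by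
    intro γ γ' hU hU' δ hδ
    have h1 := (Strand.close_radius hδ).1
    have h2 := (Strand.close_radius h1).1
    have h3 := Strand.tendsto_iff_close.1 (tendsto_id'.2 hU) _ h1
    have h4 := Strand.tendsto_iff_close.1 (tendsto_id'.2 hU') _ h2
    obtain ⟨η, h5, h6⟩ := (h3.and h4).exists
    exact Strand.Close.trans hδ h5 (Strand.Close.symm h1 h6)
  have hsub : ∀ {γ γ' : Strand φ}, ↑U ≤ 𝓝 γ → ↑U ≤ 𝓝 γ' → γ.edges ⊆ γ'.edges := by
    intro γ γ' hU hU' e he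
    obtain ⟨w, x, hp, hγ'⟩ := γ'.exists_path
    obtain ⟨d, M, hd, -, hd'⟩ := hφ.exists_height_bounds
    obtain ⟨H, hH, hHb⟩ := exists_abs_height_le φ
    have hex : ∀ ε : ℝ, 0 < ε → ∃ v : pisotSpace φ, ‖v‖ < ε ∧ (e.1, e.2 + v) ∈ γ'.edges := by
      intro ε hε
      have h0 : 0 < ‖e.2‖ + ε + 1 := by positivity
      obtain ⟨v, hv, hve⟩ := hclose hU hU' (min ε (‖e.2‖ + ε + 1)⁻¹) (by positivity)
      refine ⟨v, hv.trans_le (min_le_left _ _), (hve _ ?_).1 ?_⟩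
      · have h1 : ‖e.2‖ + ε + 1 ≤ (min ε (‖e.2‖ + ε + 1)⁻¹)⁻¹ := by
          rw [le_inv_comm₀ h0 (by positivity)]; exact min_le_right _ _
        have h2 := norm_add_le e.2 v
        have h3 := hv.trans_le (min_le_left _ _)
        simp only
        linarith
      · rw [Strand.edges_translate]; simpa using he
    have huniq : ∀ v v' : pisotSpace φ, ‖v‖ < d / (2 * H) → ‖v'‖ < d / (2 * H) →
        (e.1, e.2 + v) ∈ γ'.edges → (e.1, e.2 + v') ∈ γ'.edges → v = v' := by
      intro v v' hv hv' hm hm'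
      rw [hγ'] at hm hm'
      obtain ⟨k, -, hk⟩ := mem_pathEdges.1 hm
      obtain ⟨l, -, hl⟩ := mem_pathEdges.1 hm'
      have h1 : |height φ (x l) - height φ (x k)| < d := by
        rw [hk, hl, ← map_sub, add_sub_add_left_eq_sub]
        refine (hHb _).trans_lt ?_
        have h2 := norm_sub_le v' v
        have h3 : H * ‖v' - v‖ < H * (d / (2 * H) + d / (2 * H)) := by gcongr; linarith
        have h4 : H * (d / (2 * H) + d / (2 * H)) = d := by field_simp; ring
        linarith
      have hkl : k = l := by
        have hge := fun {k l} => hφ.height_sub_ge (fun i => (hd' i).1) hp (k := k) (l := l)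
        rw [abs_lt] at h1
        by_contra hne
        rcases lt_or_gt_of_ne hne with hlt | hlt
        · have h2 := hge hlt.le
          have h3 : (1 : ℝ) ≤ (l - k : ℤ) := by exact_mod_cast (by omega)
          nlinarith
        · have h2 := hge hlt.le
          have h3 : (1 : ℝ) ≤ (k - l : ℤ) := by exact_mod_cast (by omega)
          nlinarith
      subst hkl
      simpa using hk.symm.trans hl
    obtain ⟨v, hv, hv'⟩ := hex (d / (2 * H)) (by positivity)
    suffices hv0 : v = 0 by simpa [hv0] using hv'
    by_contra hv0
    obtain ⟨v₁, h1, h2⟩ := hex (min (d / (2 * H)) ‖v‖)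
      (lt_min (by positivity) (norm_pos_iff.2 hv0))
    have h3 := huniq v v₁ hv (h1.trans_le (min_le_left _ _)) hv' h2
    rw [← h3] at h1
    exact absurd (h1.trans_le (min_le_right _ _)) (lt_irrefl _)
  exact Strand.ext_edges (Set.Subset.antisymm (hsub hU hU') (hsub hU' hU))

end IsPisotSubstitution

/-- The strands whose words have all their blocks in `P` and whose vertices lie within distance `B`
of the expanding line, with respect to the stable seminorm. -/
def boundedStrands {φ : 𝒜 → List 𝒜} (s : StableNorm φ) (P : Set (List 𝒜)) (B : ℝ) :
    Set (Strand φ) :=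
  {γ | ∃ w x, IsPath φ w x ∧ γ.edges = pathEdges w x ∧ (∀ a b, a < b → block w a b ∈ P) ∧
    ∀ k, s.N (x k) ≤ B}

section BoundedStrands

variable {φ : 𝒜 → List 𝒜} (s : StableNorm φ) {P : Set (List 𝒜)} {B : ℝ}

lemma boundedStrands_mono {P' : Set (List 𝒜)} {B' : ℝ} (hP : P ⊆ P') (hB : B ≤ B') :
    boundedStrands s P B ⊆ boundedStrands s P' B' := by
  rintro γ ⟨w, x, h1, h2, h3, h4⟩
  exact ⟨w, x, h1, h2, fun a b h => hP (h3 a b h), fun k => (h4 k).trans hB⟩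

variable [Nonempty 𝒜] (hφ : IsPisotSubstitution φ)
include hφ

variable {s} in
lemma mem_boundedStrands_iff {w : ℤ → 𝒜} {x : ℤ → pisotSpace φ} (h : IsPath φ w x) {γ : Strand φ}
    (hγ : γ.edges = pathEdges w x) : γ ∈ boundedStrands s P B ↔
      (∀ a b, a < b → block w a b ∈ P) ∧ ∀ k, s.N (x k) ≤ B := by
  constructor
  · rintro ⟨w', x', h', hγ', hP, hB⟩
    obtain ⟨j, hj⟩ := hφ.path_unique h' h (hγ'.symm.trans hγ)
    obtain rfl : w = fun k => w' (k + j) := funext fun k => (hj k).1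
    refine ⟨fun a b hab => ?_, fun k => ?_⟩
    · rw [block_shift]; exact hP _ _ (by omega)
    · rw [(hj k).2]; exact hB _
  · rintro ⟨hP, hB⟩
    exact ⟨w, x, h, hγ, hP, hB⟩

/-- Along an ultrafilter each letter is eventually constant, and the vertex of edge `0` stays in a
bounded set: its height is controlled by the normalization and its transversal part by `B`. These
limits determine a limit strand. -/
lemma isCompact_boundedStrands : IsCompact (boundedStrands s P B) := by
  rw [isCompact_iff_ultrafilter_le_nhds]
  intro U hU
  rw [le_principal_iff] at hU
  choose w x hp he h0 h1 using hφ.exists_normalized_path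
  obtain ⟨δ, M, hδ, hM, hb⟩ := hφ.exists_height_bounds
  obtain ⟨H, hH, hHb⟩ := IsPisotSubstitution.exists_abs_height_le φ
  have hK : ∀ γ ∈ boundedStrands s P B,
      (∀ a b, a < b → block (w γ) a b ∈ P) ∧ ∀ k, s.N (x γ k) ≤ B :=
    fun γ hγ => (mem_boundedStrands_iff hφ (hp γ) (he γ)).1 hγ
  choose w₀ hw₀ using fun k => U.exists_eventually_eq fun γ => w γ k
  obtain ⟨v₀, -, hv₀⟩ := (isCompact_closedBall (0 : pisotSpace φ)
    (s.C * (M + B))).ultrafilter_le_nhds (U.map fun γ => x γ 0) (by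
      rw [le_principal_iff, Ultrafilter.coe_map, mem_map]
      refine Filter.mem_of_superset hU fun γ hγ => ?_
      simp only [Set.mem_preimage, mem_closedBall_zero_iff]
      refine (s.norm_le _).trans (mul_le_mul_of_nonneg_left (add_le_add ?_ ((hK γ hγ).2 0))
        s.C_pos.le)
      have h2 := h1 γ
      rw [show (1 : ℤ) = 0 + 1 from rfl, hp γ, map_add] at h2
      rw [abs_of_nonpos (h0 γ)]
      linarith [(hb (w γ 0)).2])
  have hx₀ : Tendsto (fun γ => x γ 0) U (𝓝 v₀) := hv₀
  obtain ⟨x₀, hx₀0, hp₀⟩ := exists_isPath φ w₀ 0 v₀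
  have hagree : ∀ a b, ∀ᶠ γ in U, ∀ k, a ≤ k → k < b → w γ k = w₀ k := by
    intro a b
    filter_upwards [(eventually_all_finite (Set.finite_Ico a b)).2 fun k _ => hw₀ k] with γ hγ k h1
      h2 using hγ k ⟨h1, h2⟩
  have hxk : ∀ k, ∀ᶠ γ in U, x γ k = x₀ k + (x γ 0 - v₀) := by
    intro k
    filter_upwards [hagree (min 0 k) (max 0 k)] with γ hγ
    have := hp₀.eq_add_of_agree (hp γ) (j := 0) (v := x γ 0 - v₀) (by simpa using hγ)
      (min_le_left 0 k) (le_max_left 0 k) (by simp [hx₀0]) (min_le_right 0 k) (le_max_right 0 k)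
    simpa using this
  refine ⟨hp₀.strand, ⟨w₀, x₀, hp₀, rfl, fun a b hab => ?_, fun k => ?_⟩, ?_⟩
  · obtain ⟨γ, hγ, h2⟩ := ((eventually_block_eq hw₀ a b).and hU).exists
    rw [← hγ]
    exact (hK γ h2).1 a b hab
  · have hlim : Tendsto (fun γ => B + s.C * ‖x γ 0 - v₀‖) U (𝓝 (B + s.C * ‖v₀ - v₀‖)) :=
      tendsto_const_nhds.add (tendsto_const_nhds.mul (hx₀.sub_const _).norm)
    rw [sub_self, norm_zero, mul_zero, add_zero] at hlim
    refine ge_of_tendsto hlim ?_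
    filter_upwards [hxk k, hU] with γ h2 h3
    have h4 := map_sub_le_add s.N (x γ k) (x γ 0 - v₀)
    rw [h2, add_sub_cancel_right, ← h2] at h4
    linarith [(hK γ h3).2 k, s.le (x γ 0 - v₀)]
  · refine tendsto_id'.1 (Strand.tendsto_iff_close.2 fun ε hε => ?_)
    obtain ⟨n, hn⟩ := exists_nat_gt ((|height φ v₀| + H * ε⁻¹ + H * ε) / δ)
    rw [div_lt_iff₀ hδ] at hn
    have hlow := hφ.height_sub_ge (fun i => (hb i).1) hp₀ (show -(n : ℤ) ≤ 0 by omega)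
    have hupp := hφ.height_sub_ge (fun i => (hb i).1) hp₀ (show (0 : ℤ) ≤ n by omega)
    rw [hx₀0] at hlow hupp
    push_cast at hlow hupp
    filter_upwards [hagree (-n) n, Metric.tendsto_nhds.1 hx₀ ε hε] with γ h2 h3
    rw [dist_eq_norm] at h3
    refine hφ.close_of_agree hp₀ (hp γ) rfl (he γ) (j := 0) h3 (by simpa using h2)
      (show -(n : ℤ) ≤ 0 by omega) (show (0 : ℤ) ≤ n by omega) (by simp [hx₀0]) fun y hy => ?_
    have h4 := (hHb y).trans (mul_le_mul_of_nonneg_left hy.le hH.le)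
    have h5 := (hHb _).trans (mul_le_mul_of_nonneg_left h3.le hH.le)
    rw [abs_le] at h4 h5
    have h6 := neg_abs_le (height φ v₀)
    have h7 := le_abs_self (height φ v₀)
    constructor <;> linarith

end BoundedStrands

namespace IsPisotMorphism

variable {φ' : ℬ → List ℬ} {φ : 𝒜 → List 𝒜} {ρ : ℬ → List 𝒜} (h : IsPisotMorphism φ' φ ρ)
  [Nonempty 𝒜] [Nonempty ℬ]

include h in
lemma mem_edgeMap_iff {E : Set (Edge φ')} {e : Edge φ} : e ∈ edgeMap φ' φ ρ E ↔
    ∃ f ∈ E, ∃ p s, ρ f.1 = p ++ e.1 :: s ∧ e.2 = abelMap φ' φ ρ f.2 + wordVec φ p := by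
  simp only [edgeMap, Set.mem_ofPred_eq, Subtype.ext_iff, Submodule.coe_add, h.abelMap_coe]
  rfl

lemma strandMap_translate (γ : Strand φ') (v : pisotSpace φ') :
    h.strandMap (γ.translate v) = (h.strandMap γ).translate (abelMap φ' φ ρ v) := by
  apply Strand.ext_edges
  ext e
  rw [Strand.edges_translate, edges_strandMap, edges_strandMap, h.mem_edgeMap_iff,
    h.mem_edgeMap_iff]
  constructor
  · rintro ⟨f, hf, p, s, h1, h2⟩
    rw [Strand.edges_translate] at hf
    exact ⟨_, hf, p, s, h1, by simp only [h2, map_sub]; abel⟩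
  · rintro ⟨f, hf, p, s, h1, h2⟩
    refine ⟨(f.1, f.2 + v), by rw [Strand.edges_translate]; simpa using hf, p, s, h1, ?_⟩
    simp only [map_add, sub_eq_iff_eq_add] at h2 ⊢
    rw [h2]; abel

lemma continuous_strandMap : Continuous h.strandMap := by
  rw [continuous_iff_continuousAt]
  intro γ
  refine Strand.tendsto_iff_close.2 fun ε hε => ?_
  obtain ⟨K, hK, hKb⟩ := (LinearMap.toContinuousLinearMap (abelMap φ' φ ρ)).bound
  obtain ⟨K', hK', hKb'⟩ := (LinearMap.toContinuousLinearMap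
    (LinearEquiv.ofBijective _ h.abelMap_bijective).symm.toLinearMap).bound
  have hKb' : ∀ y, ‖y‖ ≤ K' * ‖abelMap φ' φ ρ y‖ := fun y => by
    have := hKb' (abelMap φ' φ ρ y)
    rwa [show (LinearMap.toContinuousLinearMap
      (LinearEquiv.ofBijective _ h.abelMap_bijective).symm.toLinearMap) (abelMap φ' φ ρ y) = y from
      (LinearEquiv.ofBijective _ h.abelMap_bijective).symm_apply_apply y] at this
  obtain ⟨D, hD⟩ : ∃ D : ℝ, ∀ b p s, ρ b = p ++ s → ‖wordVec φ p‖ ≤ D := by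
    have hfin : (⋃ b, {p | p <+: ρ b}).Finite := Set.finite_iUnion fun b =>
      (ρ b).inits.toFinset.finite_toSet.subset fun p hp => by simpa using hp
    obtain ⟨D, hD⟩ := (hfin.image fun p => ‖wordVec φ p‖).bddAbove
    exact ⟨D, fun b p s hb => hD ⟨p, Set.mem_iUnion.2 ⟨b, s, hb.symm⟩, rfl⟩⟩
  have hD0 : 0 ≤ D := (norm_nonneg _).trans (hD (Classical.arbitrary ℬ) [] _ rfl)
  -- An edge of the image within `1/ε` of the origin comes from an edge whose initial vertex has
  -- norm less than `R`, because `P` is boundedly invertible and prefixes of the words `ρ b` have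
  -- vectors of norm at most `D`.
  set R := K' * (ε⁻¹ + D) with hR
  have hR0 : 0 < R := by positivity
  have hε' : 0 < min (ε / K) R⁻¹ := by positivity
  filter_upwards [Strand.tendsto_iff_close.1 tendsto_id _ hε'] with η hη
  obtain ⟨v, hv, he⟩ := hη
  refine ⟨abelMap φ' φ ρ v, ?_, fun e hed => ?_⟩
  · refine (hKb v).trans_lt ?_
    have := hv.trans_le (min_le_left _ _)
    rw [lt_div_iff₀ hK] at this
    linarith
  · rw [← strandMap_translate, edges_strandMap, edges_strandMap, h.mem_edgeMap_iff,
      h.mem_edgeMap_iff]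
    have key : ∀ f : Edge φ', ∀ p s, ρ f.1 = p ++ e.1 :: s →
        e.2 = abelMap φ' φ ρ f.2 + wordVec φ p → (f ∈ (γ.translate v).edges ↔ f ∈ η.edges) := by
      intro f p s h1 h2
      refine he f ?_
      have h3 : R ≤ (min (ε / K) R⁻¹)⁻¹ := by
        rw [le_inv_comm₀ hR0 hε']; exact min_le_right _ _
      refine lt_of_lt_of_le ((hKb' f.2).trans_lt ?_) h3
      rw [hR]
      refine mul_lt_mul_of_pos_left ?_ hK'
      rw [← sub_eq_iff_eq_add] at h2
      rw [← h2]
      exact (norm_sub_le _ _).trans_lt (add_lt_add_of_lt_of_le hed (hD _ _ _ h1))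
    exact ⟨fun ⟨f, hf, p, s, h1, h2⟩ => ⟨f, (key f p s h1 h2).1 hf, p, s, h1, h2⟩,
      fun ⟨f, hf, p, s, h1, h2⟩ => ⟨f, (key f p s h1 h2).2 hf, p, s, h1, h2⟩⟩

end IsPisotMorphism

end StrandTopology

/-! ### Inflation and substitution -/

section Inflation

open Filter Topology

variable {𝒜 ℬ 𝒞 : Type*} [Fintype 𝒜] [DecidableEq 𝒜] [Fintype ℬ] [DecidableEq ℬ]
  [Fintype 𝒞] [DecidableEq 𝒞]

lemma eq_of_block_eq {α : Type*} {x y : ℤ → α} {a b a' b' : ℤ} (hab : a ≤ b) (hab' : a' ≤ b')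
    (h : block y a' b' = block x a b) {k : ℤ} (hak : a ≤ k) (hkb : k < b) :
    y (k + (a' - a)) = x k := by
  have h1 := (block_eq_iff hab').1 h
  have h2 : (k - a).toNat < (block x a b).length := by rw [length_block]; omega
  have h3 := h1.2 _ h2
  rw [block_getElem] at h3
  rwa [show a' + ((k - a).toNat : ℤ) = k + (a' - a) by omega,
    show a + ((k - a).toNat : ℤ) = k by omega] at h3

lemma StableNorm.exists_wordVec_le {φ : 𝒜 → List 𝒜} (s : StableNorm φ) (ρ : ℬ → List 𝒜) :
    ∃ D : ℝ, 0 ≤ D ∧ ∀ b p t, ρ b = p ++ t → s.N (wordVec φ p) ≤ D := by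
  have hfin : (⋃ b, {p | p <+: ρ b}).Finite := Set.finite_iUnion fun b =>
    (ρ b).inits.toFinset.finite_toSet.subset fun p hp => by simpa using hp
  obtain ⟨D, hD⟩ := (hfin.image fun p => s.N (wordVec φ p)).bddAbove
  exact ⟨max D 0, le_max_right _ _, fun b p t hb =>
    (hD ⟨p, Set.mem_iUnion.2 ⟨b, t, hb.symm⟩, rfl⟩).trans (le_max_left _ _)⟩

namespace IsPisotMorphism

variable {φ'' : 𝒞 → List 𝒞} {φ' : ℬ → List ℬ} {φ : 𝒜 → List 𝒜} {ρ : ℬ → List 𝒜} {σ : 𝒞 → List ℬ}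
  (h : IsPisotMorphism φ' φ ρ) (h' : IsPisotMorphism φ'' φ' σ)

include h h' in
lemma comp : IsPisotMorphism φ'' φ (morComp ρ σ) where
  source := h'.source
  target := h.target
  comm i := by
    rw [extendWord_morComp, h'.comm]
    change _ = extendWord φ (extendWord ρ (σ i))
    induction σ i with
    | nil => rfl
    | cons a u ih => simp only [extendWord_cons, extendWord_append, ih, h.comm]
  ne_nil := morComp_ne_nil h.ne_nil h'.ne_nil

variable [Nonempty 𝒜] [Nonempty ℬ] [Nonempty 𝒞]

include h h' in
lemma abelMap_comp (y : pisotSpace φ'') :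
    abelMap φ'' φ (morComp ρ σ) y = abelMap φ' φ ρ (abelMap φ'' φ' σ y) := by
  apply Subtype.ext
  rw [(h.comp h').abelMap_coe, h.abelMap_coe, h'.abelMap_coe, abelianization_morComp,
    Matrix.mulVec_mulVec]

lemma strandMap_comp (γ : Strand φ'') :
    (h.comp h').strandMap γ = h.strandMap (h'.strandMap γ) := by
  obtain ⟨z, x, hx, he⟩ := γ.exists_path
  obtain ⟨c, y, X, hc, hX, hcX, hE⟩ := h'.exists_image_path hx
  obtain ⟨d, y', X', hd, hX', hdX, hE'⟩ := h.exists_image_path hX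
  apply Strand.ext_edges
  rw [edges_strandMap, edges_strandMap, edges_strandMap, he, hE, hE']
  refine ((h.comp h').edgeMap_pathEdges hx (hc.comp hd) hX' (k₀ := 0) ?_).2
  rw [hdX, hcX, h.abelMap_comp h']

lemma strandMap_congr {ρ' : ℬ → List 𝒜} (h₂ : IsPisotMorphism φ' φ ρ') (hρ : ρ = ρ')
    (γ : Strand φ') : h.strandMap γ = h₂.strandMap γ := by
  subst hρ; rfl

/-- The image of a bounded strand is bounded. -/
lemma exists_strandMap_mem (s : StableNorm φ) (s' : StableNorm φ') {K : ℝ}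
    (hK : 0 ≤ K) (hKN : ∀ y, s.N (abelMap φ' φ ρ y) ≤ K * s'.N y) :
    ∃ D : ℝ, 0 ≤ D ∧ ∀ P' P, (∀ z c y, (∀ a b, a < b → block z a b ∈ P') → IsImage ρ z c y →
      ∀ a b, a < b → block y a b ∈ P) → ∀ B, ∀ γ ∈ boundedStrands s' P' B,
      h.strandMap γ ∈ boundedStrands s P (K * B + D) := by
  obtain ⟨D, hD0, hD⟩ := s.exists_wordVec_le ρ
  refine ⟨D, hD0, ?_⟩
  rintro P' P hP B γ ⟨z, x, hx, he, hP', hB⟩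
  obtain ⟨c, y, X, hc, hX, hcX, hE⟩ := h.exists_image_path hx
  refine ⟨y, X, hX, by rw [edges_strandMap, he, hE], hP z c y hP' hc, fun n => ?_⟩
  obtain ⟨k, hk1, hk2⟩ := (hc.strictMono h.ne_nil).exists_int_floor n
  rw [hX.sum_block hk1, hcX]
  have h1 := block_append y hk1 hk2.le
  rw [hc.block_eq] at h1
  have h2 := mul_le_mul_of_nonneg_left (hB k) hK
  linarith [map_add_le_add s.N (abelMap φ' φ ρ (x k)) (wordVec φ (block y (c k) n)),
    hKN (x k), hD _ _ _ h1.symm]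

include h in
lemma exists_abelMap_N_le (s : StableNorm φ) (s' : StableNorm φ') :
    ∃ K : ℝ, 0 ≤ K ∧ ∀ y, s.N (abelMap φ' φ ρ y) ≤ K * s'.N y := by
  obtain ⟨K, hK, hKb⟩ := (LinearMap.toContinuousLinearMap (abelMap φ' φ ρ)).bound
  obtain ⟨c, hc⟩ := h.exists_abelMap_pfVector
  refine ⟨s.C * (K * s'.C), by have := s.C_pos; have := s'.C_pos; positivity, fun y => ?_⟩
  have hpos := h.source.height_pfVector_pos
  -- Subtracting `t ω'` moves `y` to height `0`, where the seminorm controls the norm, without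
  -- changing the seminorm of `y` or of its image.
  set t := height φ' y / height φ' (pfVector φ')
  have h0 : height φ' (y - t • pfVector φ') = 0 := by
    rw [map_sub, map_smul, smul_eq_mul, div_mul_cancel₀ _ hpos.ne', sub_self]
  have hN : s'.N (y - t • pfVector φ') ≤ s'.N y := by
    refine (map_sub_le_add s'.N _ _).trans ?_
    rw [map_smul_eq_mul, s'.pf, mul_zero, add_zero]
  have h1 : s.N (abelMap φ' φ ρ y) ≤ s.N (abelMap φ' φ ρ (y - t • pfVector φ')) := by
    have h2 := map_add_le_add s.N (abelMap φ' φ ρ (y - t • pfVector φ'))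
      (abelMap φ' φ ρ (t • pfVector φ'))
    rw [← map_add, sub_add_cancel, map_smul, hc, map_smul_eq_mul, map_smul_eq_mul, s.pf, mul_zero,
      mul_zero, add_zero] at h2
    exact h2
  have h3 := s'.norm_le (y - t • pfVector φ')
  rw [h0, abs_zero, zero_add] at h3
  calc s.N (abelMap φ' φ ρ y) ≤ s.C * (K * ‖y - t • pfVector φ'‖) :=
        h1.trans ((s.le _).trans (mul_le_mul_of_nonneg_left (hKb _) s.C_pos.le))
    _ ≤ s.C * (K * (s'.C * s'.N y)) := by
        have h4 := mul_le_mul_of_nonneg_left hN s'.C_pos.le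
        have := s.C_pos
        gcongr
        linarith
    _ = s.C * (K * s'.C) * s'.N y := by ring

end IsPisotMorphism

namespace IsPisotSubstitution

variable {φ : 𝒜 → List 𝒜} [Nonempty 𝒜] (hφ : IsPisotSubstitution φ)

/-- Inflation and substitution `Φ` on strands. -/
def inflation : Strand φ → Strand φ := hφ.isPisotMorphism.strandMap

lemma edges_inflation_iterate (n : ℕ) (γ : Strand φ) :
    (hφ.inflation^[n] γ).edges = (inflate φ)^[n] γ.edges := by
  induction n with
  | zero => rfl
  | succ n ih => rw [Function.iterate_succ_apply', Function.iterate_succ_apply', ← ih]; rfl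

lemma continuous_inflation_iterate (n : ℕ) : Continuous hφ.inflation^[n] :=
  hφ.isPisotMorphism.continuous_strandMap.iterate n

include hφ in
lemma abelMap_self (y : pisotSpace φ) : abelMap φ φ φ y = abelianV φ y :=
  Subtype.ext (hφ.isPisotMorphism.abelMap_coe y)

include hφ in
lemma isPisotMorphism_morPow (n : ℕ) : IsPisotMorphism φ φ (morPow φ n) where
  source := hφ
  target := hφ
  comm := (Intertwines.self hφ.ne_nil n).comm
  ne_nil := morPow_ne_nil hφ.ne_nil n

include hφ in
lemma abelMap_morPow (n : ℕ) (y : pisotSpace φ) :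
    abelMap φ φ (morPow φ n) y = (abelianV φ ^ n) y := by
  induction n generalizing y with
  | zero =>
    refine Subtype.ext (((hφ.isPisotMorphism_morPow 0).abelMap_coe y).trans ?_)
    rw [abelianization_morPow, pow_zero, Matrix.one_mulVec, pow_zero]
    rfl
  | succ n ih =>
    rw [morPow_add, (hφ.isPisotMorphism_morPow n).abelMap_comp (hφ.isPisotMorphism_morPow 1), ih,
      morPow_one, hφ.abelMap_self, pow_succ]
    rfl

lemma inflation_iterate (n : ℕ) (γ : Strand φ) :
    hφ.inflation^[n] γ = (hφ.isPisotMorphism_morPow n).strandMap γ := by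
  induction n generalizing γ with
  | zero =>
    apply Strand.ext_edges
    ext e
    rw [IsPisotMorphism.edges_strandMap, (hφ.isPisotMorphism_morPow 0).mem_edgeMap_iff]
    have hp : ∀ (i : 𝒜) p s, morPow φ 0 i = p ++ e.1 :: s ↔ p = [] ∧ e.1 = i ∧ s = [] := by
      intro i p s
      rw [morPow_zero]
      cases p <;> simp [eq_comm]
    simp only [hp, hφ.abelMap_morPow, pow_zero, Module.End.one_apply]
    constructor
    · intro he
      exact ⟨e, he, [], [], ⟨rfl, rfl, rfl⟩, by simp⟩
    · rintro ⟨f, hf, p, s, ⟨rfl, h1, -⟩, h2⟩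
      rw [wordVec_nil, add_zero] at h2
      rwa [show e = f from Prod.ext h1 h2]
  | succ n ih =>
    rw [Function.iterate_succ_apply, ih]
    have h1 := (hφ.isPisotMorphism_morPow n).strandMap_comp hφ.isPisotMorphism γ
    rw [inflation, ← h1]
    refine IsPisotMorphism.strandMap_congr _ _ ?_ _
    rw [morPow_add, morPow_one]

lemma inflation_iterate_flow (n : ℕ) (γ : Strand φ) (t : ℝ) :
    hφ.inflation^[n] (γ.flow t) = (hφ.inflation^[n] γ).flow (pfEigenvalue φ ^ n * t) := by
  induction n with
  | zero => simp
  | succ n ih =>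
    rw [Function.iterate_succ_apply', Function.iterate_succ_apply', ih, Strand.flow, Strand.flow,
      inflation, IsPisotMorphism.strandMap_translate, hφ.abelMap_self, map_neg, map_smul,
      hφ.abelianV_pfVector, smul_smul, pow_succ]
    congr 3
    ring

end IsPisotSubstitution

lemma IsPisotMorphism.strandMap_inflation {φ' : ℬ → List ℬ} {φ : 𝒜 → List 𝒜} {ρ : ℬ → List 𝒜}
    [Nonempty 𝒜] [Nonempty ℬ] (h : IsPisotMorphism φ' φ ρ) (n : ℕ) (γ : Strand φ') :
    h.strandMap (h.source.inflation^[n] γ) = h.target.inflation^[n] (h.strandMap γ) := by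
  induction n with
  | zero => rfl
  | succ n ih =>
    rw [Function.iterate_succ_apply', Function.iterate_succ_apply', ← ih,
      IsPisotSubstitution.inflation, IsPisotSubstitution.inflation, ← strandMap_comp,
      ← strandMap_comp]
    exact strandMap_congr _ _ (funext h.comm) _

lemma exists_image_of_inflation_iterate {φ : 𝒜 → List 𝒜} [Nonempty 𝒜] (hφ : IsPisotSubstitution φ)
    {n : ℕ} {γ δ : Strand φ} (hδ : hφ.inflation^[n] δ = γ) {z : ℤ → 𝒜} {x : ℤ → pisotSpace φ}
    (hx : IsPath φ z x) (he : δ.edges = pathEdges z x) :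
    ∃ c y X, IsImage (morPow φ n) z c y ∧ IsPath φ y X ∧
      (∀ k, X (c k) = (abelianV φ ^ n) (x k)) ∧ γ.edges = pathEdges y X := by
  obtain ⟨c, y, X, h1, h2, h3, h4⟩ := (hφ.isPisotMorphism_morPow n).exists_image_path hx
  refine ⟨c, y, X, h1, h2, fun k => by rw [h3, hφ.abelMap_morPow], ?_⟩
  rw [← hδ, hφ.inflation_iterate, IsPisotMorphism.edges_strandMap, he, h4]

end Inflation

/-! ### Histories -/

section Histories

open Filter Topology

lemma isCompact_histories {X : Type*} [TopologicalSpace X] [T2Space X] {f : X → X}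
    (hf : Continuous f) {K : Set X} (hK : IsCompact K) :
    IsCompact {x | ∀ n : ℕ, ∃ y ∈ K, f^[n] y = x} := by
  have h1 : {x | ∀ n : ℕ, ∃ y ∈ K, f^[n] y = x} = ⋂ n : ℕ, f^[n] '' K := by
    ext x; simp
  rw [h1]
  exact (hK.image (hf.iterate 0)).of_isClosed_subset
    (isClosed_iInter fun n => (hK.image (hf.iterate n)).isClosed) (Set.iInter_subset _ 0)

/-- Preimages in `K` of every order exist separately. The sets `f^n(K) ∩ f^(-m)(x)` are compact,
nonempty and decreasing, so one preimage of order `m` has itself preimages of all orders. -/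
lemma exists_history {X : Type*} [TopologicalSpace X] [T2Space X] {f : X → X}
    (hf : Continuous f) {K : Set X} (hK : IsCompact K) (hfK : Set.MapsTo f K K) {x : X}
    (hx : ∀ n : ℕ, ∃ y ∈ K, f^[n] y = x) (m : ℕ) :
    ∃ y, (∀ n : ℕ, ∃ z ∈ K, f^[n] z = y) ∧ f^[m] y = x := by
  have hcl : IsClosed (f^[m] ⁻¹' {x}) := isClosed_singleton.preimage (hf.iterate m)
  have hcomp : ∀ n : ℕ, IsCompact (f^[n] '' K ∩ f^[m] ⁻¹' {x}) := fun n =>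
    (hK.image (hf.iterate n)).inter_right hcl
  obtain ⟨y, hy⟩ := IsCompact.nonempty_iInter_of_sequence_nonempty_isCompact_isClosed
    (fun n : ℕ => f^[n] '' K ∩ f^[m] ⁻¹' {x}) (fun n => by
      refine Set.inter_subset_inter_left _ ?_
      rintro _ ⟨y, hy, rfl⟩
      exact ⟨f y, hfK hy, rfl⟩) (fun n => by
      obtain ⟨y, hy, h⟩ := hx (m + n)
      exact ⟨f^[n] y, ⟨y, hy, rfl⟩, by rw [Set.mem_preimage, ← Function.iterate_add_apply, h]; rfl⟩)
    (hcomp 0) fun n => (hcomp n).isClosed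
  rw [Set.mem_iInter] at hy
  exact ⟨y, fun n => (hy n).1, (hy 0).2⟩

lemma exists_mem_histories {X : Type*} [TopologicalSpace X] [T2Space X] {f : X → X}
    (hf : Continuous f) {K : Set X} (hK : IsCompact K) (hfK : Set.MapsTo f K K)
    (hne : K.Nonempty) : ∃ x, ∀ n : ℕ, ∃ y ∈ K, f^[n] y = x := by
  obtain ⟨y, hy⟩ := IsCompact.nonempty_iInter_of_sequence_nonempty_isCompact_isClosed
    (fun n : ℕ => f^[n] '' K) (fun n => by
      rintro _ ⟨y, hy, rfl⟩
      exact ⟨f y, hfK hy, rfl⟩) (fun n => hne.image _)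
    (hK.image (hf.iterate 0)) fun n => (hK.image (hf.iterate n)).isClosed
  rw [Set.mem_iInter] at hy
  exact ⟨y, fun n => hy n⟩

end Histories

/-- In a bi-infinite word with a history of all orders, words that occur twice without overlap
belong to the language. -/
lemma IsMixing.mem_language_of_occurrences {𝒜 : Type*} {φ : 𝒜 → List 𝒜} (h : IsMixing φ)
    {y : ℤ → 𝒜} (hy : ∀ m, ∃ z c, IsImage (morPow φ m) z c y) {u : List 𝒜} (hu : u ≠ []) {p q : ℤ}
    (hpq : p + u.length ≤ q) (hp : block y p (p + u.length) = u)
    (hq : block y q (q + u.length) = u) : u ∈ language φ := by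
  -- Every block `φ^m(a)` is longer than the span of the two occurrences. If the first occurrence
  -- crosses a cut, the second lies inside the next block.
  obtain ⟨m, hm⟩ := h.growing (q - p + u.length).toNat
  obtain ⟨z, c, hc⟩ := hy m
  have hne := morPow_ne_nil h.ne_nil m
  obtain ⟨k, hk1, hk2⟩ := (hc.strictMono hne).exists_int_floor p
  have h1 := hm m le_rfl (z k)
  have h2 := hm m le_rfl (z (k + 1))
  have h3 := hc.step k
  have h4 := hc.step (k + 1)
  by_cases hcut : p + u.length ≤ c (k + 1)
  · refine language_of_infix (morPow_mem_language h.ne_nil m (z k)) hu ?_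
    rw [← hc.block_eq, ← hp]
    exact block_infix y hk1 (by omega) hcut
  · refine language_of_infix (morPow_mem_language h.ne_nil m (z (k + 1))) hu ?_
    rw [← hc.block_eq, ← hq]
    exact block_infix y (by omega) (by omega) (by omega)

/-! ### The tiling space -/

section TilingSpaces

open Filter Topology

variable {𝒜 : Type*} [Fintype 𝒜] [DecidableEq 𝒜] {φ : 𝒜 → List 𝒜}

lemma mem_omegaLimitSet_iff {γ δ : Strand φ} :
    δ ∈ omegaLimitSet φ γ ↔ MapClusterPt δ atTop γ.flow := by
  rw [mapClusterPt_iff_frequently]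
  constructor
  · intro h s hs
    rw [frequently_atTop]
    intro T
    obtain ⟨η, hη, t, ht, rfl⟩ := mem_closure_iff_nhds.1 (h (max T 1) (by positivity)) s hs
    exact ⟨t, (le_max_left _ _).trans ht, hη⟩
  · intro h T _
    rw [mem_closure_iff_nhds]
    intro s hs
    obtain ⟨t, ht, hts⟩ := frequently_atTop.1 (h s hs) T
    exact ⟨_, hts, t, ht, rfl⟩

lemma IsPath.flow {w : ℤ → 𝒜} {x : ℤ → pisotSpace φ} (h : IsPath φ w x) (t : ℝ) :
    IsPath φ w (fun k => x k + -(t • pfVector φ)) := h.add_const _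

lemma Strand.edges_flow_eq {γ : Strand φ} {w : ℤ → 𝒜} {x : ℤ → pisotSpace φ}
    (hγ : γ.edges = pathEdges w x) (t : ℝ) :
    (γ.flow t).edges = pathEdges w (fun k => x k + -(t • pfVector φ)) := by
  ext e
  rw [Strand.edges_flow, hγ, mem_pathEdges, mem_pathEdges]
  simp only [← sub_eq_add_neg, sub_eq_iff_eq_add]

lemma StableNorm.N_add_smul (s : StableNorm φ) (y : pisotSpace φ) (t : ℝ) :
    s.N (y + t • pfVector φ) = s.N y := by
  have h0 : ∀ t : ℝ, s.N (t • pfVector φ) = 0 := fun t => by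
    rw [map_smul_eq_mul, s.pf, mul_zero]
  apply le_antisymm
  · have := map_add_le_add s.N y (t • pfVector φ)
    rwa [h0, add_zero] at this
  · have := map_sub_le_add s.N (y + t • pfVector φ) (t • pfVector φ)
    rwa [h0, add_zero, add_sub_cancel_right] at this

lemma StableNorm.N_add_neg_smul (s : StableNorm φ) (y : pisotSpace φ) (t : ℝ) :
    s.N (y + -(t • pfVector φ)) = s.N y := by
  rw [← s.N_add_smul _ t, neg_add_cancel_right]

lemma boundedStrands_flow (s : StableNorm φ) {P : Set (List 𝒜)} {B : ℝ} {γ : Strand φ}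
    (h : γ ∈ boundedStrands s P B) (t : ℝ) : γ.flow t ∈ boundedStrands s P B := by
  obtain ⟨w, x, h1, h2, h3, h4⟩ := h
  refine ⟨w, _, h1.flow t, Strand.edges_flow_eq h2 t, h3, fun k => ?_⟩
  rw [s.N_add_neg_smul]
  exact h4 k

namespace IsPisotSubstitution

variable [Nonempty 𝒜] (hφ : IsPisotSubstitution φ)

/-- The strands with a history of all orders in the bounded strands. -/
def core (s : StableNorm φ) (P : Set (List 𝒜)) (B : ℝ) : Set (Strand φ) :=
  {γ | ∀ n : ℕ, ∃ δ ∈ boundedStrands s P B, hφ.inflation^[n] δ = γ}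

lemma core_mono (s : StableNorm φ) (P : Set (List 𝒜)) {B B' : ℝ} (h : B ≤ B') :
    hφ.core s P B ⊆ hφ.core s P B' := fun _ hγ n => by
  obtain ⟨δ, hδ, h'⟩ := hγ n
  exact ⟨δ, boundedStrands_mono s le_rfl h hδ, h'⟩

lemma core_subset (s : StableNorm φ) (P : Set (List 𝒜)) (B : ℝ) :
    hφ.core s P B ⊆ boundedStrands s P B := fun γ hγ => by
  obtain ⟨δ, hδ, h⟩ := hγ 0
  rwa [← h]

include hφ in
lemma intertwines_self : Intertwines φ φ φ where
  comm _ := rfl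
  mem_language i := by
    have := morPow_mem_language hφ.ne_nil 1 i
    rwa [morPow_one] at this

lemma exists_inflation_bound (s : StableNorm φ) : ∃ D : ℝ, 0 ≤ D ∧
    ∀ P ∈ ({Set.univ, language φ} : Set (Set (List 𝒜))), ∀ B, ∀ γ ∈ boundedStrands s P B,
      hφ.inflation γ ∈ boundedStrands s P (s.θ * B + D) := by
  obtain ⟨D, hD, h⟩ := hφ.isPisotMorphism.exists_strandMap_mem s s s.θ_nonneg fun y => by
    rw [hφ.abelMap_self]; exact s.map_le y
  refine ⟨D, hD, fun P hP => h P P fun z c y hz hc => ?_⟩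
  rcases hP with rfl | rfl
  · exact fun _ _ _ => Set.mem_univ _
  · exact hφ.intertwines_self.image_mem hφ.ne_nil hz hc

/-- Inflation contracts the bounded strands. -/
lemma exists_attracting_bound (s : StableNorm φ) : ∃ B₀ : ℝ, 0 ≤ B₀ ∧
    ∀ P ∈ ({Set.univ, language φ} : Set (Set (List 𝒜))),
      (∀ B, B₀ ≤ B → Set.MapsTo hφ.inflation (boundedStrands s P B) (boundedStrands s P B)) ∧
      ∀ B, ∃ n : ℕ, Set.MapsTo hφ.inflation^[n] (boundedStrands s P B) (boundedStrands s P B₀) := by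
  obtain ⟨D, hD0, hD⟩ := hφ.exists_inflation_bound s
  have hθ : 0 < 1 - s.θ := by linarith [s.θ_lt]
  -- The fixed point of `B ↦ θ B + D`, which bounds the effect of one inflation. The extra `1` in
  -- the witness `D₁ + 1` lets every tube enter after finitely many steps.
  set D₁ := D / (1 - s.θ) with hD₁
  have hD₁0 : 0 ≤ D₁ := by positivity
  have hfix : s.θ * D₁ + D = D₁ := by
    rw [hD₁]; field_simp; ring
  refine ⟨D₁ + 1, by positivity, fun P hP => ⟨fun B hB γ hγ => ?_, fun B => ?_⟩⟩
  · refine boundedStrands_mono s le_rfl ?_ (hD P hP B γ hγ)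
    have := mul_le_mul_of_nonneg_left (show D₁ ≤ B by linarith) hθ.le
    nlinarith
  · have hiter : ∀ n : ℕ, Set.MapsTo hφ.inflation^[n] (boundedStrands s P B)
        (boundedStrands s P (s.θ ^ n * B + D₁)) := by
      intro n
      induction n with
      | zero =>
        intro γ hγ
        exact boundedStrands_mono s le_rfl (by simpa using hD₁0) hγ
      | succ n ih =>
        intro γ hγ
        rw [Function.iterate_succ_apply']
        refine boundedStrands_mono s le_rfl (le_of_eq ?_) (hD P hP _ _ (ih hγ))
        rw [mul_add, add_assoc, hfix, pow_succ]; ring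
    have hlim : Tendsto (fun n : ℕ => s.θ ^ n * B) atTop (𝓝 (0 * B)) :=
      (tendsto_pow_atTop_nhds_zero_of_lt_one s.θ_nonneg s.θ_lt).mul_const B
    rw [zero_mul] at hlim
    obtain ⟨n, hn⟩ := (hlim.eventually (gt_mem_nhds one_pos)).exists
    exact ⟨n, fun γ hγ => boundedStrands_mono s le_rfl (by linarith) (hiter n hγ)⟩

lemma core_eq_of_attracting (s : StableNorm φ) {P : Set (List 𝒜)} {B₀ B : ℝ}
    (h : ∀ B, ∃ n : ℕ, Set.MapsTo hφ.inflation^[n] (boundedStrands s P B) (boundedStrands s P B₀)) :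
    hφ.core s P B ⊆ hφ.core s P B₀ := by
  intro γ hγ m
  obtain ⟨n, hn⟩ := h B
  obtain ⟨δ, hδ, h'⟩ := hγ (m + n)
  exact ⟨_, hn hδ, by rw [← Function.iterate_add_apply, h']⟩

/-- The distance to the expanding line and the stable seminorm bound each other up to the constant
`C`. -/
lemma mem_strandSpace_iff (s : StableNorm φ) {γ : Strand φ} :
    γ ∈ strandSpace φ ↔ ∃ B, γ ∈ hφ.core s Set.univ B := by
  have hiff : ∀ (n : ℕ) (δ : Strand φ),
      (inflate φ)^[n] δ.edges = γ.edges ↔ hφ.inflation^[n] δ = γ := fun n δ => by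
    rw [← hφ.edges_inflation_iterate]
    exact ⟨Strand.ext_edges, fun h => by rw [h]⟩
  constructor
  · rintro ⟨R, hR⟩
    refine ⟨s.C * (R + 1), fun n => ?_⟩
    obtain ⟨δ, hδ, h⟩ := hR n
    refine ⟨δ, ?_, (hiff n δ).1 h⟩
    obtain ⟨w, x, hp, he⟩ := δ.exists_path
    refine ⟨w, x, hp, he, fun _ _ _ => Set.mem_univ _, fun k => ?_⟩
    have h1 : ((w k, x k) : Edge φ) ∈ δ.edges := by rw [he]; exact ⟨k, rfl⟩
    have h2 : Metric.infDist (x k) (expandingLine φ : Set (pisotSpace φ)) < R + 1 := by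
      linarith [hδ _ h1]
    obtain ⟨y, hy, hd⟩ := (Metric.infDist_lt_iff ⟨0, (expandingLine φ).zero_mem⟩).1 h2
    obtain ⟨t, rfl⟩ := Submodule.mem_span_singleton.1 hy
    rw [dist_eq_norm, sub_eq_add_neg] at hd
    rw [← s.N_add_neg_smul (x k) t]
    exact (s.le _).trans (mul_le_mul_of_nonneg_left hd.le s.C_pos.le)
  · rintro ⟨B, hB⟩
    refine ⟨s.C * B, fun n => ?_⟩
    obtain ⟨δ, ⟨w, x, hp, he, -, hN⟩, h⟩ := hB n
    refine ⟨δ, fun e hed => ?_, (hiff n δ).2 h⟩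
    rw [he, mem_pathEdges] at hed
    obtain ⟨k, -, hk⟩ := hed
    rw [← hk]
    have hpos := hφ.height_pfVector_pos
    set t := height φ (x k) / height φ (pfVector φ)
    refine (Metric.infDist_le_dist_of_mem
      (Submodule.mem_span_singleton.2 ⟨t, rfl⟩ : t • pfVector φ ∈ expandingLine φ)).trans ?_
    rw [dist_eq_norm]
    refine (s.norm_le _).trans (mul_le_mul_of_nonneg_left ?_ s.C_pos.le)
    rw [map_sub, map_smul, smul_eq_mul, div_mul_cancel₀ _ hpos.ne', sub_self, abs_zero, zero_add,
      sub_eq_add_neg, s.N_add_neg_smul]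
    exact hN k

lemma exists_image_history {γ : Strand φ} {y : ℤ → 𝒜} {Y : ℤ → pisotSpace φ} (hY : IsPath φ y Y)
    (hγ : γ.edges = pathEdges y Y) (h : ∀ n : ℕ, ∃ δ, hφ.inflation^[n] δ = γ) (m : ℕ) :
    ∃ z c, IsImage (morPow φ m) z c y := by
  obtain ⟨δ, hδ⟩ := h m
  obtain ⟨z, x, hx, he⟩ := δ.exists_path
  obtain ⟨c, y', X, hc, hX, -, hE⟩ := exists_image_of_inflation_iterate hφ hδ hx he
  obtain ⟨j, hj⟩ := hφ.path_unique hX hY (hE.symm.trans hγ)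
  obtain rfl : y = fun k => y' (k + j) := funext fun k => (hj k).1
  exact ⟨z, _, hc.translate j⟩

include hφ in
/-- The words of a limit of the forward flow of a strand occur in the strand arbitrarily far
to the right. -/
lemma exists_occurrence {U : Filter ℝ} [U.NeBot] (hU : U ≤ atTop) {γ δ : Strand φ} {r : ℝ}
    (hr : 0 < r) (hlim : Tendsto (fun t => γ.flow (t / r)) U (𝓝 δ)) {w y : ℤ → 𝒜}
    {x Y : ℤ → pisotSpace φ} (hx : IsPath φ w x) (hδ : δ.edges = pathEdges w x) (hY : IsPath φ y Y)
    (hγ : γ.edges = pathEdges y Y) {a b : ℤ} (hab : a < b) (q : ℤ) :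
    ∃ p ≥ q, block y p (p + (b - a)) = block w a b := by
  obtain ⟨R, hR⟩ := ((Set.finite_Ico a b).image fun k => ‖x k‖).bddAbove
  have hR' : ∀ k, a ≤ k → k < b → ‖x k‖ ≤ R := fun k h1 h2 => hR ⟨k, ⟨h1, h2⟩, rfl⟩
  have hR0 : 0 ≤ R := (norm_nonneg _).trans (hR' a le_rfl hab)
  obtain ⟨H, hH, hHb⟩ := exists_abs_height_le φ
  have hpos := hφ.height_pfVector_pos
  have hε : 0 < (R + 2)⁻¹ := by positivity
  have hε1 : (R + 2)⁻¹ < 1 := inv_lt_one_of_one_lt₀ (by linarith)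
  have hlarge := hU (eventually_ge_atTop
    (r * ((height φ (Y q) + H * (R + 1)) / height φ (pfVector φ))))
  obtain ⟨t, ht1, ht2⟩ := ((Strand.tendsto_iff_close.1 hlim _ hε).and hlarge).exists
  obtain ⟨v, j, hv, hj⟩ := hφ.exists_copy hx (hY.flow (t / r)) hδ (Strand.edges_flow_eq hγ _) ht1
    hab fun k h1 h2 => by rw [inv_inv]; linarith [hR' k h1 h2]
  refine ⟨a + j, ?_, ?_⟩
  · obtain ⟨-, h1⟩ := hj a le_rfl hab
    have h2 := congrArg (height φ) h1
    simp only [map_add, map_neg, map_smul, smul_eq_mul] at h2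
    have h3 := (abs_le.1 (hHb (x a))).1
    have h4 := (abs_le.1 (hHb v)).1
    have h5 := mul_le_mul_of_nonneg_left (hR' a le_rfl hab) hH.le
    have h6 := mul_le_mul_of_nonneg_left (hv.trans hε1).le hH.le
    have h7 : height φ (Y q) + H * (R + 1) ≤ t / r * height φ (pfVector φ) := by
      rw [← div_le_iff₀ hpos, le_div_iff₀ hr, mul_comm]; exact ht2
    have h8 : height φ (Y q) ≤ height φ (Y (a + j)) := by linarith
    exact (hφ.height_strictMono hY).le_iff_le.1 h8
  · have h1 : block w a b = block y (a + j) (a + j + (b - a)) := by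
      refine block_congr fun n h0 hn => ?_
      rw [← (hj (a + n) (by omega) (by omega)).1]
      congr 1; ring
    exact h1.symm

/-- The words of the limit strands belong to the language. -/
lemma mem_core_of_mapClusterPt (s : StableNorm φ) {B : ℝ}
    (hB : Set.MapsTo hφ.inflation (boundedStrands s Set.univ B) (boundedStrands s Set.univ B))
    {γ δ : Strand φ} (hγ : γ ∈ hφ.core s Set.univ B) (hδ : MapClusterPt δ atTop γ.flow) :
    δ ∈ hφ.core s (language φ) B := by
  have := hφ.t2Space
  have hcont : Continuous hφ.inflation := hφ.isPisotMorphism.continuous_strandMap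
  have hK := isCompact_boundedStrands s (P := Set.univ) (B := B) hφ
  intro n
  -- Flowing the preimage `γ'` for time `t / λ^n` and inflating `n` times flows `γ` for time `t`. A
  -- limit of the slowed flow along the same ultrafilter is therefore an order-`n` preimage of `δ`.
  -- Its words occur in `γ'` twice without overlap, which puts them in the language.
  obtain ⟨γ', hγ', hγγ'⟩ := exists_history hcont hK hB hγ n
  obtain ⟨U, hU, hUδ⟩ := mapClusterPt_iff_ultrafilter.1 hδ
  have hr : 0 < pfEigenvalue φ ^ n := pow_pos (one_pos.trans hφ.one_lt) n
  obtain ⟨δ', hδ', hlim⟩ := hK.ultrafilter_le_nhds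
    (U.map fun t => γ'.flow (t / pfEigenvalue φ ^ n)) (by
      rw [le_principal_iff, Ultrafilter.coe_map, mem_map]
      exact Filter.univ_mem' fun t => boundedStrands_flow s (hφ.core_subset s _ B hγ') _)
  have hlim : Tendsto (fun t => γ'.flow (t / pfEigenvalue φ ^ n)) U (𝓝 δ') := hlim
  refine ⟨δ', ?_, ?_⟩
  · obtain ⟨w, x, hx, hδx⟩ := δ'.exists_path
    obtain ⟨y, Y, hY, hγY⟩ := γ'.exists_path
    rw [mem_boundedStrands_iff hφ hx hδx] at hδ' ⊢
    refine ⟨fun a b hab => ?_, hδ'.2⟩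
    obtain ⟨p, -, hp⟩ := hφ.exists_occurrence hU hr hlim hx hδx hY hγY hab 0
    obtain ⟨q, hq, hq'⟩ := hφ.exists_occurrence hU hr hlim hx hδx hY hγY hab (p + (b - a))
    have hlen : ((block w a b).length : ℤ) = b - a := by rw [length_block]; omega
    refine hφ.isMixing.mem_language_of_occurrences (hφ.exists_image_history hY hγY fun m => ?_)
      (p := p) (q := q) ?_ ?_ ?_ ?_
    · obtain ⟨z, -, hz⟩ := hγ' m
      exact ⟨z, hz⟩
    · rw [← List.length_pos_iff_ne_nil]; omega
    · rwa [hlen]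
    · rwa [hlen]
    · rwa [hlen]
  · have h1 := ((hφ.continuous_inflation_iterate n).tendsto δ').comp hlim
    refine tendsto_nhds_unique h1 (hUδ.congr fun t => ?_)
    rw [Function.comp_apply, hφ.inflation_iterate_flow, mul_div_cancel₀ _ hr.ne', hγγ']

/-- Strands with a history in the allowed strands are recurrent under the flow. -/
lemma mapClusterPt_of_mem_core (s : StableNorm φ) {B : ℝ} {δ : Strand φ}
    (hδ : δ ∈ hφ.core s (language φ) B) : MapClusterPt δ atTop δ.flow := by
  rw [mapClusterPt_iff_frequently]
  intro O hO
  obtain ⟨ε, hε, hO⟩ := Strand.mem_nhds_iff_close.1 hO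
  rw [frequently_atTop]
  intro T
  suffices h : ∃ t ≥ T, Strand.Close ε δ (δ.flow t) by
    obtain ⟨t, ht, h⟩ := h
    exact ⟨t, ht, hO _ h⟩
  obtain ⟨d, M, hd, -, hb⟩ := hφ.exists_height_bounds
  obtain ⟨H, hH, hHb⟩ := exists_abs_height_le φ
  have hpos := hφ.height_pfVector_pos
  have hlam := hφ.one_lt
  -- Vectors between vertices of a bounded strand have seminorm at most `2B`. After `n` inflations
  -- this is too small to matter, while an inflated edge is taller than the ball in which the
  -- strands must agree.
  obtain ⟨n, hn1, hn2⟩ : ∃ n : ℕ, s.C * (s.θ ^ n * (2 * B)) < ε ∧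
      H * ε⁻¹ < pfEigenvalue φ ^ n * d := by
    have hl1 : Tendsto (fun n : ℕ => s.C * (s.θ ^ n * (2 * B))) atTop
        (𝓝 (s.C * (0 * (2 * B)))) := tendsto_const_nhds.mul
      ((tendsto_pow_atTop_nhds_zero_of_lt_one s.θ_nonneg s.θ_lt).mul_const _)
    rw [zero_mul, mul_zero] at hl1
    have hl2 : Tendsto (fun n : ℕ => pfEigenvalue φ ^ n * d) atTop atTop :=
      (tendsto_pow_atTop_atTop_of_one_lt hlam).atTop_mul_const hd
    exact ((hl1.eventually (gt_mem_nhds hε)).and (hl2.eventually_gt_atTop _)).exists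
  set A := abelianV φ ^ n with hA
  have hAh : ∀ y, height φ (A y) = pfEigenvalue φ ^ n * height φ y := by
    intro y
    rw [hA]; clear_value A; clear hA
    clear hn1 hn2
    induction n with
    | zero => simp
    | succ n ih => rw [pow_succ', Module.End.mul_apply, hφ.height_abelianV, ih]; ring
  have hAN : ∀ y, s.N (A y) ≤ s.θ ^ n * s.N y := by
    intro y
    rw [hA]; clear_value A; clear hA hAh
    clear hn1 hn2
    induction n with
    | zero => simp
    | succ n ih =>
      rw [pow_succ', Module.End.mul_apply]
      refine (s.map_le _).trans ((mul_le_mul_of_nonneg_left ih s.θ_nonneg).trans (le_of_eq ?_))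
      ring
  obtain ⟨δ', hδ', hδδ'⟩ := hδ n
  obtain ⟨w, x, hx, hδx, h0, h1⟩ := hφ.exists_normalized_path δ'
  obtain ⟨hw, hN⟩ := (mem_boundedStrands_iff hφ hx hδx).1 hδ'
  obtain ⟨c, y, X, hc, hX, hcX, hE⟩ := exists_image_of_inflation_iterate hφ hδδ' hx hδx
  obtain ⟨q, hq⟩ := exists_nat_gt (|T| * height φ (pfVector φ) / d)
  rw [div_lt_iff₀ hd] at hq
  -- The edge over height `0` is taken with a neighbour on each side, so the window extends at least
  -- `d` above and below height `0`. A recurrence of these three letters far to the right becomes,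
  -- after inflation, a near return of `δ`.
  obtain ⟨p, hpq, hp⟩ := hφ.isMixing.exists_block_eq hw (hw (-1) 2 (by omega)) q
  rw [length_block, show (2 - -1 : ℤ).toNat = 3 from rfl] at hp
  set u := x p - x (-1) with hu
  have hmono := hc.monotone
  have hab : c (-1) ≤ c 2 := hmono (by omega)
  have hagree : ∀ k, c (-1) ≤ k → k < c 2 → y (k + (c p - c (-1))) = y k := by
    intro k hk1 hk2
    refine eq_of_block_eq hab (hmono (show p ≤ p + 3 by omega)) ?_ hk1 hk2
    rw [hc.block_extend (show p ≤ p + 3 by omega), hc.block_extend (show (-1 : ℤ) ≤ 2 by omega)]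
    exact congrArg _ hp
  -- This flow time cancels the height of the displacement `A^n u`; what remains is transversal,
  -- hence shorter than `ε`.
  set t := height φ (A u) / height φ (pfVector φ) with ht
  have hv0 : height φ (A u + -(t • pfVector φ)) = 0 := by
    rw [map_add, map_neg, map_smul, smul_eq_mul, ht, div_mul_cancel₀ _ hpos.ne', add_neg_cancel]
  have hv : ‖A u + -(t • pfVector φ)‖ < ε := by
    refine (s.norm_le _).trans_lt (lt_of_le_of_lt ?_ hn1)
    rw [hv0, abs_zero, zero_add, s.N_add_neg_smul]
    have h2 := map_sub_le_add s.N (x p) (x (-1))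
    have h3 := hAN u
    have h4 := mul_le_mul_of_nonneg_left
      (show s.N u ≤ 2 * B by rw [hu]; linarith [hN p, hN (-1)]) (pow_nonneg s.θ_nonneg n)
    exact mul_le_mul_of_nonneg_left (h3.trans h4) s.C_pos.le
  have hbot : height φ (x (-1)) ≤ -d := by
    have h2 := hx (-1)
    rw [neg_add_cancel] at h2
    rw [h2, map_add] at h0
    linarith [(hb (w (-1))).1]
  have htop : d ≤ height φ (x 2) := by
    rw [show (2 : ℤ) = 1 + 1 from rfl, hx, map_add]
    linarith [(hb (w 1)).1]
  refine ⟨t, ?_, ?_⟩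
  · have h2 := hφ.height_sub_ge (fun i => (hb i).1) hx (show -1 ≤ p by omega)
    rw [← map_sub, ← hu] at h2
    have h3 : (q : ℝ) ≤ (p - -1 : ℤ) := by exact_mod_cast (by omega)
    have h4 := mul_le_mul_of_nonneg_left h3 hd.le
    have h5 : |T| * height φ (pfVector φ) ≤ height φ u := by linarith
    have h6 : 0 ≤ height φ u := le_trans (by positivity) h5
    have h7 : height φ u ≤ height φ (A u) := by
      rw [hAh]
      exact le_mul_of_one_le_left h6 (one_le_pow₀ hlam.le)
    rw [ge_iff_le, ht, le_div_iff₀ hpos]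
    have := mul_le_mul_of_nonneg_right (le_abs_self T) hpos.le
    linarith
  · refine hφ.close_of_agree hX (hX.flow t) hE (Strand.edges_flow_eq hE t) hv hagree le_rfl hab
      ?_ fun z hz => ?_
    · rw [add_sub_cancel, hcX, hcX, hu, map_sub]; abel
    · rw [hv0, hcX, hcX, hAh, hAh]
      have h2 := abs_le.1 ((hHb z).trans (mul_le_mul_of_nonneg_left hz.le hH.le))
      have hlp : 0 ≤ pfEigenvalue φ ^ n := by positivity
      have h3 := mul_le_mul_of_nonneg_left hbot hlp
      have h4 := mul_le_mul_of_nonneg_left htop hlp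
      constructor <;> linarith

/-- This replaces the `ω`-limit set by a condition that morphisms transport. Limits of the flow
acquire histories with allowed words; conversely a strand with such a history is recurrent and lies
in its own `ω`-limit set. -/
theorem mem_tilingSpace_iff (s : StableNorm φ) {γ : Strand φ} :
    γ ∈ tilingSpace φ ↔ ∃ B, γ ∈ hφ.core s (language φ) B := by
  constructor
  · rintro ⟨δ, hδ, hγ⟩
    obtain ⟨B, hB⟩ := (hφ.mem_strandSpace_iff s).1 hδ
    obtain ⟨B₀, -, h₀⟩ := hφ.exists_attracting_bound s
    exact ⟨max B B₀, hφ.mem_core_of_mapClusterPt s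
      ((h₀ _ (Set.mem_insert _ _)).1 _ (le_max_right _ _))
      (hφ.core_mono s _ (le_max_left _ _) hB) (mem_omegaLimitSet_iff.1 hγ)⟩
  · rintro ⟨B, hB⟩
    refine ⟨γ, (hφ.mem_strandSpace_iff s).2 ⟨B, fun n => ?_⟩,
      mem_omegaLimitSet_iff.2 (hφ.mapClusterPt_of_mem_core s hB)⟩
    obtain ⟨δ, hδ, h⟩ := hB n
    exact ⟨δ, boundedStrands_mono s (Set.subset_univ _) le_rfl hδ, h⟩

lemma exists_tilingSpace_eq (s : StableNorm φ) : ∃ B, 0 ≤ B ∧ tilingSpace φ =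
      {γ | ∀ n : ℕ, ∃ δ ∈ boundedStrands s (language φ) B, hφ.inflation^[n] δ = γ} ∧
    Set.MapsTo hφ.inflation (boundedStrands s (language φ) B)
      (boundedStrands s (language φ) B) ∧
    ∀ B', ∃ n : ℕ, Set.MapsTo hφ.inflation^[n] (boundedStrands s (language φ) B')
      (boundedStrands s (language φ) B) := by
  obtain ⟨B, hB, h⟩ := hφ.exists_attracting_bound s
  obtain ⟨h1, h2⟩ := h (language φ) (by simp)
  refine ⟨B, hB, ?_, h1 B le_rfl, h2⟩
  ext γ
  rw [hφ.mem_tilingSpace_iff s]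
  exact ⟨fun ⟨B', hB'⟩ => hφ.core_eq_of_attracting s h2 hB', fun h => ⟨B, h⟩⟩

include hφ in
lemma isCompact_tilingSpace : IsCompact (tilingSpace φ) := by
  obtain ⟨s⟩ := hφ.nonempty_stableNorm
  have := hφ.t2Space
  obtain ⟨B, -, h, -⟩ := hφ.exists_tilingSpace_eq s
  rw [h]
  exact isCompact_histories hφ.isPisotMorphism.continuous_strandMap
    (isCompact_boundedStrands s hφ)

lemma exists_preimage_tilingSpace {γ : Strand φ} (hγ : γ ∈ tilingSpace φ) (n : ℕ) :
    ∃ δ ∈ tilingSpace φ, hφ.inflation^[n] δ = γ := by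
  obtain ⟨s⟩ := hφ.nonempty_stableNorm
  have := hφ.t2Space
  obtain ⟨B, -, h, hB, -⟩ := hφ.exists_tilingSpace_eq s
  rw [h] at hγ ⊢
  exact exists_history hφ.isPisotMorphism.continuous_strandMap
    (isCompact_boundedStrands s hφ) hB hγ n

lemma inflation_mem_tilingSpace {γ : Strand φ} (hγ : γ ∈ tilingSpace φ) :
    hφ.inflation γ ∈ tilingSpace φ := by
  obtain ⟨s⟩ := hφ.nonempty_stableNorm
  obtain ⟨B, -, h, hB, -⟩ := hφ.exists_tilingSpace_eq s
  rw [h] at hγ ⊢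
  intro n
  obtain ⟨δ, hδ, h'⟩ := hγ n
  exact ⟨_, hB hδ, by rw [← Function.iterate_succ_apply, Function.iterate_succ_apply', h']⟩

lemma inflation_iterate_mem_tilingSpace {γ : Strand φ} (hγ : γ ∈ tilingSpace φ) (n : ℕ) :
    hφ.inflation^[n] γ ∈ tilingSpace φ :=
  (Set.MapsTo.iterate (fun _ => hφ.inflation_mem_tilingSpace) n) hγ

include hφ in
lemma mem_allowedWords {γ : Strand φ} (hγ : γ ∈ tilingSpace φ) {w : ℤ → 𝒜}
    {x : ℤ → pisotSpace φ} (hx : IsPath φ w x) (he : γ.edges = pathEdges w x) :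
    w ∈ allowedWords φ := by
  obtain ⟨s⟩ := hφ.nonempty_stableNorm
  obtain ⟨B, hB⟩ := (hφ.mem_tilingSpace_iff s).1 hγ
  exact ((mem_boundedStrands_iff hφ hx he).1 (hφ.core_subset s _ B hB)).1

include hφ in
/-- The words of the language are balanced. -/
lemma exists_balanced (s : StableNorm φ) : ∃ B, ∀ u ∈ language φ, s.N (wordVec φ u) ≤ B := by
  obtain ⟨D, hD0, hD⟩ := s.exists_wordVec_le φ
  obtain ⟨D', hD'0, hD'⟩ := s.exists_wordVec_le (morPow φ 0)
  have hθ : 0 < 1 - s.θ := by linarith [s.θ_lt]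
  set D₁ := (D + D') / (1 - s.θ) with hD₁
  have hfix : s.θ * D₁ + (D + D') = D₁ := by
    rw [hD₁]; field_simp; ring
  have hD₁0 : 0 ≤ D₁ := by positivity
  -- A prefix of `φ(u)` is the image of a prefix of `u` followed by a bounded remainder. Iterating,
  -- its vector obeys the contracting recursion with fixed point `D₁`, and a factor is a difference
  -- of two prefixes.
  have hsplit : ∀ (u : List 𝒜) (p t : List 𝒜), extendWord φ u = p ++ t →
      ∃ v v' q q' i, u = v ++ v' ∧ p = extendWord φ v ++ q ∧ (q = [] ∨ φ i = q ++ q') := by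
    intro u
    induction u with
    | nil =>
      intro p t hp
      rw [extendWord_nil, eq_comm, List.append_eq_nil_iff] at hp
      exact ⟨[], [], [], [], Classical.arbitrary 𝒜, rfl, hp.1, Or.inl rfl⟩
    | cons a u ih =>
      intro p t hp
      rw [extendWord_cons, List.append_eq_append_iff] at hp
      rcases hp with ⟨p', rfl, h2⟩ | ⟨q', h1, -⟩
      · obtain ⟨v, v', q, q', i, rfl, rfl, h5⟩ := ih _ _ h2
        exact ⟨a :: v, v', q, q', i, rfl, by simp, h5⟩
      · exact ⟨[], a :: u, p, q', a, rfl, rfl, Or.inr h1⟩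
  have hprefix : ∀ (n : ℕ) i p t, morPow φ n i = p ++ t → s.N (wordVec φ p) ≤ D₁ := by
    intro n i
    induction n with
    | zero =>
      intro p t hp
      refine (hD' i p t hp).trans ?_
      have : 0 ≤ s.θ * D₁ := mul_nonneg s.θ_nonneg hD₁0
      linarith
    | succ n ih =>
      intro p t hp
      have h1 : morPow φ (n + 1) i = extendWord φ (morPow φ n i) := by
        rw [add_comm, morPow_add, morPow_one]; rfl
      obtain ⟨v, v', q, q', j, h2, rfl, h4⟩ := hsplit _ _ _ (h1.symm.trans hp)
      have h5 : s.N (wordVec φ q) ≤ D := by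
        rcases h4 with rfl | h4
        · simpa using hD0
        · exact hD _ _ _ h4
      rw [wordVec_append, ← hφ.isPisotMorphism.abelMap_wordVec, hφ.abelMap_self]
      have h6 := mul_le_mul_of_nonneg_left (ih v v' h2) s.θ_nonneg
      linarith [map_add_le_add s.N (abelianV φ (wordVec φ v)) (wordVec φ q),
        s.map_le (wordVec φ v)]
  refine ⟨D₁ + D₁, ?_⟩
  rintro u ⟨-, i, n, p, t, hpt⟩
  have h1 := hprefix n i (p ++ u) t hpt.symm
  have h2 := hprefix n i p (u ++ t) (by rw [← List.append_assoc]; exact hpt.symm)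
  have h3 := map_sub_le_add s.N (wordVec φ (p ++ u)) (wordVec φ p)
  rw [wordVec_append, add_sub_cancel_left] at h3
  rw [wordVec_append] at h1
  linarith

-- By balancedness the strand through the origin along any allowed word stays in a tube. Inflating
-- it yields a strand in the attracting tube, and compactness provides a strand with a full history
-- there.
include hφ in
lemma tilingSpace_nonempty : (tilingSpace φ).Nonempty := by
  obtain ⟨s⟩ := hφ.nonempty_stableNorm
  have := hφ.t2Space
  obtain ⟨B, -, h, hB, hB'⟩ := hφ.exists_tilingSpace_eq s
  obtain ⟨w, hw⟩ := hφ.isMixing.allowedWords_nonempty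
  obtain ⟨B', hbal⟩ := hφ.exists_balanced s
  obtain ⟨x, hx0, hx⟩ := exists_isPath φ w 0 0
  have hne : (boundedStrands s (language φ) B).Nonempty := by
    obtain ⟨n, hn⟩ := hB' (max B' 0)
    refine ⟨_, hn (⟨w, x, hx, hx.edges_strand, hw, fun k => ?_⟩ :
      hx.strand ∈ boundedStrands s (language φ) (max B' 0))⟩
    rcases lt_trichotomy k 0 with hk | rfl | hk
    · have h1 := hx.sum_block hk.le
      rw [hx0, eq_comm, add_eq_zero_iff_eq_neg] at h1
      rw [h1, map_neg_eq_map]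
      exact (hbal _ (hw k 0 hk)).trans (le_max_left _ _)
    · rw [hx0, map_zero]; exact le_max_right _ _
    · rw [hx.sum_block hk.le, hx0, zero_add]
      exact (hbal _ (hw 0 k hk)).trans (le_max_left _ _)
  rw [h]
  exact exists_mem_histories hφ.isPisotMorphism.continuous_strandMap
    (isCompact_boundedStrands s hφ) hB hne

-- By minimality a period of one allowed word is a period of the word of a strand in the tiling
-- space. The displacement over a period has seminorm zero, since its multiples join vertices of a
-- bounded strand; hence it is parallel to `ω` and the strand is periodic under the flow.
include hφ in
lemma hasNoPeriod : HasNoPeriod φ := by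
  intro z hz d hd hper
  obtain ⟨s⟩ := hφ.nonempty_stableNorm
  obtain ⟨γ, hγ⟩ := hφ.tilingSpace_nonempty
  obtain ⟨w, x, hx, he⟩ := γ.exists_path
  obtain ⟨B, hB⟩ := (hφ.mem_tilingSpace_iff s).1 hγ
  have hN := ((mem_boundedStrands_iff hφ hx he).1 (hφ.core_subset s _ B hB)).2
  have hw := hφ.mem_allowedWords hγ hx he
  have hwd : ∀ k, w (k + d) = w k := by
    intro k
    obtain ⟨p, hp⟩ := hφ.isMixing.exists_shifts hz hw
    obtain ⟨m, h1, h2⟩ := ((hp k).and (hp (k + d))).exists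
    rw [← h1, ← h2, ← hper (k + p m)]
    congr 1; ring
  set v := x d - x 0 with hv
  have hxd : ∀ k, x (k + d) = x k + v := by
    intro k
    have h1 : IsPath φ w fun k => x (k + d) := by
      have := hx.shift d
      rwa [show (fun k => w (k + d)) = w from funext hwd] at this
    have := hx.unique h1 k
    simpa [hv] using this
  have hxn : ∀ n : ℕ, x (n * d) = x 0 + n • v := by
    intro n
    induction n with
    | zero => simp
    | succ n ih =>
      rw [Nat.cast_succ, add_mul, one_mul, hxd, ih, succ_nsmul]; abel
  have hNv : s.N v = 0 := by
    by_contra hne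
    have hpos : 0 < s.N v := lt_of_le_of_ne (apply_nonneg s.N v) (Ne.symm hne)
    obtain ⟨n, hn⟩ := exists_nat_gt ((2 * B) / s.N v)
    rw [div_lt_iff₀ hpos] at hn
    have h1 := map_sub_le_add s.N (x (n * d)) (x 0)
    rw [hxn, add_sub_cancel_left, ← Nat.cast_smul_eq_nsmul ℝ, map_smul_eq_mul, Real.norm_natCast,
      Nat.cast_smul_eq_nsmul, ← hxn] at h1
    linarith [hN (n * d), hN 0]
  have hpos := hφ.height_pfVector_pos
  set t := height φ v / height φ (pfVector φ) with ht
  have hvt : v = t • pfVector φ := by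
    have h1 := s.norm_le (v - t • pfVector φ)
    rw [map_sub, map_smul, smul_eq_mul, ht, div_mul_cancel₀ _ hpos.ne', sub_self, abs_zero,
      zero_add, sub_eq_add_neg, s.N_add_neg_smul, hNv, mul_zero,
      ← sub_eq_add_neg, norm_le_zero_iff, sub_eq_zero] at h1
    exact h1
  have hv0 : 0 < height φ v := by
    rw [hv, map_sub, sub_pos]
    exact hφ.height_strictMono hx (by exact_mod_cast hd)
  refine hφ.aperiodic γ hγ t (by rw [ht]; positivity) (Strand.ext_edges ?_)
  rw [Strand.edges_flow_eq he, he, ← hvt]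
  rw [← IsPath.pathEdges_shift w _ d]
  simp only [hwd, hxd, add_neg_cancel_right]

end IsPisotSubstitution

end TilingSpaces

/-! ### The homeomorphism of tiling spaces induced by a recognizable morphism -/

section TilingMaps

open Filter Topology

variable {𝒜 ℬ : Type*} [Fintype 𝒜] [DecidableEq 𝒜] [Fintype ℬ] [DecidableEq ℬ]
  [Nonempty 𝒜] [Nonempty ℬ]

namespace IsPisotMorphism

variable {φ' : ℬ → List ℬ} {φ : 𝒜 → List 𝒜} {ρ : ℬ → List 𝒜} (h : IsPisotMorphism φ' φ ρ)

lemma strandMap_mem_tilingSpace (hi : Intertwines φ' φ ρ) {γ : Strand φ'}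
    (hγ : γ ∈ tilingSpace φ') : h.strandMap γ ∈ tilingSpace φ := by
  obtain ⟨s⟩ := h.target.nonempty_stableNorm
  obtain ⟨s'⟩ := h.source.nonempty_stableNorm
  obtain ⟨K, hK, hKN⟩ := h.exists_abelMap_N_le s s'
  obtain ⟨D, -, hD⟩ := h.exists_strandMap_mem s s' hK hKN
  obtain ⟨B, hB⟩ := (h.source.mem_tilingSpace_iff s').1 hγ
  refine (h.target.mem_tilingSpace_iff s).2 ⟨K * B + D, fun n => ?_⟩
  obtain ⟨δ, hδ, hn⟩ := hB n
  exact ⟨h.strandMap δ, hD (language φ') _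
    (fun z c y hz hc => hi.image_mem h.target.ne_nil hz hc) B δ hδ,
    by rw [← h.strandMap_inflation, hn]⟩

lemma strandMap_injective_of_recognizable (hrec : Recognizable ρ (allowedWords φ'))
    {γ δ : Strand φ'} {z z' : ℤ → ℬ} {x x' : ℤ → pisotSpace φ'} (hx : IsPath φ' z x)
    (hγ : γ.edges = pathEdges z x) (hx' : IsPath φ' z' x') (hδ : δ.edges = pathEdges z' x')
    (hz : z ∈ allowedWords φ') (hz' : z' ∈ allowedWords φ')
    (heq : h.strandMap γ = h.strandMap δ) : γ = δ := by
  obtain ⟨c, y, X, hc, hX, hcX, hE⟩ := h.exists_image_path hx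
  obtain ⟨c', y', X', hc', hX', hcX', hE'⟩ := h.exists_image_path hx'
  have h1 : pathEdges y X = pathEdges y' X' := by
    rw [← hE, ← hE', ← hγ, ← hδ, ← h.edges_strandMap, ← h.edges_strandMap, heq]
  obtain ⟨j, hj⟩ := h.target.path_unique hX hX' h1
  have hy : (fun n => y' (n + -j)) = y := funext fun n => by rw [(hj _).1, neg_add_cancel_right]
  have h2 := hc'.translate (-j)
  rw [hy] at h2
  obtain ⟨i, hi⟩ := hrec z hz z' hz' _ _ _ hc h2
  have hxi : ∀ k, x' k = x (k + i) := by
    intro k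
    apply h.abelMap_injective
    rw [← hcX', ← hcX, (hj _).2, ← (hi k).2, sub_neg_eq_add]
  apply Strand.ext_edges
  rw [hγ, hδ, ← IsPath.pathEdges_shift z x i]
  congr 1
  · exact funext fun k => (hi k).1.symm
  · exact funext fun k => (hxi k).symm

/-- The word is lifted through `ρ` and the vertices at the cuts through `P⁻¹`. Since `P` is
bijective and respects the expanding lines, the tube widens by at most a fixed factor. -/
lemma exists_strandMap_eq (hi : Intertwines φ' φ ρ) (s : StableNorm φ) (s' : StableNorm φ') :
    ∃ K : ℝ, ∀ B, ∀ γ ∈ boundedStrands s (language φ) B,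
      ∃ δ ∈ boundedStrands s' (language φ') (K * B), h.strandMap δ = γ := by
  have hbij := h.abelMap_bijective
  obtain ⟨K, hK, hKb⟩ := (LinearMap.toContinuousLinearMap
    (LinearEquiv.ofBijective _ hbij).symm.toLinearMap).bound
  obtain ⟨c₀, hc₀⟩ := h.exists_abelMap_pfVector
  have hc₀ne : c₀ ≠ 0 := by
    rintro rfl
    rw [zero_smul, ← map_zero (abelMap φ' φ ρ)] at hc₀
    have := h.source.height_pfVector_pos
    rw [hbij.1 hc₀, map_zero] at this
    exact lt_irrefl _ this
  have hpos := h.target.height_pfVector_pos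
  have hN : ∀ y, s'.N y ≤ s'.C * (K * s.C) * s.N (abelMap φ' φ ρ y) := by
    intro y
    set t := height φ (abelMap φ' φ ρ y) / height φ (pfVector φ)
    have h1 : abelMap φ' φ ρ (y + -((t / c₀) • pfVector φ')) =
        abelMap φ' φ ρ y + -(t • pfVector φ) := by
      rw [map_add, map_neg, map_smul, hc₀, smul_smul, div_mul_cancel₀ _ hc₀ne]
    have h2 := hKb (abelMap φ' φ ρ (y + -((t / c₀) • pfVector φ')))
    have h3 : (LinearMap.toContinuousLinearMap (LinearEquiv.ofBijective _ hbij).symm.toLinearMap)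
        (abelMap φ' φ ρ (y + -((t / c₀) • pfVector φ'))) = y + -((t / c₀) • pfVector φ') :=
      (LinearEquiv.ofBijective _ hbij).symm_apply_apply _
    rw [h3, h1] at h2
    have h4 := s.norm_le (abelMap φ' φ ρ y + -(t • pfVector φ))
    rw [s.N_add_neg_smul, map_add, map_neg, map_smul, smul_eq_mul, div_mul_cancel₀ _ hpos.ne',
      add_neg_cancel, abs_zero, zero_add] at h4
    rw [← s'.N_add_neg_smul y (t / c₀)]
    have := s'.C_pos
    calc s'.N (y + -((t / c₀) • pfVector φ')) ≤ s'.C * ‖y + -((t / c₀) • pfVector φ')‖ := s'.le _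
      _ ≤ s'.C * (K * (s.C * s.N (abelMap φ' φ ρ y))) := by
        gcongr
        exact h2.trans (mul_le_mul_of_nonneg_left h4 hK.le)
      _ = _ := by ring
  refine ⟨s'.C * (K * s.C), ?_⟩
  rintro B γ ⟨y, X, hX, hγ, hy, hB⟩
  obtain ⟨z, hz, c, hc⟩ := hi.exists_preimage h.target.isMixing h.source.isMixing
    (x := y) hy
  choose f hf using hbij.2
  have hx : IsPath φ' z fun k => f (X (c k)) := by
    intro k
    apply hbij.1
    rw [map_add, hf, hf, h.abelMap_segVec, hX.sum_block (hc.monotone (show k ≤ k + 1 by omega)),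
      hc.block_eq]
  refine ⟨hx.strand, ⟨z, _, hx, rfl, hz, fun k => (hN _).trans ?_⟩, ?_⟩
  · rw [hf]
    refine mul_le_mul_of_nonneg_left (hB _) ?_
    have := s.C_pos
    have := s'.C_pos
    positivity
  · apply Strand.ext_edges
    rw [h.edges_strandMap, hx.edges_strand, hγ]
    exact (h.edgeMap_pathEdges hx hc hX (k₀ := 0) (hf _).symm).2

/-- A whole history of `γ` is lifted term by term. The inflated lifts all have image `γ`, so
recognizability identifies them, and the lifts form a history of a single strand. -/
lemma exists_strandMap_eq_tilingSpace (hi : Intertwines φ' φ ρ)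
    (hrec : Recognizable ρ (allowedWords φ')) {γ : Strand φ} (hγ : γ ∈ tilingSpace φ) :
    ∃ δ ∈ tilingSpace φ', h.strandMap δ = γ := by
  obtain ⟨s⟩ := h.target.nonempty_stableNorm
  obtain ⟨s'⟩ := h.source.nonempty_stableNorm
  obtain ⟨K, hK⟩ := h.exists_strandMap_eq hi s s'
  obtain ⟨B, hB⟩ := (h.target.mem_tilingSpace_iff s).1 hγ
  choose γn hγn hγn' using hB
  choose δn hδn hδn' using fun n => hK B (γn n) (hγn n)
  have hmap : ∀ n, h.strandMap (h.source.inflation^[n] (δn n)) = γ := fun n => by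
    rw [h.strandMap_inflation, hδn', hγn']
  have hword : ∀ n, ∃ w x, IsPath φ' w x ∧
      (h.source.inflation^[n] (δn n)).edges = pathEdges w x ∧ w ∈ allowedWords φ' := by
    intro n
    obtain ⟨D, -, hD⟩ := h.source.exists_inflation_bound s'
    have : ∀ m, ∃ B', h.source.inflation^[m] (δn n) ∈ boundedStrands s' (language φ') B' := by
      intro m
      induction m with
      | zero => exact ⟨_, hδn n⟩
      | succ m ih =>
        obtain ⟨B', hB'⟩ := ih
        exact ⟨_, by rw [Function.iterate_succ_apply']; exact hD _ (by simp) _ _ hB'⟩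
    obtain ⟨B', w, x, h1, h2, h3, -⟩ := this n
    exact ⟨w, x, h1, h2, h3⟩
  have heq : ∀ n, h.source.inflation^[n] (δn n) = δn 0 := by
    intro n
    obtain ⟨w, x, h1, h2, h3⟩ := hword n
    obtain ⟨w', x', h1', h2', h3'⟩ := hword 0
    exact h.strandMap_injective_of_recognizable hrec h1 h2 h1' h2' h3 h3'
      ((hmap n).trans (hmap 0).symm)
  exact ⟨δn 0, (h.source.mem_tilingSpace_iff s').2 ⟨_, fun n => ⟨δn n, hδn n, heq n⟩⟩, hmap 0⟩

theorem exists_homeomorph (hi : Intertwines φ' φ ρ) (hrec : Recognizable ρ (allowedWords φ')) :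
    ∃ H : tilingSpace φ' ≃ₜ tilingSpace φ, ∀ γ, (H γ).1 = h.strandMap γ.1 := by
  have := h.target.t2Space
  have : CompactSpace (tilingSpace φ') :=
    isCompact_iff_compactSpace.1 h.source.isCompact_tilingSpace
  let f : tilingSpace φ' → tilingSpace φ :=
    fun γ => ⟨h.strandMap γ.1, h.strandMap_mem_tilingSpace hi γ.2⟩
  have hf : Function.Bijective f := by
    constructor
    · intro γ δ hγδ
      obtain ⟨z, x, hx, hγ⟩ := γ.1.exists_path
      obtain ⟨z', x', hx', hδ⟩ := δ.1.exists_path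
      exact Subtype.ext (h.strandMap_injective_of_recognizable hrec hx hγ hx' hδ
        (h.source.mem_allowedWords γ.2 hx hγ) (h.source.mem_allowedWords δ.2 hx' hδ)
        (congrArg Subtype.val hγδ))
    · intro γ
      obtain ⟨δ, hδ, hδγ⟩ := h.exists_strandMap_eq_tilingSpace hi hrec γ.2
      exact ⟨⟨δ, hδ⟩, Subtype.ext hδγ⟩
  have hcont : Continuous f :=
    (h.continuous_strandMap.comp continuous_subtype_val).subtype_mk _
  exact ⟨Continuous.homeoOfEquivCompactToT2 (f := Equiv.ofBijective f hf) hcont, fun _ => rfl⟩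

end IsPisotMorphism

/-! ### Return lattices -/

omit [Nonempty 𝒜] in
lemma wordVec_mem_gammaLattice (φ : 𝒜 → List 𝒜) (u : List 𝒜) :
    wordVec φ u ∈ gammaLattice φ := by
  induction u with
  | nil => exact zero_mem _
  | cons a u ih =>
    rw [wordVec_cons]
    exact add_mem (AddSubgroup.subset_closure ⟨a, rfl⟩) ih

omit [Nonempty 𝒜] in
lemma IsPath.sub_mem_gammaLattice {φ : 𝒜 → List 𝒜} {w : ℤ → 𝒜} {x : ℤ → pisotSpace φ}
    (h : IsPath φ w x) (k l : ℤ) : x l - x k ∈ gammaLattice φ := by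
  rcases le_total k l with hkl | hkl
  · rw [h.sum_block hkl, add_sub_cancel_left]
    exact wordVec_mem_gammaLattice φ _
  · rw [h.sum_block hkl, ← neg_sub, add_sub_cancel_left]
    exact neg_mem (wordVec_mem_gammaLattice φ _)

omit [Nonempty 𝒜] in
lemma abelianV_pow_mem_returnLattice {φ : 𝒜 → List 𝒜} {v : pisotSpace φ}
    (hv : v ∈ returnLattice φ) (n : ℕ) : (abelianV φ ^ n) v ∈ returnLattice φ := by
  induction n with
  | zero => exact hv
  | succ n ih =>
    rw [pow_succ', Module.End.mul_apply]
    exact (latticeEnd φ).map_mem _ ih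

omit [Nonempty 𝒜] in
lemma returnVectors_subset_returnLattice (φ : 𝒜 → List 𝒜) (i : 𝒜) :
    returnVectors φ i ⊆ returnLattice φ := fun θ hθ =>
  ⟨AddSubgroup.subset_closure ⟨i, θ, 0, 0, hθ, rfl⟩, hθ.1⟩

namespace IsPisotMorphism

variable {φ' : ℬ → List ℬ} {φ : 𝒜 → List 𝒜} {ρ : ℬ → List 𝒜} (h : IsPisotMorphism φ' φ ρ)

include h in
lemma abelMap_pow_comm (n : ℕ) (y : pisotSpace φ') :
    (abelianV φ ^ n) (abelMap φ' φ ρ y) = abelMap φ' φ ρ ((abelianV φ' ^ n) y) := by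
  induction n with
  | zero => rfl
  | succ n ih =>
    rw [pow_succ', pow_succ', Module.End.mul_apply, Module.End.mul_apply, ih, h.abelMap_comm]

include h in
lemma abelMap_mem_gammaLattice {y : pisotSpace φ'} (hy : y ∈ gammaLattice φ') :
    abelMap φ' φ ρ y ∈ gammaLattice φ := by
  induction hy using AddSubgroup.closure_induction with
  | mem x hx =>
    obtain ⟨i, rfl⟩ := hx
    rw [h.abelMap_segVec]
    exact wordVec_mem_gammaLattice φ _
  | zero => rw [map_zero]; exact zero_mem _
  | add x y _ _ hx hy => rw [map_add]; exact add_mem hx hy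
  | neg x _ hx => rw [map_neg]; exact neg_mem hx

lemma mem_edges_strandMap {γ : Strand φ'} {i : ℬ} {x : pisotSpace φ'} (he : (i, x) ∈ γ.edges)
    {a : 𝒜} {t : List 𝒜} (ha : ρ i = a :: t) :
    (a, abelMap φ' φ ρ x) ∈ (h.strandMap γ).edges := by
  rw [edges_strandMap, h.mem_edgeMap_iff]
  exact ⟨_, he, [], t, ha, by simp⟩

include h in
lemma abelMap_returnVectors (hi : Intertwines φ' φ ρ) {i : ℬ} {θ : pisotSpace φ'}
    (hθ : θ ∈ returnVectors φ' i) : ∃ a, abelMap φ' φ ρ θ ∈ returnVectors φ a := by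
  obtain ⟨hΓ, γ, hγ, x, h1, h2⟩ := hθ
  obtain ⟨a, t, ha⟩ := List.exists_cons_of_ne_nil (h.ne_nil i)
  refine ⟨a, h.abelMap_mem_gammaLattice hΓ, h.strandMap γ, h.strandMap_mem_tilingSpace hi hγ,
    abelMap φ' φ ρ x, h.mem_edges_strandMap h1 ha, ?_⟩
  rw [← map_add]
  exact h.mem_edges_strandMap h2 ha

include h in
lemma abelMap_mem_returnGroup (hi : Intertwines φ' φ ρ) {y : pisotSpace φ'}
    (hy : y ∈ returnGroup φ') : abelMap φ' φ ρ y ∈ returnGroup φ := by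
  induction hy using AddSubgroup.closure_induction with
  | mem x hx =>
    obtain ⟨i, θ, k, l, hθ, hx⟩ := hx
    obtain ⟨a, ha⟩ := h.abelMap_returnVectors hi hθ
    exact AddSubgroup.subset_closure ⟨a, _, k, l, ha, by
      rw [h.abelMap_pow_comm, hx, h.abelMap_pow_comm]⟩
  | zero => rw [map_zero]; exact zero_mem _
  | add x y _ _ hx hy => rw [map_add]; exact add_mem hx hy
  | neg x _ hx => rw [map_neg]; exact neg_mem hx

/-- The map of pairs `(V', Σ') → (V, Σ)` induced by a morphism. -/
noncomputable def pairHom (hi : Intertwines φ' φ ρ) :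
    PairHom (returnLattice φ') (returnLattice φ) where
  lin := abelMap φ' φ ρ
  map_mem _ hx := ⟨h.abelMap_mem_returnGroup hi hx.1, h.abelMap_mem_gammaLattice hx.2⟩

include h in
/-- A power of `A` maps each return vector of `φ` to the image of a return vector of `φ'`. -/
lemma exists_returnVectors (hi : Intertwines φ' φ ρ) (hrec : Recognizable ρ (allowedWords φ'))
    {i : 𝒜} {θ : pisotSpace φ} (hθ : θ ∈ returnVectors φ i) :
    ∃ (m : ℕ) (j : ℬ), ∃ θ' ∈ returnVectors φ' j, (abelianV φ ^ m) θ = abelMap φ' φ ρ θ' := by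
  obtain ⟨-, γ, hγ, v, h1, h2⟩ := hθ
  obtain ⟨L₀, hL₀⟩ := hrec.exists_local h.ne_nil
  obtain ⟨M, hM⟩ := exists_length_le ρ
  -- The edges `I` and `I + θ` become two copies of `φ^m(i)`, long enough to contain windows of
  -- radius `L₀` around their positions `N`. Local recognizability makes the `ρ`-blocks at those
  -- positions equal, with equal offsets. As `N` also bounds block lengths, these blocks start
  -- inside the copies, so their initial vertices differ by `A^m θ`.
  obtain ⟨m, hm⟩ := h.target.isMixing.growing (2 * max L₀ M + 1)
  set N := max L₀ M with hN
  obtain ⟨w, x, hx, hγx⟩ := γ.exists_path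
  rw [hγx] at h1 h2
  obtain ⟨p, hp1, hp2⟩ := mem_pathEdges.1 h1
  obtain ⟨q, hq1, hq2⟩ := mem_pathEdges.1 h2
  simp only at hp1 hp2 hq1 hq2
  obtain ⟨c, y, X, hc, hX, hcX, hE⟩ := exists_image_of_inflation_iterate h.target
    (n := m) (γ := h.target.inflation^[m] γ) rfl hx hγx
  obtain ⟨δ, hδ, hδγ⟩ := h.exists_strandMap_eq_tilingSpace hi hrec
    (h.target.inflation_iterate_mem_tilingSpace hγ m)
  obtain ⟨z, x', hx', hδx⟩ := δ.exists_path
  obtain ⟨c', y', X', hc', hX', hcX', hE'⟩ := h.exists_image_path hx'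
  have hEE : pathEdges y X = pathEdges y' X' := by
    rw [← hE, ← hE', ← hδx, ← h.edges_strandMap, hδγ]
  obtain ⟨j, hj⟩ := h.target.path_unique hX hX' hEE
  have hy : (fun n => y' (n + -j)) = y := funext fun n => by rw [(hj _).1, neg_add_cancel_right]
  obtain ⟨d, hd, hdX⟩ : ∃ d, IsImage ρ z d y ∧ ∀ k, X (d k) = abelMap φ' φ ρ (x' k) := by
    refine ⟨fun k => c' k - -j, by rw [← hy]; exact hc'.translate (-j), fun k => ?_⟩
    beta_reduce
    rw [← hcX', (hj _).2, sub_neg_eq_add]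
  have hz := h.source.mem_allowedWords hδ hx' hδx
  have hlen : 2 * N + 1 ≤ (morPow φ m i).length := hm m le_rfl i
  have hagree : ∀ n : ℤ, 0 ≤ n → n < 2 * N + 1 → y (c q + n) = y (c p + n) := by
    intro n h0 hn
    obtain ⟨n, rfl⟩ := Int.eq_ofNat_of_zero_le h0
    rw [hc.getElem q n (by rw [hq1]; omega), hc.getElem p n (by rw [hp1]; omega)]
    simp only [hp1, hq1]
  have hmono := hd.strictMono h.ne_nil
  obtain ⟨k, hk1, hk2⟩ := hmono.exists_int_floor (c p + N)
  obtain ⟨l, hl1, hl2⟩ := hmono.exists_int_floor (c q + N)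
  obtain ⟨hzz, hdd⟩ := hL₀ _ (allowedWords_shift hz k) _ (allowedWords_shift hz l) _ _ _ _
    ((hd.shift k).translate (c p + N)) ((hd.shift l).translate (c q + N))
    (by simp only [zero_add]; omega) (by simp only [add_comm 1 k]; omega)
    (by simp only [zero_add]; omega) (by simp only [add_comm 1 l]; omega) (fun n hn => by
      rw [abs_le] at hn
      have := hagree (n + N) (by omega) (by omega)
      rw [show n + (c p + N : ℤ) = c p + (n + N) by ring, ← this,
        show n + (c q + N : ℤ) = c q + (n + N) by ring])
  simp only [zero_add] at hzz hdd
  have hkd := hd.step k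
  have hρ := hM (z k)
  have hXX : X (d l) = X (d k) + (abelianV φ ^ m) θ := by
    rw [show d l = d k + (c q - c p) by omega]
    refine hX.eq_add_of_agree hX (a := c p) (b := c p + (2 * N + 1)) (k₀ := c p)
      (fun n h0 hn => ?_) le_rfl (by omega) ?_ (by omega) (by omega)
    · have := hagree (n - c p) (by omega) (by omega)
      rwa [show c q + (n - c p) = n + (c q - c p) by ring, add_sub_cancel] at this
    · rw [add_sub_cancel, hcX, hcX, ← map_add, hq2, hp2]
  refine ⟨m, z k, x' l - x' k, ⟨hx'.sub_mem_gammaLattice k l, δ, hδ, x' k, ?_, ?_⟩, ?_⟩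
  · rw [hδx]; exact ⟨k, rfl⟩
  · rw [hδx, add_sub_cancel, hzz]; exact ⟨l, rfl⟩
  · rw [map_sub, ← hdX, ← hdX, hXX, add_sub_cancel_left]

include h in
lemma exists_pow_mem_of_returnGroup (hi : Intertwines φ' φ ρ)
    (hrec : Recognizable ρ (allowedWords φ')) {v : pisotSpace φ} (hv : v ∈ returnGroup φ) :
    ∃ m : ℕ, ∃ v' ∈ returnLattice φ', (abelianV φ ^ m) v = abelMap φ' φ ρ v' := by
  induction hv using AddSubgroup.closure_induction with
  | mem x hx =>
    obtain ⟨i, θ, k, l, hθ, hx⟩ := hx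
    obtain ⟨m, j, θ', hθ', hm⟩ := h.exists_returnVectors hi hrec hθ
    refine ⟨m + k, (abelianV φ' ^ l) θ', abelianV_pow_mem_returnLattice
      (returnVectors_subset_returnLattice φ' j hθ') l, ?_⟩
    rw [pow_add, Module.End.mul_apply, hx, ← h.abelMap_pow_comm, ← hm, ← Module.End.mul_apply,
      ← Module.End.mul_apply, ← pow_add, ← pow_add, add_comm]
  | zero => exact ⟨0, 0, zero_mem _, by simp⟩
  | add x y _ _ hx hy =>
    obtain ⟨m, v, hv, hm⟩ := hx
    obtain ⟨n, w, hw, hn⟩ := hy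
    refine ⟨m + n, (abelianV φ' ^ n) v + (abelianV φ' ^ m) w,
      add_mem (abelianV_pow_mem_returnLattice hv n) (abelianV_pow_mem_returnLattice hw m), ?_⟩
    rw [map_add, map_add, ← h.abelMap_pow_comm, ← h.abelMap_pow_comm, ← hm, ← hn,
      ← Module.End.mul_apply, ← Module.End.mul_apply, ← pow_add, ← pow_add, add_comm n m]
  | neg x _ hx =>
    obtain ⟨m, v, hv, hm⟩ := hx
    exact ⟨m, -v, neg_mem hv, by rw [map_neg, map_neg, hm]⟩

include h in
/-- A power of `A` maps the return lattice of `φ` into the image of the return lattice of `φ'`. -/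
lemma exists_pow_returnLattice (hi : Intertwines φ' φ ρ)
    (hrec : Recognizable ρ (allowedWords φ')) : ∃ m : ℕ, 0 < m ∧ ∀ v ∈ returnLattice φ,
      ∃ v' ∈ returnLattice φ', (abelianV φ ^ m) v = abelMap φ' φ ρ v' := by
  -- The exponent found for an element of `Σ` depends on that element; finite generation, inherited
  -- from `Γ`, makes it uniform.
  have hfg : (AddSubgroup.toIntSubmodule (returnLattice φ)).FG := by
    have h1 : IsNoetherian ℤ (Submodule.span ℤ (Set.range (segVec φ))) :=
      isNoetherian_span_of_finite ℤ (Set.finite_range _)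
    refine isNoetherian_submodule.1 h1 _ fun v hv => ?_
    have hv : v ∈ gammaLattice φ := hv.2
    rw [← Submodule.mem_toAddSubgroup, Submodule.span_int_eq_addSubgroupClosure]
    exact hv
  obtain ⟨F, hF⟩ := hfg
  have hFm : ∀ v ∈ F, v ∈ returnLattice φ := fun v hv => by
    have : v ∈ Submodule.span ℤ (F : Set (pisotSpace φ)) := Submodule.subset_span hv
    rwa [hF] at this
  obtain ⟨m, hm⟩ : ∃ m : ℕ, ∀ v ∈ F, ∃ v' ∈ returnLattice φ',
      (abelianV φ ^ m) v = abelMap φ' φ ρ v' := by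
    choose f hf using fun (v : pisotSpace φ) (hv : v ∈ F) =>
      h.exists_pow_mem_of_returnGroup hi hrec (hFm v hv).1
    refine ⟨∑ v : F, f v.1 v.2, fun v hv => ?_⟩
    obtain ⟨v', hv', h1⟩ := hf v hv
    have h2 : f v hv ≤ ∑ v : F, f v.1 v.2 :=
      Finset.single_le_sum (f := fun v : F => f v.1 v.2) (fun _ _ => Nat.zero_le _)
        (Finset.mem_univ ⟨v, hv⟩)
    obtain ⟨r, hr⟩ := Nat.exists_eq_add_of_le' h2
    refine ⟨_, abelianV_pow_mem_returnLattice hv' r, ?_⟩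
    rw [hr, pow_add, Module.End.mul_apply, h1, h.abelMap_pow_comm]
  have hall : ∀ v ∈ returnLattice φ, ∃ v' ∈ returnLattice φ',
      (abelianV φ ^ m) v = abelMap φ' φ ρ v' := by
    intro v hv
    replace hv : v ∈ Submodule.span ℤ (F : Set (pisotSpace φ)) := by rw [hF]; exact hv
    induction hv using Submodule.span_induction with
    | mem v hv => exact hm v hv
    | zero => exact ⟨0, zero_mem _, by simp⟩
    | add x y _ _ hx hy =>
      obtain ⟨x', h1, h1'⟩ := hx
      obtain ⟨y', h2, h2'⟩ := hy
      exact ⟨x' + y', add_mem h1 h2, by rw [map_add, map_add, h1', h2']⟩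
    | smul n x _ hx =>
      obtain ⟨x', h1, h1'⟩ := hx
      exact ⟨n • x', zsmul_mem h1 n, by rw [map_zsmul, map_zsmul, h1']⟩
  -- The extra step secures the positive exponent required in a shift equivalence.
  refine ⟨m + 1, m.succ_pos, fun v hv => ?_⟩
  obtain ⟨v', hv', h1⟩ := hall v hv
  refine ⟨abelianV φ' v', (latticeEnd φ').map_mem _ hv', ?_⟩
  rw [pow_succ', Module.End.mul_apply, h1, h.abelMap_comm]

/-! ### Geometric realizations -/

/-- Every strand contains an edge of the fixed type `i`, and its image starts with an edge of type
`a`, the first letter of `ρ i`, at the image vertex. So in each coordinate the two realizations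
differ by `P u'_i - u_a`, which depends neither on the strand nor on the coordinate. -/
lemma exists_translation (hi : Intertwines φ' φ ρ) {H : tilingSpace φ' → tilingSpace φ}
    (hH : ∀ γ, (H γ).1 = h.strandMap γ.1) {g : tilingSpace φ → solenoid (latticeEnd φ)}
    {g' : tilingSpace φ' → solenoid (latticeEnd φ')} (hg : IsGeometricRealization φ g)
    (hg' : IsGeometricRealization φ' g')
    (hcomm : ∀ x, (latticeEnd φ).lin ((h.pairHom hi).lin x) =
      (h.pairHom hi).lin ((latticeEnd φ').lin x)) :
    ∃ c, ∀ γ, g (H γ) = c + solenoidMap (h.pairHom hi) hcomm (g' γ) := by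
  obtain ⟨u, -, hu⟩ := hg
  obtain ⟨u', -, hu'⟩ := hg'
  obtain ⟨γ₀, hγ₀⟩ := h.source.tilingSpace_nonempty
  let i : ℬ := Classical.arbitrary ℬ
  obtain ⟨a, t, ha⟩ := List.exists_cons_of_ne_nil (h.ne_nil i)
  have key : ∀ (γ : tilingSpace φ') (k : ℕ),
      (g (H γ)).1 k - quotientTorusMap (h.pairHom hi) ((g' γ).1 k) =
        quotientTorusMap (h.pairHom hi) (u' i) - u a := by
    intro γ k
    obtain ⟨δ, hδ, hδγ⟩ := h.source.exists_preimage_tilingSpace γ.2 k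
    obtain ⟨w, x, hx, he⟩ := δ.exists_path
    obtain ⟨p, -, hp⟩ := h.source.isMixing.exists_block_eq
      (h.source.mem_allowedWords hδ hx he) (singleton_mem_language φ' i) 0
    have hwp : w p = i := by
      rw [List.length_singleton, Nat.cast_one, block_succ, List.cons.injEq] at hp
      exact hp.1
    have hedge : (i, x p) ∈ δ.edges := by rw [he, ← hwp]; exact ⟨p, rfl⟩
    rw [hu' γ ⟨δ, hδ⟩ k (by rw [← h.source.edges_inflation_iterate, hδγ]) i (x p) hedge,
      hu (H γ) ⟨h.strandMap δ, h.strandMap_mem_tilingSpace hi hδ⟩ k (by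
        rw [← h.target.edges_inflation_iterate, ← h.strandMap_inflation, hδγ, hH])
        a _ (h.mem_edges_strandMap hedge ha), map_sub]
    have h1 : quotientTorusMap (h.pairHom hi) (modReturn φ' (x p)) =
      modReturn φ (abelMap φ' φ ρ (x p)) := rfl
    rw [h1]; abel
  refine ⟨g (H ⟨γ₀, hγ₀⟩) - solenoidMap (h.pairHom hi) hcomm (g' ⟨γ₀, hγ₀⟩), fun γ => ?_⟩
  rw [← sub_eq_iff_eq_add]
  exact Subtype.ext (funext fun k => (key γ k).trans (key ⟨γ₀, hγ₀⟩ k).symm)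

end IsPisotMorphism

end TilingMaps

/-! ### Shift equivalences and solenoids -/

section Solenoids

variable {V V' : Type*} [AddCommGroup V] [Module ℝ V] [AddCommGroup V'] [Module ℝ V']
  {Λ : AddSubgroup V} {Λ' : AddSubgroup V'}

lemma quotientTorusMap_iterate (A : PairHom Λ Λ) (m : ℕ) (x : V) :
    (quotientTorusMap A)^[m] (QuotientAddGroup.mk x : V ⧸ Λ) =
      QuotientAddGroup.mk ((A.lin ^ m) x) := by
  induction m with
  | zero => rfl
  | succ m ih => rw [Function.iterate_succ_apply', ih, pow_succ']; rfl

lemma solenoid_iterate {A : PairHom Λ Λ} (z : solenoid A) (k m : ℕ) :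
    (quotientTorusMap A)^[m] (z.1 (k + m)) = z.1 k := by
  induction m with
  | zero => rfl
  | succ m ih =>
    rw [Function.iterate_succ_apply, ← add_assoc]
    have h : quotientTorusMap A (z.1 (k + m + 1)) = z.1 (k + m) := z.2 (k + m)
    rw [h, ih]

lemma solenoidShift_symm_iterate {A : PairHom Λ Λ} (m : ℕ) (z : solenoid A) (k : ℕ) :
    ((solenoidShift A).symm^[m] z).1 k = z.1 (k + m) := by
  induction m generalizing z with
  | zero => rfl
  | succ m ih => rw [Function.iterate_succ_apply, ih]; rfl

lemma solenoidShift_symm_iterate_add {A : PairHom Λ Λ} (m : ℕ) (z z' : solenoid A) :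
    (solenoidShift A).symm^[m] (z + z') =
      (solenoidShift A).symm^[m] z + (solenoidShift A).symm^[m] z' := by
  ext k
  simp only [solenoidShift_symm_iterate, AddSubgroup.coe_add, Pi.add_apply]

/-- The composite `TS` acts as `A'^m`, which undoes the `m` backward shifts. -/
lemma solenoidMap_shift_solenoidMap {A : PairHom Λ Λ} {A' : PairHom Λ' Λ'} {T : PairHom Λ Λ'}
    {S : PairHom Λ' Λ} (hT : ∀ x, A'.lin (T.lin x) = T.lin (A.lin x))
    (hS : ∀ x, A.lin (S.lin x) = S.lin (A'.lin x)) {m : ℕ}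
    (hTS : ∀ x, T.lin (S.lin x) = (A'.lin ^ m) x) (z : solenoid A') :
    solenoidMap T hT ((solenoidShift A).symm^[m] (solenoidMap S hS z)) = z := by
  refine Subtype.ext (funext fun k => ?_)
  have h1 : (solenoidMap T hT ((solenoidShift A).symm^[m] (solenoidMap S hS z))).1 k =
      quotientTorusMap T (((solenoidShift A).symm^[m] (solenoidMap S hS z)).1 k) := rfl
  have h2 : (solenoidMap S hS z).1 (k + m) = quotientTorusMap S (z.1 (k + m)) := rfl
  rw [h1, solenoidShift_symm_iterate, h2, ← solenoid_iterate z k m]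
  generalize z.1 (k + m) = q
  induction q using QuotientAddGroup.induction_on with
  | H x =>
    rw [quotientTorusMap_iterate, ← hTS]
    rfl

end Solenoids

/-! ### Rewritings -/

lemma StrictMono.eq_shift_of_range_eq {c c' : ℤ → ℤ} (hc : StrictMono c) (hc' : StrictMono c')
    (h : Set.range c = Set.range c') : ∃ j, ∀ k, c' k = c (k + j) := by
  choose f hf using fun k => (h.symm ▸ ⟨k, rfl⟩ : c' k ∈ Set.range c)
  have hmono : StrictMono f := fun k l hkl => hc.lt_iff_lt.1 (by rw [hf, hf]; exact hc' hkl)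
  have hsurj : Function.Surjective f := by
    intro l
    obtain ⟨k, hk⟩ := (h ▸ ⟨l, rfl⟩ : c l ∈ Set.range c')
    exact ⟨k, hc.injective (by rw [hf, hk])⟩
  have hstep : ∀ k, f (k + 1) = f k + 1 := by
    intro k
    obtain ⟨n, hn⟩ := hsurj (f k + 1)
    have h1 : k < n := hmono.lt_iff_lt.1 (by omega)
    have h2 := hmono.monotone (show k + 1 ≤ n by omega)
    have h3 := hmono (show k < k + 1 by omega)
    omega
  refine ⟨f 0, fun k => ?_⟩
  have := eq_add_of_step_eq (F := id) (F' := f) (fun k => by rw [hstep]; simp) k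
  rw [← hf k, this]
  simp

section Rewritings

variable {𝒜 ℬ : Type*} {φ : 𝒜 → List 𝒜} {φ' : ℬ → List ℬ} {ρ : ℬ → List 𝒜}

lemma IsRewriting.intertwines (h : IsRewriting φ φ' ρ) : Intertwines φ' φ ρ :=
  ⟨h.factor, h.mem_language⟩

/-- Uniqueness of the set of cutting points fixes the cuts up to a shift of indices, and then
distinctness of the words `ρ i` recovers the letters. -/
lemma IsRewriting.recognizable (h : IsRewriting φ φ' ρ) (hφ : ∀ i, φ i ≠ []) :
    Recognizable ρ (allowedWords φ') := by
  intro z hz z' hz' c c' y hc hc'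
  have hne : ∀ i, ρ i ≠ [] := h.intertwines.ne_nil
  have hcut : ∀ {z c}, IsImage ρ z c y → IsCutting (Set.range ρ) y (Set.range c) :=
    fun {z c} hc => ⟨c, hc.strictMono hne, rfl, fun k => ⟨z k, (hc.block_eq k).symm⟩⟩
  obtain ⟨j, hj⟩ := (hc.strictMono hne).eq_shift_of_range_eq (hc'.strictMono hne)
    ((h.unique_cutting y (h.intertwines.image_mem hφ hz hc)).unique (hcut hc) (hcut hc'))
  refine ⟨j, fun k => ⟨h.injective ?_, hj k⟩⟩
  rw [← hc'.block_eq, ← hc.block_eq, hj, hj, add_right_comm]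

end Rewritings

/-! ### Shift equivalences from recognizable morphisms and the final assembly -/

section Conclusion

variable {𝒜 ℬ : Type*} [Fintype 𝒜] [DecidableEq 𝒜] [Fintype ℬ] [DecidableEq ℬ]
  [Nonempty 𝒜] [Nonempty ℬ] {φ' : ℬ → List ℬ} {φ : 𝒜 → List 𝒜}

namespace IsPisotMorphism

/-- A recognizable morphism is one half of a shift equivalence. -/
lemma exists_shiftEquiv {ρ : ℬ → List 𝒜} (h : IsPisotMorphism φ' φ ρ)
    (hi : Intertwines φ' φ ρ) (hrec : Recognizable ρ (allowedWords φ')) :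
    ∃ (T : PairHom (returnLattice φ) (returnLattice φ')) (m : ℕ),
      ExpressShiftEquiv (latticeEnd φ) (latticeEnd φ') T (h.pairHom hi) ∧
      ∀ x, T.lin ((h.pairHom hi).lin x) = ((latticeEnd φ').lin ^ m) x := by
  obtain ⟨m, hm0, hm⟩ := h.exists_pow_returnLattice hi hrec
  let e := LinearEquiv.ofBijective (abelMap φ' φ ρ) h.abelMap_bijective
  have he : ∀ y, abelMap φ' φ ρ (e.symm y) = y := fun y => e.apply_symm_apply y
  have he' : ∀ y, e.symm (abelMap φ' φ ρ y) = y := fun y => e.symm_apply_apply y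
  -- The inverse of `P` need not map `Σ` into `Σ'`; precomposing with `A^m` repairs this.
  let T : PairHom (returnLattice φ) (returnLattice φ') :=
    { lin := e.symm.toLinearMap ∘ₗ abelianV φ ^ m
      map_mem := fun x hx => by
        obtain ⟨v', hv', h1⟩ := hm x hx
        rw [LinearMap.comp_apply, h1]
        change e.symm (abelMap φ' φ ρ v') ∈ _
        rwa [he'] }
  have hTS : ∀ x, T.lin ((h.pairHom hi).lin x) = ((latticeEnd φ').lin ^ m) x := fun x => by
    change e.symm ((abelianV φ ^ m) (abelMap φ' φ ρ x)) = _
    rw [h.abelMap_pow_comm, he']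
    rfl
  refine ⟨T, m, ⟨fun x => ?_, fun x => h.abelMap_comm x, ⟨m, hm0, fun x => he _⟩,
    ⟨m, hm0, hTS⟩⟩, hTS⟩
  apply h.abelMap_injective
  change abelMap φ' φ ρ (abelianV φ' (e.symm ((abelianV φ ^ m) x))) =
    abelMap φ' φ ρ (e.symm ((abelianV φ ^ m) (abelianV φ x)))
  rw [← h.abelMap_comm, he, he, ← Module.End.mul_apply, ← Module.End.mul_apply,
    ← pow_succ, ← pow_succ']

end IsPisotMorphism

variable {α : ℬ → List 𝒜} {β : 𝒜 → List ℬ}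

/-- One factor of a substitution intertwines it with the substitution of the factors in the
other order. -/
lemma IsPisotSubstitution.isPisotMorphism_of_factor (hφ : IsPisotSubstitution φ)
    (hφ' : IsPisotSubstitution φ') (h : ∀ i, φ i = extendWord α (β i))
    (h' : ∀ j, φ' j = extendWord β (α j)) :
    IsPisotMorphism φ' φ α ∧ Intertwines φ' φ α ∧ Recognizable α (allowedWords φ') := by
  obtain rfl : φ = morComp α β := funext h
  obtain rfl : φ' = morComp β α := funext h'
  have hα : ∀ j, α j ≠ [] := fun j hj => hφ'.ne_nil j (by simp [morComp, hj])
  have hβ : ∀ i, β i ≠ [] := fun i hi => hφ.ne_nil i (by simp [morComp, hi])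
  have hcomm : ∀ j, extendWord α (morComp β α j) = extendWord (morComp α β) (α j) := fun j => by
    rw [extendWord_morComp]; rfl
  refine ⟨⟨hφ', hφ, hcomm, hα⟩, ⟨hcomm, fun j => ?_⟩,
    (hφ'.isMixing.recognizable hφ'.hasNoPeriod).of_morComp hβ⟩
  -- Primitivity puts `j` in some `β a`, so `α j` is a factor of `φ a = α (β a)`.
  obtain ⟨N, hN⟩ := hφ'.isMixing.mem_morPow
  have h1 := hN (1 + N) (by omega) j j
  rw [morPow_add, morPow_one] at h1
  obtain ⟨a, -, ha⟩ : ∃ a ∈ extendWord α (morPow (morComp β α) N j), j ∈ β a := by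
    change j ∈ extendWord (morComp β α) _ at h1
    rw [extendWord_morComp] at h1
    simpa [extendWord] using h1
  have h2 := morPow_mem_language hφ.ne_nil 1 a
  rw [morPow_one] at h2
  exact language_of_infix h2 (hα j) (infix_extendWord_of_mem α ha)

end Conclusion

theorem lemma3 {𝒜 𝒜' : Type*} [Fintype 𝒜] [DecidableEq 𝒜] [Nonempty 𝒜]
    [Fintype 𝒜'] [DecidableEq 𝒜'] [Nonempty 𝒜']
    (φ : 𝒜 → List 𝒜) (φ' : 𝒜' → List 𝒜')
    (hφ : IsPisotSubstitution φ) (hφ' : IsPisotSubstitution φ') :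
    (∀ ρ : 𝒜' → List 𝒜, IsRewriting φ φ' ρ →
      ∃ h : tilingSpace φ' ≃ₜ tilingSpace φ,
        (∀ γ', (h γ').1.edges = edgeMap φ' φ ρ γ'.1.edges) ∧
        ∃ (T : PairHom (returnLattice φ) (returnLattice φ'))
          (S : PairHom (returnLattice φ') (returnLattice φ))
          (hE : ExpressShiftEquiv (latticeEnd φ) (latticeEnd φ') T S) (m : ℕ),
          ∀ g g', IsGeometricRealization φ g → IsGeometricRealization φ' g' →
            ∃ (c : solenoid (latticeEnd φ)) (c' : solenoid (latticeEnd φ')),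
              (∀ γ', g (h γ') = c + solenoidMap S hE.comm_S (g' γ')) ∧
              (∀ γ, g' (h.symm γ) =
                c' + solenoidMap T hE.comm_T ((solenoidShift (latticeEnd φ)).symm^[m] (g γ)))) ∧
    (∀ (α : 𝒜' → List 𝒜) (β : 𝒜 → List 𝒜'),
      (∀ i, φ i = extendWord α (β i)) → (∀ j, φ' j = extendWord β (α j)) →
      ∃ (hα : tilingSpace φ' ≃ₜ tilingSpace φ) (hβ : tilingSpace φ ≃ₜ tilingSpace φ'),
        (∀ γ', (hα γ').1.edges = edgeMap φ' φ α γ'.1.edges) ∧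
        (∀ γ, (hβ γ).1.edges = edgeMap φ φ' β γ.1.edges) ∧
        ∃ (T : PairHom (returnLattice φ) (returnLattice φ'))
          (S : PairHom (returnLattice φ') (returnLattice φ))
          (hE : ExpressShiftEquiv (latticeEnd φ) (latticeEnd φ') T S),
          ∀ g g', IsGeometricRealization φ g → IsGeometricRealization φ' g' →
            ∃ (c : solenoid (latticeEnd φ)) (c' : solenoid (latticeEnd φ')),
              (∀ γ', g (hα γ') = c + solenoidMap S hE.comm_S (g' γ')) ∧
              (∀ γ, g' (hβ γ) = c' + solenoidMap T hE.comm_T (g γ))) := by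
  refine ⟨fun ρ hρ => ?_, fun α β hαβ hβα => ?_⟩
  · have hi := hρ.intertwines
    have hrec := hρ.recognizable hφ.ne_nil
    have h : IsPisotMorphism φ' φ ρ := ⟨hφ', hφ, hρ.factor, hi.ne_nil⟩
    obtain ⟨H, hH⟩ := h.exists_homeomorph hi hrec
    obtain ⟨T, m, hE, hTS⟩ := h.exists_shiftEquiv hi hrec
    refine ⟨H, fun γ => by rw [hH]; rfl, T, h.pairHom hi, hE, m, fun g g' hg hg' => ?_⟩
    obtain ⟨c, hc⟩ := h.exists_translation hi hH hg hg' hE.comm_S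
    -- Applying `F̂_T` after `m` backward shifts to the first formula turns `F̂_S (g' γ')` into `g'
    -- γ'` and leaves the image of `c`, which is moved to the other side.
    refine ⟨c, -solenoidMap T hE.comm_T ((solenoidShift (latticeEnd φ)).symm^[m] c), hc,
      fun γ => ?_⟩
    have h1 := hc (H.symm γ)
    rw [H.apply_symm_apply] at h1
    rw [h1, solenoidShift_symm_iterate_add, map_add,
      solenoidMap_shift_solenoidMap hE.comm_T hE.comm_S hTS, neg_add_cancel_left]
  · obtain ⟨hα, hiα, hrα⟩ := hφ.isPisotMorphism_of_factor hφ' hαβ hβα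
    obtain ⟨hβ, hiβ, hrβ⟩ := hφ'.isPisotMorphism_of_factor hφ hβα hαβ
    obtain ⟨H, hH⟩ := hα.exists_homeomorph hiα hrα
    obtain ⟨G, hG⟩ := hβ.exists_homeomorph hiβ hrβ
    have hST : ∀ x, abelMap φ' φ α (abelMap φ φ' β x) = abelianV φ x := fun x => by
      rw [← hα.abelMap_comp hβ, ← hφ.abelMap_self, show morComp α β = φ from (funext hαβ).symm]
    have hTS : ∀ x, abelMap φ φ' β (abelMap φ' φ α x) = abelianV φ' x := fun x => by
      rw [← hβ.abelMap_comp hα, ← hφ'.abelMap_self, show morComp β α = φ' from (funext hβα).symm]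
    have hE : ExpressShiftEquiv (latticeEnd φ) (latticeEnd φ') (hβ.pairHom hiβ) (hα.pairHom hiα) :=
      ⟨fun x => hβ.abelMap_comm x, fun x => hα.abelMap_comm x,
        ⟨1, one_pos, fun x => by rw [pow_one]; exact hST x⟩,
        ⟨1, one_pos, fun x => by rw [pow_one]; exact hTS x⟩⟩
    refine ⟨H, G, fun γ => by rw [hH]; rfl, fun γ => by rw [hG]; rfl, hβ.pairHom hiβ,
      hα.pairHom hiα, hE, fun g g' hg hg' => ?_⟩
    obtain ⟨c, hc⟩ := hα.exists_translation hiα hH hg hg' hE.comm_S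
    obtain ⟨c', hc'⟩ := hβ.exists_translation hiβ hG hg' hg hE.comm_T
    exact ⟨c, c', hc, hc'⟩
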